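/- Fix $0<q<1$ and write $(a)_\infty=\prod_{i\ge 0}(1-q^ia)$, $\theta(a)=(a)_\infty(q/a)_\infty$. Let $n$ be a non-negative integer, let $\tau\in\mathbb{C}$ be an arbitrary complex number, $t=q^\tau$, and let $a_1,a_2,b_1,b_2\in\mathbb{C}$ satisfy $$|qt^{2i-2}|<1\quad\text{and}\quad q<|a_1a_2b_1b_2t^{2i-2}|\qquad(i=1,\dots,n),$$ and suppose $(t^k)_\infty\neq 0$ for $k=1,\dots,n$. Complex powers $z^s=e^{s\log z}$ of points $z\in\mathbb{C}^*$ are taken with respect to any fixed determination of the logarithm satisfying $\log(qz)=\log z+\log q$. For $z\in(\mathbb{C}^*)^n$ put $$\Phi(z)=\prod_{i=1}^n z_i\frac{(qa_1^{-1}z_i)_\infty}{(b_1z_i)_\infty}\frac{(qa_2^{-1}z_i)_\infty}{(b_2z_i)_\infty}\prod_{1\le i<j\le n}z_i^{2\tau-1}\frac{(qt^{-1}z_j/z_i)_\infty}{(tz_j/z_i)_\infty},\qquad \Delta(z)=\prod_{1\le i<j\le n}(z_i-z_j),$$ and for $x\in(\mathbb{C}^*)^n$ define $$J(x)=(1-q)^n\sum_{\nu\in\mathbb{Z}^n}\Phi(x_1q^{\nu_1},\dots,x_nq^{\nu_n})\,\Delta(x_1q^{\nu_1},\dots,x_nq^{\nu_n}),$$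 where at a point $xq^\nu$ at which a numerator factor of $\Phi$ vanishes the term is $0$. For $x_1,x_2\in\mathbb{C}^*$ and $0\le i\le n$ let $$\zeta_i(x_1,x_2)=(x_1,x_1t,\dots,x_1t^{i-1},x_2,x_2t,\dots,x_2t^{n-i-1}).$$ (1) Let $x_1,x_2\in\mathbb{C}^*$ be such that $\theta(x_ib_jt^{k-1})\neq0$ for $i,j\in\{1,2\}$, $1\le k\le n$, and $\theta(x_2x_1^{-1}t^{m})\neq 0$ for all integers $m$ with $|m|<n$. Then the series $J(\zeta_i(x_1,x_2))$, $0\le i\le n$, converge absolutely, and $$\sum_{i=0}^{n}J(\zeta_i(x_1,x_2))\prod_{j=1}^{i}\frac{(x_1t^{j-1})^{-1-2(n-j)\tau}}{\theta(x_2x_1^{-1}t^{-j+1})}\prod_{k=1}^{n-i}\frac{(x_2t^{k-1})^{-1-2(n-i-k)\tau}}{\theta(x_1x_2^{-1}t^{i-k+1})}=C_0\prod_{k=1}^n\frac{\theta(x_1x_2b_1b_2t^{n+k-2})}{\prod_{i=1}^2\prod_{j=1}^2\theta(x_ib_jt^{k-1})},$$ where $C_0$ does not depend on $x_1,x_2$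 and is given by $$C_0=(1-q)^n\prod_{k=1}^n\frac{(q)_\infty(t)_\infty\prod_{i=1}^2\prod_{j=1}^2(qa_i^{-1}b_j^{-1}t^{-(k-1)})_\infty}{(t^{k})_\infty(qa_1^{-1}a_2^{-1}b_1^{-1}b_2^{-1}t^{-(n+k-2)})_\infty}.$$ (2) Suppose moreover that $\theta(t^k)\neq 0$ for $k=1,\dots,n$ (if $n\ge1$, in particular $\tau\notin\mathbb{Z}$), and put $$h(x)=\prod_{i=1}^n\frac{x_i}{\theta(b_1x_i)\theta(b_2x_i)}\prod_{1\le i<j\le n}x_i^{2\tau}\frac{\theta(x_j/x_i)}{\theta(tx_j/x_i)}.$$ There is a holomorphic function $\mathcal{J}$ on $(\mathbb{C}^*)^n$, the regularization of $J$, such that $J(x)$ converges absolutely and $\mathcal{J}(x)=J(x)/h(x)$ at all $x\in(\mathbb{C}^*)^n$ with $\theta(b_lx_i)\ne0$ for all $l,i$, and $\theta(x_j/x_i)\neq0$, $\theta(tx_j/x_i)\ne0$ for all $i<j$. With $$H_i(x_1,x_2)=\prod_{j=1}^{i}\frac{\theta(x_2b_1t^{n-j})\theta(x_2b_2t^{n-j})}{\theta(t^{j})\theta(x_2x_1^{-1}t^{n-i-j+1})}\prod_{k=1}^{n-i}\frac{\theta(x_1b_1t^{n-k})\theta(x_1b_2t^{n-k})}{\theta(t^{k})\theta(x_1x_2^{-1}t^{i-k+1})}\prod_{l=1}^n\frac{\theta(t^l)}{\theta(x_1x_2b_1b_2t^{n+l-2})}$$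 one has, for all $x_1,x_2\in\mathbb{C}^*$ with $\theta(x_2x_1^{-1}t^{m})\neq0$ for all integers $|m|<n$ and $\theta(x_1x_2b_1b_2t^{n+l-2})\neq0$ for $1\le l\le n$, $$\sum_{i=0}^{n}\mathcal{J}(\zeta_i(x_1,x_2))\,H_i(x_1,x_2)=C_1,$$ where $C_1$ does not depend on $x_1,x_2$ and is given by $$C_1=(1-q)^n\prod_{k=1}^n\frac{(q)_\infty(qt^{-k})_\infty\prod_{i=1}^2\prod_{j=1}^2(qa_i^{-1}b_j^{-1}t^{-(k-1)})_\infty}{(qt^{-1})_\infty(qa_1^{-1}a_2^{-1}b_1^{-1}b_2^{-1}t^{-(n+k-2)})_\infty}.$$ -/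

import Mathlib

namespace SelbergJackson

noncomputable section

/-- The infinite `q`-shifted factorial `(a)_∞ = ∏_{i ≥ 0} (1 - q^i a)`. -/
def qPoch (q : ℝ) (a : ℂ) : ℂ := ∏' i : ℕ, (1 - (q : ℂ) ^ i * a)

/-- The theta function `θ(a) = (a)_∞ (q/a)_∞`. -/
def theta (q : ℝ) (a : ℂ) : ℂ := qPoch q a * qPoch q ((q : ℂ) / a)

/-- `lg` is a determination of the logarithm on `ℂ \ {0}` that is compatible with the `q`-shift
`z ↦ q z`.  The principal logarithm is one.  The complex powers of the coordinates
are taken with respect to such a determination. -/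
def IsQLog (q : ℝ) (lg : ℂ → ℂ) : Prop :=
  ∀ z : ℂ, z ≠ 0 →
    Complex.exp (lg z) = z ∧ lg ((q : ℂ) * z) = lg z + (Real.log q : ℂ)

/-- The power `z ^ s = exp (s log z)` for the determination `lg` of the logarithm. -/
def powL (lg : ℂ → ℂ) (z s : ℂ) : ℂ := Complex.exp (s * lg z)

variable {n : ℕ}

/-- The integrand `Φ(z)`, where `t = q ^ τ`. The index `0 : Fin 2` stands for the subscript `1`
of `a` and `b`, and `1 : Fin 2` for the subscript `2`. -/
def Phi (q : ℝ) (τ : ℂ) (a b : Fin 2 → ℂ) (lg : ℂ → ℂ) (z : Fin n → ℂ) : ℂ :=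
  (∏ i, z i * ∏ l : Fin 2, qPoch q (q * (a l)⁻¹ * z i) / qPoch q (b l * z i)) *
  ∏ i, ∏ j ∈ Finset.Ioi i,
    powL lg (z i) (2 * τ - 1) *
      (qPoch q (q * ((q : ℂ) ^ τ)⁻¹ * (z j / z i)) / qPoch q ((q : ℂ) ^ τ * (z j / z i)))

/-- The difference product `Δ(z) = ∏_{i < j} (z_i - z_j)`. -/
def Delta (z : Fin n → ℂ) : ℂ := ∏ i, ∏ j ∈ Finset.Ioi i, (z i - z j)

/-- The term of index `ν ∈ ℤ^n` of the bilateral series: `Φ(z) Δ(z)` at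
`z = (x_1 q^{ν_1}, …, x_n q^{ν_n})`. -/
def term (q : ℝ) (τ : ℂ) (a b : Fin 2 → ℂ) (lg : ℂ → ℂ) (x : Fin n → ℂ) (ν : Fin n → ℤ) : ℂ :=
  Phi q τ a b lg (fun i => x i * (q : ℂ) ^ ν i) * Delta (fun i => x i * (q : ℂ) ^ ν i)

/-- The Jackson integral of Selberg type
`J(x) = (1 - q)^n ∑_{ν ∈ ℤ^n} Φ(x q^ν) Δ(x q^ν)`. -/
def J (q : ℝ) (τ : ℂ) (a b : Fin 2 → ℂ) (lg : ℂ → ℂ) (x : Fin n → ℂ) : ℂ :=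
  (1 - (q : ℂ)) ^ n * ∑' ν : Fin n → ℤ, term q τ a b lg x ν

/-- The point `ζ_i(x₁, x₂) = (x₁, x₁ t, …, x₁ t^{i-1}, x₂, x₂ t, …, x₂ t^{n-i-1})`. -/
def zeta (n : ℕ) (t : ℂ) (i : ℕ) (x₁ x₂ : ℂ) : Fin n → ℂ :=
  fun m => if (m : ℕ) < i then x₁ * t ^ (m : ℕ) else x₂ * t ^ ((m : ℕ) - i)

/-- The coefficient of `J(ζ_i(x₁, x₂))` in the sum. -/
def weight (n : ℕ) (q : ℝ) (τ : ℂ) (lg : ℂ → ℂ) (i : ℕ) (x₁ x₂ : ℂ) : ℂ :=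
  (∏ j ∈ Finset.Icc 1 i,
    powL lg (x₁ * ((q : ℂ) ^ τ) ^ ((j : ℤ) - 1)) (-1 - 2 * ((n : ℂ) - j) * τ) /
      theta q (x₂ * x₁⁻¹ * ((q : ℂ) ^ τ) ^ (-(j : ℤ) + 1))) *
  ∏ k ∈ Finset.Icc 1 (n - i),
    powL lg (x₂ * ((q : ℂ) ^ τ) ^ ((k : ℤ) - 1)) (-1 - 2 * ((n : ℂ) - i - k) * τ) /
      theta q (x₁ * x₂⁻¹ * ((q : ℂ) ^ τ) ^ ((i : ℤ) - k + 1))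

/-- The constant `C₀`. -/
def C₀ (n : ℕ) (q : ℝ) (t : ℂ) (a b : Fin 2 → ℂ) : ℂ :=
  (1 - (q : ℂ)) ^ n * ∏ k ∈ Finset.Icc 1 n,
    (qPoch q q * qPoch q t *
      ∏ i : Fin 2, ∏ j : Fin 2, qPoch q (q * (a i)⁻¹ * (b j)⁻¹ * t ^ (-((k : ℤ) - 1)))) /
    (qPoch q (t ^ (k : ℤ)) *
      qPoch q (q * (a 0)⁻¹ * (a 1)⁻¹ * (b 0)⁻¹ * (b 1)⁻¹ * t ^ (-((n : ℤ) + k - 2))))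

/-- The function `h(x)` of the regularization. -/
def h (q : ℝ) (τ : ℂ) (b : Fin 2 → ℂ) (lg : ℂ → ℂ) (x : Fin n → ℂ) : ℂ :=
  (∏ i, x i / (theta q (b 0 * x i) * theta q (b 1 * x i))) *
  ∏ i, ∏ j ∈ Finset.Ioi i,
    powL lg (x i) (2 * τ) * (theta q (x j / x i) / theta q ((q : ℂ) ^ τ * (x j / x i)))

/-- `F` is the regularization `𝒥` of `J`: the holomorphic function on `(ℂ^*)^n` which equals
`J(x) / h(x)` (with an absolutely convergent `J(x)`) at every point `x` at which no denominator
occurring in `J(x)` or in `h(x)` vanishes and `h(x) ≠ 0`.  These points are dense in `(ℂ^*)^n`,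
so there is at most one such function on `(ℂ^*)^n`. -/
def IsRegularization (q : ℝ) (τ : ℂ) (a b : Fin 2 → ℂ) (lg : ℂ → ℂ)
    (F : (Fin n → ℂ) → ℂ) : Prop :=
  DifferentiableOn ℂ F {x | ∀ i, x i ≠ 0} ∧
  ∀ x : Fin n → ℂ, (∀ i, x i ≠ 0) →
    (∀ i, ∀ l : Fin 2, theta q (b l * x i) ≠ 0) →
    (∀ i j, i < j → theta q (x j / x i) ≠ 0 ∧ theta q ((q : ℂ) ^ τ * (x j / x i)) ≠ 0) →
    Summable (term q τ a b lg x) ∧ F x = J q τ a b lg x / h q τ b lg x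

/-- The function `H_i(x₁, x₂)`. -/
def H (n : ℕ) (q : ℝ) (t : ℂ) (b : Fin 2 → ℂ) (i : ℕ) (x₁ x₂ : ℂ) : ℂ :=
  (∏ j ∈ Finset.Icc 1 i,
    (theta q (x₂ * b 0 * t ^ ((n : ℤ) - j)) * theta q (x₂ * b 1 * t ^ ((n : ℤ) - j))) /
    (theta q (t ^ (j : ℤ)) * theta q (x₂ * x₁⁻¹ * t ^ ((n : ℤ) - i - j + 1)))) *
  (∏ k ∈ Finset.Icc 1 (n - i),
    (theta q (x₁ * b 0 * t ^ ((n : ℤ) - k)) * theta q (x₁ * b 1 * t ^ ((n : ℤ) - k))) /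
    (theta q (t ^ (k : ℤ)) * theta q (x₁ * x₂⁻¹ * t ^ ((i : ℤ) - k + 1)))) *
  ∏ l ∈ Finset.Icc 1 n,
    theta q (t ^ (l : ℤ)) / theta q (x₁ * x₂ * b 0 * b 1 * t ^ ((n : ℤ) + l - 2))

/-- The constant `C₁`. -/
def C₁ (n : ℕ) (q : ℝ) (t : ℂ) (a b : Fin 2 → ℂ) : ℂ :=
  (1 - (q : ℂ)) ^ n * ∏ k ∈ Finset.Icc 1 n,
    (qPoch q q * qPoch q (q * t ^ (-(k : ℤ))) *
      ∏ i : Fin 2, ∏ j : Fin 2, qPoch q (q * (a i)⁻¹ * (b j)⁻¹ * t ^ (-((k : ℤ) - 1)))) /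
    (qPoch q (q * t⁻¹) *
      qPoch q (q * (a 0)⁻¹ * (a 1)⁻¹ * (b 0)⁻¹ * (b 1)⁻¹ * t ^ (-((n : ℤ) + k - 2))))

end

end SelbergJackson

open SelbergJackson

/-!
Fix `t = q ^ τ` and put `α = a⁻¹`. Dividing `Φ Δ` by the quasi-periodic function `h` and multiplying by
the elliptic Vandermonde product `A(x) = ∏_{i < j} x_i θ(x_j / x_i)` (`thetaVandermonde`) removes the
complex powers and all poles: the bilateral series becomes `G(x) = ∑_ν regTerm x ν` (`regSum`), which
converges absolutely on all of `(ℂ^*)^n` (`regTerm_summable`) and is separately holomorphic. The pair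
factors are antisymmetric, so `G` is antisymmetric, and a shift of `ν` gives the transformation of `G`
under `x_k ↦ q x_k`. Hence `F = G / A` is symmetric and, in every variable, a theta function of degree
two: `φ (q y) = φ y / (q κ y²)` with `κ = b₁ b₂ t^(n-1)` (`IsTwoTheta`). That the quotient is
holomorphic is seen without local analysis of the zeros of `A`: a theta function of degree two is
determined by its values at two points, so off the zeros of `A` the quotient coincides with an explicit
interpolation sum, which is holomorphic everywhere (`exists_regSum_eq_mul`).

The interpolation formula at the two points `x₁ t^i`, `x₂ t^j`, applied to one variable after the other,
expands the value of any such `F` at a geometric progression `(ξ, ξ t, …, ξ t^(n-1))` with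
`ξ⁻¹ = b₁ t^(n-1)` in terms of the values `F(ζ_i(x₁, x₂))` (`symmetric_expansion`). The coefficients
obey a Pascal-type recursion, which is the same interpolation formula for a product of two theta
functions; they are the functions `H_i` up to a common factor (`H_mul_prod`). This is why the sums in
the theorem do not depend on `x₁` and `x₂` beyond explicit factors.

It remains to evaluate `G` at that progression, where the series is truncated to a cone
(`coneFormula`). If `α₁ = q^N b₁ t^(n-1)`, only finitely many terms survive and the sum is, up to an
explicit factor, a polynomial of degree at most `n N` in `α₂`. It vanishes at `α₂ = b₂ t^k q^(-m)` for
`k < n` and `1 ≤ m ≤ N`: there every term of the series at the progression truncated by `b₂` is zero,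
and the value of `F` at that progression is the only one that contributes to the expansion at the
progression truncated by `b₁`. For generic `t` on the unit circle and generic `b` these are all the
roots, and a value of `α₂` that leaves a single term gives the constant (`coneFormula_circle`). The
finite sums are holomorphic in `t`, which gives the terminating case for all `t`. The special values of
`α₁` accumulate at `0`, so the identity theorem in `α₁` gives the general case.

The expansion needs `θ(t^k) ≠ 0`. The formula for `J` without regularization holds under the weaker
assumption `(t^k)_∞ ≠ 0`, and follows by letting `t' → t` along points with `θ(t'^k) ≠ 0`: on the
points `ζ_i` the indices of the nonvanishing terms increase weakly within each of the two progressions,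
and this monotonicity gives a majorant that is uniform near `t` (`redSum_continuousAt`).
-/

namespace SelbergJackson

noncomputable section

open Filter Topology Set

set_option linter.unusedSectionVars false

/-! ### The infinite `q`-shifted factorial and the theta function -/

section qPoch

variable {q : ℝ} (h0 : 0 < q) (h1 : q < 1)

lemma q_ne (h0 : 0 < q) : (q : ℂ) ≠ 0 := by exact_mod_cast h0.ne'

lemma norm_q (h0 : 0 < q) : ‖(q : ℂ)‖ = q := by simp [abs_of_pos h0]

include h0 h1

lemma summable_geom_mul (r : ℝ) : Summable fun i : ℕ => q ^ i * r :=
  (summable_geometric_of_lt_one h0.le h1).mul_right r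

lemma norm_geom_mul (a : ℂ) (i : ℕ) : ‖-((q : ℂ) ^ i * a)‖ = q ^ i * ‖a‖ := by
  rw [norm_neg, norm_mul, norm_pow, norm_q h0]

lemma multipliable_qPoch (a : ℂ) : Multipliable fun i : ℕ => 1 - (q : ℂ) ^ i * a := by
  simp only [sub_eq_add_neg]
  apply multipliable_one_add_of_summable
  simp only [norm_geom_mul h0 h1]
  exact summable_geom_mul h0 h1 _

lemma qPoch_step (a : ℂ) : qPoch q a = (1 - a) * qPoch q (q * a) := by
  have := tprod_eq_zero_mul' (f := fun i : ℕ => 1 - (q : ℂ) ^ i * a)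
    (by simpa [pow_succ, mul_assoc] using multipliable_qPoch h0 h1 (q * a))
  unfold qPoch
  rw [this]
  simp [pow_succ, mul_assoc]

lemma qPoch_split (a : ℂ) (k : ℕ) :
    qPoch q a = (∏ j ∈ Finset.range k, (1 - (q : ℂ) ^ j * a)) * qPoch q ((q : ℂ) ^ k * a) := by
  induction k with
  | zero => simp
  | succ k ih =>
    rw [ih, Finset.prod_range_succ, qPoch_step h0 h1 ((q : ℂ) ^ k * a), pow_succ']
    ring_nf

lemma qPoch_eq_zero_iff (a : ℂ) : qPoch q a = 0 ↔ ∃ k : ℕ, (q : ℂ) ^ k * a = 1 := by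
  constructor
  · contrapose!
    intro h
    unfold qPoch
    simp only [sub_eq_add_neg]
    refine tprod_one_add_ne_zero_of_summable (fun i => ?_) ?_
    · have := h i
      rw [← sub_eq_add_neg, sub_ne_zero]
      exact this.symm
    · simp only [norm_geom_mul h0 h1]
      exact summable_geom_mul h0 h1 _
  · rintro ⟨k, hk⟩
    rw [qPoch_split h0 h1 a (k + 1), Finset.prod_range_succ, hk]
    simp

lemma qPoch_ne_zero_of_norm_lt {a : ℂ} (ha : ‖a‖ < 1) : qPoch q a ≠ 0 := by
  rw [Ne, qPoch_eq_zero_iff h0 h1]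
  rintro ⟨k, hk⟩
  have := congrArg norm hk
  rw [norm_mul, norm_pow, norm_q h0, norm_one] at this
  have h2 : q ^ k ≤ 1 := pow_le_one₀ h0.le h1.le
  nlinarith [norm_nonneg a, pow_pos h0 k]

lemma qPoch_differentiable : Differentiable ℂ (qPoch q) := by
  intro a
  have key : HasProdLocallyUniformlyOn (fun (i : ℕ) (a : ℂ) => 1 + -((q : ℂ) ^ i * a))
      (fun a => ∏' i : ℕ, (1 + -((q : ℂ) ^ i * a))) (Metric.ball 0 (‖a‖ + 1)) := by
    refine Summable.hasProdLocallyUniformlyOn_nat_one_add Metric.isOpen_ball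
      (summable_geom_mul h0 h1 (‖a‖ + 1)) (Eventually.of_forall fun i x hx => ?_) (fun i => ?_)
    · rw [norm_geom_mul h0 h1]
      have : ‖x‖ < ‖a‖ + 1 := by simpa using hx
      gcongr
    · fun_prop
  have h2 : DifferentiableOn ℂ (fun a => ∏' i : ℕ, (1 + -((q : ℂ) ^ i * a)))
      (Metric.ball 0 (‖a‖ + 1)) := by
    refine key.differentiableOn (Eventually.of_forall fun s => ?_) Metric.isOpen_ball
    fun_prop
  have h3 := h2.differentiableAt (Metric.isOpen_ball.mem_nhds (x := a) (by simp))
  simpa [qPoch, sub_eq_add_neg, funext_iff] using! h3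

lemma qPoch_continuous : Continuous (qPoch q) := (qPoch_differentiable h0 h1).continuous

lemma prod_one_add_geom_le {r : ℝ} (hr : 0 ≤ r) (k : ℕ) :
    ∏ j ∈ Finset.range k, (1 + q ^ j * r) ≤ Real.exp (r / (1 - q)) := by
  calc ∏ j ∈ Finset.range k, (1 + q ^ j * r)
      ≤ ∏ j ∈ Finset.range k, Real.exp (q ^ j * r) := by
        refine Finset.prod_le_prod (fun i _ => by positivity) (fun i _ => ?_)
        rw [add_comm]; exact Real.add_one_le_exp _
    _ = Real.exp (∑ j ∈ Finset.range k, q ^ j * r) := by rw [Real.exp_sum]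
    _ ≤ Real.exp (r / (1 - q)) := by
        apply Real.exp_le_exp.2
        have := (summable_geom_mul h0 h1 r).sum_le_tsum (Finset.range k)
          (fun i _ => by positivity)
        rwa [tsum_mul_right, tsum_geometric_of_lt_one h0.le h1, inv_mul_eq_div] at this

lemma norm_prod_one_sub_geom_le (a : ℂ) (k : ℕ) :
    ‖∏ j ∈ Finset.range k, (1 - (q : ℂ) ^ j * a)‖ ≤ Real.exp (‖a‖ / (1 - q)) := by
  refine le_trans ?_ (prod_one_add_geom_le h0 h1 (norm_nonneg a) k)
  rw [norm_prod]
  refine Finset.prod_le_prod (fun i _ => norm_nonneg _) (fun i _ => ?_)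
  calc ‖1 - (q : ℂ) ^ i * a‖ ≤ ‖(1 : ℂ)‖ + ‖(q : ℂ) ^ i * a‖ := norm_sub_le _ _
    _ = 1 + q ^ i * ‖a‖ := by rw [norm_one, norm_mul, norm_pow, norm_q h0]

lemma norm_qPoch_le (a : ℂ) : ‖qPoch q a‖ ≤ Real.exp (‖a‖ / (1 - q)) := by
  have h := (multipliable_qPoch h0 h1 a).hasProd.tendsto_prod_nat
  exact le_of_tendsto h.norm (Eventually.of_forall fun k => norm_prod_one_sub_geom_le h0 h1 a k)

lemma norm_qPoch_le' {a : ℂ} {R : ℝ} (h : ‖a‖ ≤ R) : ‖qPoch q a‖ ≤ Real.exp (R / (1 - q)) := by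
  refine (norm_qPoch_le h0 h1 a).trans (Real.exp_le_exp.2 ?_)
  have : 0 < 1 - q := by linarith
  gcongr

lemma qPoch_q_ne_zero : qPoch q q ≠ 0 :=
  qPoch_ne_zero_of_norm_lt h0 h1 (by rwa [norm_q h0])

/-! Transformation rules and zeros of the theta function. -/

lemma theta_q_mul {a : ℂ} (ha : a ≠ 0) : theta q (q * a) = -a⁻¹ * theta q a := by
  have hq := q_ne h0
  unfold theta
  rw [qPoch_step h0 h1 a, show (q : ℂ) / (q * a) = a⁻¹ by field_simp, qPoch_step h0 h1 a⁻¹,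
    div_eq_mul_inv]
  field_simp
  ring

lemma theta_inv {a : ℂ} (ha : a ≠ 0) : theta q a⁻¹ = -a⁻¹ * theta q a := by
  unfold theta
  rw [qPoch_step h0 h1 a, qPoch_step h0 h1 a⁻¹, show (q : ℂ) / a⁻¹ = q * a by field_simp,
    div_eq_mul_inv]
  field_simp
  ring

lemma theta_eq_zero_iff {a : ℂ} (ha : a ≠ 0) : theta q a = 0 ↔ ∃ k : ℤ, a = (q : ℂ) ^ k := by
  have hq := q_ne h0
  unfold theta
  rw [mul_eq_zero, qPoch_eq_zero_iff h0 h1, qPoch_eq_zero_iff h0 h1]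
  constructor
  · rintro (⟨k, hk⟩ | ⟨k, hk⟩)
    · refine ⟨-k, ?_⟩
      rw [zpow_neg, zpow_natCast]
      exact (eq_inv_of_mul_eq_one_right hk)
    · refine ⟨k + 1, ?_⟩
      rw [zpow_add₀ hq, zpow_natCast, zpow_one]
      field_simp at hk
      exact hk.symm
  · rintro ⟨k, rfl⟩
    rcases le_or_gt k 0 with hk | hk
    · left
      obtain ⟨m, rfl⟩ : ∃ m : ℕ, k = -m := ⟨k.natAbs, by omega⟩
      exact ⟨m, by rw [zpow_neg, zpow_natCast, mul_inv_cancel₀ (pow_ne_zero _ hq)]⟩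
    · right
      obtain ⟨m, rfl⟩ : ∃ m : ℕ, k = m + 1 := ⟨(k - 1).natAbs, by omega⟩
      refine ⟨m, ?_⟩
      rw [zpow_add₀ hq, zpow_natCast, zpow_one]
      field_simp

lemma theta_one : theta q 1 = 0 :=
  (theta_eq_zero_iff h0 h1 one_ne_zero).2 ⟨0, by simp⟩

lemma theta_inv_eq_zero_iff {a : ℂ} (ha : a ≠ 0) : theta q a⁻¹ = 0 ↔ theta q a = 0 := by
  rw [theta_inv h0 h1 ha, mul_eq_zero]
  simp [ha]

lemma theta_differentiableAt {a : ℂ} (ha : a ≠ 0) : DifferentiableAt ℂ (theta q) a := by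
  unfold theta
  refine (qPoch_differentiable h0 h1 a).mul ?_
  exact ((qPoch_differentiable h0 h1) _).comp a
    ((differentiableAt_const _).div differentiableAt_id ha)

lemma theta_continuousAt {a : ℂ} (ha : a ≠ 0) : ContinuousAt (theta q) a :=
  (theta_differentiableAt h0 h1 ha).continuousAt

lemma theta_hasDerivAt_one : HasDerivAt (theta q) (-(qPoch q q * qPoch q q)) 1 := by
  have h2 : theta q = fun a => (1 - a) * (qPoch q (q * a) * qPoch q (q / a)) := by
    ext a
    unfold theta
    rw [qPoch_step h0 h1 a]; ring
  have h3 : DifferentiableAt ℂ (fun a : ℂ => qPoch q (q * a) * qPoch q (q / a)) 1 := by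
    refine DifferentiableAt.mul ?_ ?_
    · exact ((qPoch_differentiable h0 h1) _).comp (1 : ℂ) (by fun_prop)
    · exact ((qPoch_differentiable h0 h1) _).comp (1 : ℂ)
        ((differentiableAt_const _).div differentiableAt_id one_ne_zero)
  rw [h2]
  have := ((hasDerivAt_const (1 : ℂ) (1 : ℂ)).sub (hasDerivAt_id (1 : ℂ))).mul h3.hasDerivAt
  simpa using! this

/-! The regularized reciprocal `θ(w) / (w q^m)_∞`. -/

omit h0 h1 in
/-- The function `θ(w) / (w q ^ m)_∞`, extended to all `w ≠ 0`: it is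
`(q / (w q ^ m))_∞ (-w) ^ m q ^ (m (m - 1) / 2)`. -/
def thetaQuot (q : ℝ) (w : ℂ) (m : ℤ) : ℂ :=
  qPoch q (q / (w * (q : ℂ) ^ m)) * (-w) ^ m * (q : ℂ) ^ (m * (m - 1) / 2)

omit h0 h1 in
lemma tri_succ (m : ℤ) : (m + 1) * (m + 1 - 1) / 2 = m * (m - 1) / 2 + m := by
  rw [show (m + 1) * (m + 1 - 1) = m * (m - 1) + m * 2 by ring,
    Int.add_mul_ediv_right _ _ (by norm_num)]

omit h0 h1 in
lemma tri_neg (m : ℤ) : (-m) * (-m - 1) / 2 = m * (m - 1) / 2 + m := by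
  rw [← tri_succ]; ring_nf

lemma thetaQuot_q_mul {w : ℂ} (hw : w ≠ 0) (m : ℤ) :
    thetaQuot q (q * w) m = -w⁻¹ * thetaQuot q w (m + 1) := by
  have hq := q_ne h0
  have hw' : -w ≠ 0 := neg_ne_zero.2 hw
  unfold thetaQuot
  rw [tri_succ, zpow_add₀ hq, zpow_add₀ hq, zpow_add₀ hw', zpow_one, zpow_one,
    show -((q : ℂ) * w) = q * (-w) by ring, mul_zpow, mul_comm (q : ℂ) w, mul_assoc w,
    mul_comm (q : ℂ) ((q : ℂ) ^ m)]
  field_simp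

lemma thetaQuot_mul_qPoch {w : ℂ} (hw : w ≠ 0) (m : ℤ) :
    thetaQuot q w m * qPoch q (w * (q : ℂ) ^ m) = theta q w := by
  have hq := q_ne h0
  have key : ∀ (m : ℤ) {w : ℂ}, w ≠ 0 →
      thetaQuot q (q * w) m * qPoch q (q * w * (q : ℂ) ^ m) =
        -w⁻¹ * (thetaQuot q w (m + 1) * qPoch q (w * (q : ℂ) ^ (m + 1))) := by
    intro m w hw
    rw [thetaQuot_q_mul h0 h1 hw, zpow_add₀ hq, zpow_one]
    ring_nf
  induction m generalizing w with
  | zero => simp [thetaQuot, theta, mul_comm]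
  | succ m ih =>
    have h := key m hw
    rw [ih (mul_ne_zero hq hw), theta_q_mul h0 h1 hw] at h
    exact (mul_left_cancel₀ (by simpa using hw) h).symm
  | pred m ih =>
    have hw2 : w / q ≠ 0 := div_ne_zero hw hq
    have h := key (-(m : ℤ) - 1) hw2
    rw [sub_add_cancel, ih hw2, mul_div_cancel₀ _ hq, ← theta_q_mul h0 h1 hw2,
      mul_div_cancel₀ _ hq] at h
    exact h

lemma thetaQuot_zero (w : ℂ) : thetaQuot q w 0 = qPoch q (q / w) := by
  simp [thetaQuot]

lemma thetaQuot_eq_div {w : ℂ} (hw : w ≠ 0) {m : ℤ} (h : qPoch q (w * (q : ℂ) ^ m) ≠ 0) :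
    thetaQuot q w m = theta q w / qPoch q (w * (q : ℂ) ^ m) := by
  rw [eq_div_iff h, thetaQuot_mul_qPoch h0 h1 hw]

lemma qPoch_ne_zero_of_theta {w : ℂ} (hw : w ≠ 0) (h : theta q w ≠ 0) (m : ℤ) :
    qPoch q (w * (q : ℂ) ^ m) ≠ 0 := by
  intro h2
  apply h
  rw [← thetaQuot_mul_qPoch h0 h1 hw m, h2, mul_zero]

lemma thetaQuot_natCast {w : ℂ} (hw : w ≠ 0) (m : ℕ) :
    thetaQuot q w m = qPoch q (q / w) * ∏ j ∈ Finset.range m, (1 - (q : ℂ) ^ j * w) := by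
  have hq := q_ne h0
  induction m generalizing w with
  | zero => simp [thetaQuot_zero h0 h1]
  | succ m ih =>
    have h := thetaQuot_q_mul h0 h1 hw m
    rw [ih (mul_ne_zero hq hw)] at h
    have h2 : thetaQuot q w ((m : ℤ) + 1) = -w * (qPoch q (q / (q * w)) *
        ∏ j ∈ Finset.range m, (1 - (q : ℂ) ^ j * (q * w))) := by
      rw [h]; field_simp
    push_cast
    rw [h2, Finset.prod_range_succ', show (q : ℂ) / (q * w) = w⁻¹ by field_simp,
      qPoch_step h0 h1 w⁻¹, div_eq_mul_inv]
    simp only [pow_succ, mul_assoc, pow_zero, one_mul]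
    field_simp
    ring

lemma thetaQuot_differentiableAt {w : ℂ} (hw : w ≠ 0) (m : ℤ) :
    DifferentiableAt ℂ (fun w => thetaQuot q w m) w := by
  have hq := q_ne h0
  have := zpow_ne_zero m hq
  unfold thetaQuot
  refine DifferentiableAt.mul (DifferentiableAt.mul ?_ ?_) (differentiableAt_const _)
  · exact ((qPoch_differentiable h0 h1) _).comp w
      ((differentiableAt_const _).div (by fun_prop) (mul_ne_zero hw this))
  · exact (differentiableAt_id.neg).zpow (Or.inl (neg_ne_zero.2 hw))

end qPoch

/-! ### Quasi-periodic functions on the punctured plane -/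

section quasiperiodic

variable {q : ℝ} (h0 : 0 < q) (h1 : q < 1)

lemma exists_differentiable_quotient {f g : ℂ → ℂ} (hf : ∀ x ≠ 0, DifferentiableAt ℂ f x)
    (hg : ∀ x ≠ 0, DifferentiableAt ℂ g x)
    (hz : ∀ x ≠ 0, g x = 0 → f x = 0 ∧ deriv g x ≠ 0) :
    ∃ ψ : ℂ → ℂ, (∀ x ≠ 0, DifferentiableAt ℂ ψ x) ∧ ∀ x ≠ 0, f x = g x * ψ x := by
  classical
  refine ⟨fun x => if g x = 0 then deriv f x / deriv g x else f x / g x, ?_, ?_⟩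
  · intro x hx
    have hU : IsOpen ({0}ᶜ : Set ℂ) := isOpen_compl_singleton
    by_cases hgx : g x = 0
    · obtain ⟨hfx, hdg⟩ := hz x hx hgx
      have hx' : ({0}ᶜ : Set ℂ) ∈ 𝓝 x := hU.mem_nhds hx
      have df : DifferentiableAt ℂ (dslope f x) x :=
        ((Complex.differentiableOn_dslope hx').2
          fun y hy => (hf y hy).differentiableWithinAt).differentiableAt hx'
      have dg : DifferentiableAt ℂ (dslope g x) x :=
        ((Complex.differentiableOn_dslope hx').2
          fun y hy => (hg y hy).differentiableWithinAt).differentiableAt hx'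
      have hne : dslope g x x ≠ 0 := by rwa [dslope_same]
      refine (df.div dg hne).congr_of_eventuallyEq ?_
      filter_upwards [dg.continuousAt.eventually_ne hne] with y hy
      by_cases hyx : y = x
      · subst hyx
        simp [hgx]
      · have hsub : y - x ≠ 0 := sub_ne_zero.2 hyx
        have e1 : g y = (y - x) * dslope g x y := by
          have := sub_smul_dslope g x y
          rw [hgx, sub_zero, smul_eq_mul] at this
          exact this.symm
        have e2 : f y = (y - x) * dslope f x y := by
          have := sub_smul_dslope f x y
          rw [hfx, sub_zero, smul_eq_mul] at this
          exact this.symm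
        have hgy : g y ≠ 0 := by rw [e1]; exact mul_ne_zero hsub hy
        simp only [hgy, if_false, Pi.div_apply]
        rw [e1, e2, mul_div_mul_left _ _ hsub]
    · refine ((hf x hx).div (hg x hx) hgx).congr_of_eventuallyEq ?_
      filter_upwards [(hg x hx).continuousAt.eventually_ne hgx] with y hy
      simp [hy]
  · intro x hx
    by_cases hgx : g x = 0
    · simp [hgx, (hz x hx hgx).1]
    · simp only [hgx, if_false]
      field_simp

include h0 h1

/-- All zeros of the theta function are simple. -/
lemma deriv_theta_ne_zero {p x : ℂ} (hp : p ≠ 0) (hx : x ≠ 0) (h : theta q (x / p) = 0) :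
    deriv (fun x => theta q (x / p)) x ≠ 0 := by
  have hq := q_ne h0
  obtain ⟨k, hk⟩ := (theta_eq_zero_iff h0 h1 (div_ne_zero hx hp)).1 h
  -- near `x`, the function is a nonvanishing multiple of `y ↦ θ(y / x)`
  have key : ∀ k : ℤ, ∃ M : ℂ → ℂ, (∀ y ≠ 0, DifferentiableAt ℂ M y ∧ M y ≠ 0) ∧
      ∀ y ≠ 0, theta q ((q : ℂ) ^ k * y) = M y * theta q y := by
    intro k
    induction k with
    | zero => exact ⟨fun _ => 1, fun y _ => ⟨differentiableAt_const _, one_ne_zero⟩, by simp⟩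
    | succ k ih =>
      obtain ⟨M, hM, hM2⟩ := ih
      refine ⟨fun y => -((q : ℂ) ^ (k : ℤ) * y)⁻¹ * M y, fun y hy => ⟨?_, ?_⟩, fun y hy => ?_⟩
      · have : (q : ℂ) ^ (k : ℤ) * y ≠ 0 := mul_ne_zero (zpow_ne_zero _ hq) hy
        exact (((differentiableAt_const _).mul differentiableAt_id).inv this).neg.mul (hM y hy).1
      · simp [hq, hy, (hM y hy).2]
      · rw [mul_assoc, ← hM2 y hy, ← theta_q_mul h0 h1 (mul_ne_zero (zpow_ne_zero _ hq) hy),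
          zpow_add₀ hq, zpow_one]
        ring_nf
    | pred k ih =>
      obtain ⟨M, hM, hM2⟩ := ih
      refine ⟨fun y => -((q : ℂ) ^ (-(k : ℤ) - 1) * y) * M y, fun y hy => ⟨?_, ?_⟩,
        fun y hy => ?_⟩
      · exact ((differentiableAt_const _).mul differentiableAt_id).neg.mul (hM y hy).1
      · simp [hq, hy, (hM y hy).2, zpow_ne_zero]
      · have hw : (q : ℂ) ^ (-(k : ℤ) - 1) * y ≠ 0 := mul_ne_zero (zpow_ne_zero _ hq) hy
        have := theta_q_mul h0 h1 hw
        rw [show (q : ℂ) * ((q : ℂ) ^ (-(k : ℤ) - 1) * y) = (q : ℂ) ^ (-(k : ℤ)) * y by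
          rw [zpow_sub_one₀ hq]; field_simp] at this
        rw [mul_assoc, ← hM2 y hy, this]
        field_simp
  obtain ⟨M, hM, hM2⟩ := key k
  have hloc : (fun y => theta q (y / p)) =ᶠ[𝓝 x] fun y => M (y / x) * theta q (y / x) := by
    filter_upwards [isOpen_compl_singleton.mem_nhds (show x ∈ ({0}ᶜ : Set ℂ) from hx)] with y hy
    have hy' : y ≠ 0 := hy
    rw [← hM2 _ (div_ne_zero hy' hx), ← hk]
    congr 1; field_simp
  rw [hloc.deriv_eq]
  have dM : DifferentiableAt ℂ (fun y => M (y / x)) x := by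
    have := (hM (x / x) (div_ne_zero hx hx)).1
    exact DifferentiableAt.comp (g := M) (f := fun y => y / x) x this
      (differentiableAt_id.div_const x)
  have dT : HasDerivAt (fun y => theta q (y / x)) (-(qPoch q q * qPoch q q) * (1 / x)) x := by
    have h2 := theta_hasDerivAt_one h0 h1
    rw [← div_self hx] at h2
    exact HasDerivAt.comp (h₂ := theta q) (h := fun y => y / x) x h2
      ((hasDerivAt_id x).div_const x)
  have := (dM.hasDerivAt.mul dT).deriv
  erw [this]
  rw [div_self hx, theta_one h0 h1, mul_zero, zero_add]
  have := qPoch_q_ne_zero h0 h1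
  simp [hx, this, (hM 1 one_ne_zero).2]

lemma exists_div_theta {φ : ℂ → ℂ} (hφ : ∀ x ≠ 0, DifferentiableAt ℂ φ x) {c : ℂ} {m : ℕ}
    (hper : ∀ x ≠ 0, φ (q * x) = c * (x ^ (m + 1))⁻¹ * φ x) {p : ℂ} (hp : p ≠ 0)
    (hφp : φ p = 0) :
    ∃ ψ : ℂ → ℂ, (∀ x ≠ 0, DifferentiableAt ℂ ψ x) ∧
      (∀ x ≠ 0, φ x = theta q (x / p) * ψ x) ∧
      ∀ x ≠ 0, ψ (q * x) = -(c / p) * (x ^ m)⁻¹ * ψ x := by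
  have hq := q_ne h0
  have dth : ∀ x ≠ 0, DifferentiableAt ℂ (fun x => theta q (x / p)) x := fun x hx =>
    DifferentiableAt.comp (g := theta q) (f := fun x => x / p) x
      (theta_differentiableAt h0 h1 (div_ne_zero hx hp)) (differentiableAt_id.div_const p)
  have step : ∀ x ≠ 0, (φ (q * x) = 0 ↔ φ x = 0 ∨ c = 0) := by
    intro x hx
    rw [hper x hx]
    simp [hx, or_comm]
  have hzero : ∀ k : ℤ, c ≠ 0 → φ ((q : ℂ) ^ k * p) = 0 := by
    intro k hc
    induction k with
    | zero => simpa
    | succ k ih =>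
      rw [add_comm, zpow_add₀ hq, zpow_one, mul_assoc,
        step _ (mul_ne_zero (zpow_ne_zero _ hq) hp)]
      exact Or.inl ih
    | pred k ih =>
      have := (step ((q : ℂ) ^ (-(k : ℤ) - 1) * p) (mul_ne_zero (zpow_ne_zero _ hq) hp)).1 (by
        rw [zpow_sub_one₀ hq]; convert ih using 2; field_simp)
      simpa [hc] using this
  have hz0 : c = 0 → ∀ x ≠ 0, φ x = 0 := by
    intro hc x hx
    have := hper (x / q) (div_ne_zero hx hq)
    rw [mul_div_cancel₀ _ hq] at this
    simp [this, hc]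
  obtain ⟨ψ, hψ, hψ2⟩ := exists_differentiable_quotient hφ dth (fun x hx hx0 => by
    refine ⟨?_, deriv_theta_ne_zero h0 h1 hp hx hx0⟩
    by_cases hc : c = 0
    · exact hz0 hc x hx
    obtain ⟨k, hk⟩ := (theta_eq_zero_iff h0 h1 (div_ne_zero hx hp)).1 hx0
    have := hzero k hc
    rwa [← hk, div_mul_cancel₀ _ hp] at this)
  refine ⟨ψ, hψ, hψ2, ?_⟩
  have hmain : ∀ x ≠ 0, theta q (x / p) ≠ 0 → ψ (q * x) = -(c / p) * (x ^ m)⁻¹ * ψ x := by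
    intro x hx hne
    have e := hper x hx
    rw [hψ2 x hx, hψ2 _ (mul_ne_zero hq hx), mul_div_assoc,
      theta_q_mul h0 h1 (div_ne_zero hx hp)] at e
    have hxp : -(x / p)⁻¹ ≠ 0 := by simp [hx, hp]
    apply mul_left_cancel₀ (mul_ne_zero hxp hne)
    rw [e, pow_succ]
    field_simp
  intro x hx
  by_cases hne : theta q (x / p) = 0
  · have hd := deriv_theta_ne_zero h0 h1 hp hx hne
    have hev : ∀ᶠ y in 𝓝[≠] x, theta q (y / p) ≠ 0 :=
      (dth x hx).hasDerivAt.eventually_ne hd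
    have hev2 : ∀ᶠ y in 𝓝[≠] x, y ≠ 0 :=
      nhdsWithin_le_nhds (isOpen_compl_singleton.mem_nhds (show x ∈ ({0}ᶜ : Set ℂ) from hx))
    have c1 : ContinuousAt (fun y => ψ (q * y)) x :=
      ContinuousAt.comp (g := ψ) (hψ _ (mul_ne_zero hq hx)).continuousAt (by fun_prop)
    have c2 : ContinuousAt (fun y => -(c / p) * (y ^ m)⁻¹ * ψ y) x := by
      refine ContinuousAt.mul (ContinuousAt.mul continuousAt_const ?_) (hψ x hx).continuousAt
      exact ContinuousAt.inv₀ (by fun_prop) (pow_ne_zero _ hx)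
    refine tendsto_nhds_unique_of_eventuallyEq (c1.tendsto.mono_left nhdsWithin_le_nhds)
      (c2.tendsto.mono_left nhdsWithin_le_nhds) (l := 𝓝[≠] x) ?_
    filter_upwards [hev, hev2] with y hy hy0 using hmain y hy0 hy
  · exact hmain x hx hne

/-- A holomorphic function on the punctured plane with `g (q x) = c g x` vanishes unless `c` is
an integral power of `q`: all its Laurent coefficients are zero. -/
lemma eq_zero_of_multiplier {g : ℂ → ℂ} (hg : ∀ x ≠ 0, DifferentiableAt ℂ g x) {c : ℂ}
    (hper : ∀ x ≠ 0, g (q * x) = c * g x) (hc : ∀ k : ℤ, c ≠ (q : ℂ) ^ k) :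
    ∀ x ≠ 0, g x = 0 := by
  have hq := q_ne h0
  -- it is enough to treat the point `1`
  suffices H : ∀ g : ℂ → ℂ, (∀ x ≠ 0, DifferentiableAt ℂ g x) →
      (∀ x ≠ 0, g (q * x) = c * g x) → g 1 = 0 by
    intro x hx
    have := H (fun y => g (x * y))
      (fun y hy => DifferentiableAt.comp y (hg _ (mul_ne_zero hx hy)) (by fun_prop))
      (fun y hy => by rw [← hper _ (mul_ne_zero hx hy)]; ring_nf)
    simpa using this
  clear hper hg g
  intro g hg hper
  have hcoef : ∀ k : ℤ, (∮ z in C(0, 1), (z - 0)⁻¹ • (z ^ k * g z)) = 0 := by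
    intro k
    have hF : ∀ z ≠ 0, DifferentiableAt ℂ (fun z => z ^ k * g z) z := fun z hz =>
      (differentiableAt_id.zpow (Or.inl hz)).mul (hg z hz)
    have e1 := Complex.circleIntegral_sub_center_inv_smul_eq_of_differentiable_on_annulus_off_countable
      (c := 0) (r := q) (R := 1) (f := fun z => z ^ k * g z) h0 h1.le Set.countable_empty
      (fun z hz => by
        have hz0 : z ≠ 0 := by
          rintro rfl
          exact hz.2 (by simpa using h0)
        exact (hF z hz0).continuousAt.continuousWithinAt)
      (fun z hz => by
        have hz0 : z ≠ 0 := by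
          rintro rfl
          exact hz.1.2 (by simpa using h0.le)
        exact hF z hz0)
    have e2 : (∮ z in C(0, q), (z - 0)⁻¹ • (z ^ k * g z)) =
        (q : ℂ) ^ k * c * ∮ z in C(0, 1), (z - 0)⁻¹ • (z ^ k * g z) := by
      simp only [circleIntegral, deriv_circleMap]
      rw [← intervalIntegral.integral_const_mul]
      congr 1
      ext θ
      have hz : circleMap 0 1 θ ≠ 0 := circleMap_ne_center one_ne_zero
      have e : circleMap 0 q θ = q * circleMap 0 1 θ := by simp [circleMap]
      rw [e, hper _ hz, mul_zpow]
      simp only [sub_zero, smul_eq_mul]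
      field_simp
    rw [e2] at e1
    have hne : 1 - (q : ℂ) ^ k * c ≠ 0 := by
      intro h
      apply hc (-k)
      rw [zpow_neg]
      exact (eq_inv_of_mul_eq_one_right (by linear_combination -h))
    have : (1 - (q : ℂ) ^ k * c) * (∮ z in C(0, 1), (z - 0)⁻¹ • (z ^ k * g z)) = 0 := by
      linear_combination e1
    exact (mul_eq_zero.1 this).resolve_left hne
  have : Fact (0 < 2 * Real.pi) := ⟨by positivity⟩
  let f : C(AddCircle (2 * Real.pi), ℂ) :=
    ⟨fun x => g (AddCircle.toCircle x), by
      refine continuous_iff_continuousAt.2 fun x => ?_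
      have : ContinuousAt (fun x : AddCircle (2 * Real.pi) => (AddCircle.toCircle x : ℂ)) x :=
        (continuous_subtype_val.comp AddCircle.continuous_toCircle).continuousAt
      exact ContinuousAt.comp (g := g) (hg _ (Circle.coe_ne_zero _)).continuousAt this⟩
  have hf0 : ∀ k, fourierCoeff f k = 0 := by
    intro k
    rw [fourierCoeff_eq_intervalIntegral f k 0]
    have := hcoef (-k)
    simp only [circleIntegral, deriv_circleMap] at this
    have e : ∀ θ : ℝ, (circleMap 0 1 θ * Complex.I) • (circleMap 0 1 θ - 0)⁻¹ •
        (circleMap 0 1 θ ^ (-k) * g (circleMap 0 1 θ)) =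
        Complex.I * (fourier (-k) (θ : AddCircle (2 * Real.pi)) • f θ) := by
      intro θ
      have hz : circleMap 0 1 θ ≠ 0 := circleMap_ne_center one_ne_zero
      have e1 : (fourier (-k) (θ : AddCircle (2 * Real.pi)) : ℂ) = circleMap 0 1 θ ^ (-k) := by
        rw [fourier_coe_apply, circleMap, zero_add, Complex.ofReal_one, one_mul,
          ← Complex.exp_int_mul]
        congr 1
        have : (Real.pi : ℂ) ≠ 0 := by exact_mod_cast Real.pi_ne_zero
        push_cast
        field_simp
      have e2 : f θ = g (circleMap 0 1 θ) := by
        show g (AddCircle.toCircle (θ : AddCircle (2 * Real.pi))) = _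
        rw [AddCircle.toCircle_apply_mk, Circle.coe_exp, circleMap, zero_add, Complex.ofReal_one,
          one_mul]
        congr 2
        have : (Real.pi : ℂ) ≠ 0 := by exact_mod_cast Real.pi_ne_zero
        push_cast
        field_simp
      rw [e1, e2]
      simp only [sub_zero, smul_eq_mul]
      field_simp
    simp only [e] at this
    rw [intervalIntegral.integral_const_mul] at this
    rw [zero_add, (mul_eq_zero.1 this).resolve_left Complex.I_ne_zero, smul_zero]
  have hs := hasSum_fourier_series_of_summable (f := f)
    (by rw [show fourierCoeff f = fun _ => 0 from funext hf0]; exact summable_zero)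
  have hf : f = 0 := by
    have h2 : HasSum (fun i : ℤ => fourierCoeff f i • (fourier i : C(AddCircle (2 * Real.pi), ℂ)))
        0 := by
      simpa only [hf0, zero_smul] using
        (hasSum_zero : HasSum (fun _ : ℤ => (0 : C(AddCircle (2 * Real.pi), ℂ))) 0)
    exact hs.unique h2
  have := DFunLike.congr_fun hf (0 : AddCircle (2 * Real.pi))
  simpa [f] using this

/-- A theta function of degree `m` that vanishes at `m` inequivalent points vanishes identically,
unless the product of these points is the exceptional one. -/
lemma eq_zero_of_zeros (m : ℕ) {φ : ℂ → ℂ} (hφ : ∀ x ≠ 0, DifferentiableAt ℂ φ x) {c : ℂ}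
    (hper : ∀ x ≠ 0, φ (q * x) = c * (x ^ m)⁻¹ * φ x) (p : Fin m → ℂ) (hp : ∀ i, p i ≠ 0)
    (hφp : ∀ i, φ (p i) = 0) (hdist : ∀ i j, i < j → theta q (p j / p i) ≠ 0)
    (hc : ∀ k : ℤ, c ≠ (q : ℂ) ^ k * ∏ i, -p i) : ∀ x ≠ 0, φ x = 0 := by
  induction m generalizing φ c with
  | zero =>
    refine eq_zero_of_multiplier h0 h1 hφ (c := c) (fun x hx => ?_) (fun k => ?_)
    · simpa using hper x hx
    · simpa using hc k
  | succ m ih =>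
    obtain ⟨ψ, hψ, hψ2, hψ3⟩ := exists_div_theta h0 h1 hφ hper (hp 0) (hφp 0)
    have h := ih hψ hψ3 (fun i => p i.succ) (fun i => hp _) (fun i => ?_)
      (fun i j hij => hdist _ _ (by simpa using hij)) (fun k hk => ?_)
    · intro x hx
      rw [hψ2 x hx, h x hx, mul_zero]
    · have := hφp i.succ
      rw [hψ2 _ (hp _)] at this
      exact (mul_eq_zero.1 this).resolve_left (hdist _ _ (Fin.succ_pos i))
    · apply hc k
      rw [Fin.prod_univ_succ]
      have h00 := hp 0
      field_simp at hk
      linear_combination -hk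

end quasiperiodic

/-! ### Interpolation of theta functions of degree two -/

section interpolation

variable {q : ℝ} (h0 : 0 < q) (h1 : q < 1)

/-- The two-dimensional space of theta functions of degree two: holomorphic functions on the
punctured plane with `q κ x ^ 2 φ(q x) = φ(x)`. -/
def IsTwoTheta (q : ℝ) (κ : ℂ) (φ : ℂ → ℂ) : Prop :=
  (∀ x ≠ 0, DifferentiableAt ℂ φ x) ∧ ∀ x ≠ 0, φ (q * x) = (q * κ)⁻¹ * (x ^ 2)⁻¹ * φ x

lemma IsTwoTheta.const_mul {κ : ℂ} {φ : ℂ → ℂ} (hφ : IsTwoTheta q κ φ) (c : ℂ) :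
    IsTwoTheta q κ (fun x => c * φ x) :=
  ⟨fun x hx => (hφ.1 x hx).const_mul c, fun x hx => by simp only [hφ.2 x hx]; ring⟩

lemma IsTwoTheta.sum {ι : Type*} {κ : ℂ} (s : Finset ι) {φ : ι → ℂ → ℂ}
    (hφ : ∀ i ∈ s, IsTwoTheta q κ (φ i)) : IsTwoTheta q κ (fun x => ∑ i ∈ s, φ i x) :=
  ⟨fun x hx => DifferentiableAt.fun_sum fun i hi => (hφ i hi).1 x hx, fun x hx => by
    rw [Finset.mul_sum]; exact Finset.sum_congr rfl fun i hi => (hφ i hi).2 x hx⟩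

include h0 h1

lemma isTwoTheta_theta {κ X : ℂ} (hκ : κ ≠ 0) (hX : X ≠ 0) :
    IsTwoTheta q κ (fun y => theta q (X / y) * theta q (κ * X * y)) := by
  have hq := q_ne h0
  refine ⟨fun y hy => ?_, fun y hy => ?_⟩
  · refine DifferentiableAt.mul ?_ ?_
    · exact DifferentiableAt.comp (g := theta q) (f := fun y => X / y) y
        (theta_differentiableAt h0 h1 (div_ne_zero hX hy))
        ((differentiableAt_const _).div differentiableAt_id hy)
    · exact DifferentiableAt.comp (g := theta q) (f := fun y => κ * X * y) y
        (theta_differentiableAt h0 h1 (by simp [hκ, hX, hy])) (by fun_prop)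
  · have e1 := theta_q_mul h0 h1 (a := X / (q * y)) (by simp [hX, hq, hy])
    rw [show (q : ℂ) * (X / (q * y)) = X / y by field_simp] at e1
    have e2 := theta_q_mul h0 h1 (a := κ * X * y) (by simp [hκ, hX, hy])
    rw [show (q : ℂ) * (κ * X * y) = κ * X * (q * y) by ring] at e2
    simp only [e1, e2]
    field_simp

/-- Two-point interpolation in the space of theta functions of degree two. -/
lemma IsTwoTheta.interpolation {κ : ℂ} (hκ : κ ≠ 0) {φ : ℂ → ℂ} (hφ : IsTwoTheta q κ φ)
    {X₁ X₂ y : ℂ} (hX₁ : X₁ ≠ 0) (hX₂ : X₂ ≠ 0) (hy : y ≠ 0) (hne : theta q (X₂ / X₁) ≠ 0) :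
    theta q (κ * X₁ * X₂) * φ y =
      theta q (X₂ / y) * theta q (κ * X₂ * y) / theta q (X₂ / X₁) * φ X₁ +
      theta q (X₁ / y) * theta q (κ * X₁ * y) / theta q (X₁ / X₂) * φ X₂ := by
  have hq := q_ne h0
  have main : ∀ X₁ : ℂ, X₁ ≠ 0 → theta q (X₂ / X₁) ≠ 0 → theta q (κ * X₁ * X₂) ≠ 0 →
      theta q (κ * X₁ * X₂) * φ y =
      theta q (X₂ / y) * theta q (κ * X₂ * y) / theta q (X₂ / X₁) * φ X₁ +
      theta q (X₁ / y) * theta q (κ * X₁ * y) / theta q (X₁ / X₂) * φ X₂ := by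
    intro X₁ hX₁ hne hk
    have hne2 : theta q (X₁ / X₂) ≠ 0 := by
      rwa [← inv_div, Ne, theta_inv_eq_zero_iff h0 h1 (div_ne_zero hX₂ hX₁)]
    have d1 := isTwoTheta_theta h0 h1 hκ hX₁
    have d2 := isTwoTheta_theta h0 h1 hκ hX₂
    have := eq_zero_of_zeros h0 h1 2 (φ := fun y => theta q (κ * X₁ * X₂) * φ y -
      (theta q (X₂ / y) * theta q (κ * X₂ * y) / theta q (X₂ / X₁) * φ X₁ +
        theta q (X₁ / y) * theta q (κ * X₁ * y) / theta q (X₁ / X₂) * φ X₂))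
      (c := (q * κ)⁻¹) (fun x hx => ?_) (fun x hx => ?_) ![X₁, X₂] (fun i => ?_) (fun i => ?_)
      (fun i j hij => ?_) (fun k hk2 => ?_) y hy
    · exact sub_eq_zero.1 this
    · exact ((hφ.1 x hx).const_mul _).sub ((((d2.1 x hx).div_const _).mul_const _).add
        (((d1.1 x hx).div_const _).mul_const _))
    · have e1 := d1.2 x hx
      have e2 := d2.2 x hx
      have e3 := hφ.2 x hx
      simp only at e1 e2 e3 ⊢
      rw [e1, e2, e3]; ring
    · fin_cases i <;> simpa
    · fin_cases i
      · simp only [Fin.zero_eta, Fin.isValue, Matrix.cons_val_zero]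
        rw [div_self hX₁, theta_one h0 h1, mul_right_comm κ X₂ X₁]
        field_simp
        ring
      · simp only [Fin.mk_one, Fin.isValue, Matrix.cons_val_one, Matrix.cons_val_fin_one]
        rw [div_self hX₂, theta_one h0 h1]
        field_simp
        ring
    · have : i = 0 ∧ j = 1 := by omega
      obtain ⟨rfl, rfl⟩ := this
      simpa using hne
    · apply hk
      rw [theta_eq_zero_iff h0 h1 (by simp [hκ, hX₁, hX₂])]
      refine ⟨-k - 1, ?_⟩
      simp only [Fin.prod_univ_two, Matrix.cons_val_zero, Matrix.cons_val_one,
        Matrix.cons_val_fin_one] at hk2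
      have hqk : (q : ℂ) ^ k ≠ 0 := zpow_ne_zero _ hq
      rw [zpow_sub_one₀ hq, zpow_neg]
      field_simp at hk2 ⊢
      linear_combination -hk2
  by_cases hk : theta q (κ * X₁ * X₂) = 0
  · -- the exceptional case follows by continuity in `X₁`
    have hκX : (κ * X₂)⁻¹ ≠ 0 := by simp [hκ, hX₂]
    have e : ∀ x : ℂ, x / (κ * X₂)⁻¹ = κ * x * X₂ := fun x => by field_simp
    have hd := deriv_theta_ne_zero h0 h1 hκX hX₁ (by rwa [e])
    have hdiff : DifferentiableAt ℂ (fun x => theta q (x / (κ * X₂)⁻¹)) X₁ :=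
      DifferentiableAt.comp (g := theta q) (f := fun x => x / (κ * X₂)⁻¹) X₁
        (theta_differentiableAt h0 h1 (div_ne_zero hX₁ hκX)) (differentiableAt_id.div_const _)
    have hev : ∀ᶠ x in 𝓝[≠] X₁, theta q (x / (κ * X₂)⁻¹) ≠ 0 := hdiff.hasDerivAt.eventually_ne hd
    have hev0 : ∀ᶠ x in 𝓝[≠] X₁, x ≠ 0 := nhdsWithin_le_nhds
      (isOpen_compl_singleton.mem_nhds (show X₁ ∈ ({0}ᶜ : Set ℂ) from hX₁))
    have c1 : ContinuousAt (fun x => theta q (X₂ / x)) X₁ :=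
      ContinuousAt.comp (g := theta q) (theta_continuousAt h0 h1 (div_ne_zero hX₂ hX₁))
        (continuousAt_const.div continuousAt_id hX₁)
    have c2 : ContinuousAt (fun x => theta q (x / X₂)) X₁ :=
      ContinuousAt.comp (g := theta q) (theta_continuousAt h0 h1 (div_ne_zero hX₁ hX₂))
        (continuousAt_id.div_const _)
    have c3 : ContinuousAt (fun x => theta q (x / y)) X₁ :=
      ContinuousAt.comp (g := theta q) (theta_continuousAt h0 h1 (div_ne_zero hX₁ hy))
        (continuousAt_id.div_const _)
    have c4 : ContinuousAt (fun x => theta q (κ * x * y)) X₁ :=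
      ContinuousAt.comp (g := theta q) (theta_continuousAt h0 h1 (by simp [hκ, hX₁, hy]))
        (by fun_prop)
    have c5 : ContinuousAt (fun x => theta q (κ * x * X₂)) X₁ :=
      ContinuousAt.comp (g := theta q) (theta_continuousAt h0 h1 (by simp [hκ, hX₁, hX₂]))
        (by fun_prop)
    have hne2 : theta q (X₁ / X₂) ≠ 0 := by
      rwa [← inv_div, Ne, theta_inv_eq_zero_iff h0 h1 (div_ne_zero hX₂ hX₁)]
    have hL := c5.mul (continuousAt_const (y := φ y))
    have hR := (((continuousAt_const (y := theta q (X₂ / y) * theta q (κ * X₂ * y))).div c1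
      hne).mul (hφ.1 X₁ hX₁).continuousAt).add
      (((c3.mul c4).div c2 hne2).mul (continuousAt_const (y := φ X₂)))
    refine tendsto_nhds_unique_of_eventuallyEq (hL.tendsto.mono_left nhdsWithin_le_nhds)
      (hR.tendsto.mono_left nhdsWithin_le_nhds) (l := 𝓝[≠] X₁) ?_
    filter_upwards [hev, hev0, nhdsWithin_le_nhds (c1.eventually_ne hne)] with x hx hx0 hx1
    rw [e] at hx
    exact main x hx0 hx1 hx
  · exact main X₁ hX₁ hne hk

/-- The three-term relation of theta functions, in the form in which it gives the recursion of the
interpolation coefficients. -/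
lemma theta_three_term {B x₁ x₂ u v : ℂ} (hB : B ≠ 0) (hx₁ : x₁ ≠ 0) (hx₂ : x₂ ≠ 0)
    (hu : u ≠ 0) (hv : v ≠ 0) (hne : theta q (x₂ / x₁ * (v / u)) ≠ 0) :
    theta q (u * v) * theta q (B * x₂ * (u * v)) * theta q (B * x₁ * (u * v)) =
      theta q u * theta q (B * x₂ * (u * v ^ 2)) * theta q (B * x₁ * u) *
        theta q (x₁ / x₂ * u) / theta q (x₁ / x₂ * (u / v)) +
      theta q v * theta q (B * x₁ * (v * u ^ 2)) * theta q (B * x₂ * v) *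
        theta q (x₂ / x₁ * v) / theta q (x₂ / x₁ * (v / u)) := by
  have h := (isTwoTheta_theta h0 h1 (κ := B / x₂) (X := x₂) (div_ne_zero hB hx₂)
    hx₂).interpolation h0 h1 (div_ne_zero hB hx₂) (X₁ := x₁ * u) (X₂ := x₂ * v)
    (y := x₂ * (u * v)) (by simp [hx₁, hu]) (by simp [hx₂, hv]) (by simp [hx₂, hu, hv])
    (by rwa [show x₂ * v / (x₁ * u) = x₂ / x₁ * (v / u) by field_simp])
  have e1 : x₂ / (x₂ * (u * v)) = (u * v)⁻¹ := by field_simp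
  have e2 : x₂ * v / (x₂ * (u * v)) = u⁻¹ := by field_simp
  have e3 : x₂ * v / (x₁ * u) = x₂ / x₁ * (v / u) := by field_simp
  have e4 : x₂ / (x₁ * u) = (x₁ / x₂ * u)⁻¹ := by field_simp
  have e5 : x₁ * u / (x₂ * (u * v)) = (x₂ / x₁ * v)⁻¹ := by field_simp
  have e6 : x₂ / (x₂ * v) = v⁻¹ := by field_simp
  have e7 : x₁ * u / (x₂ * v) = (x₂ / x₁ * (v / u))⁻¹ := by field_simp
  have e8 : B / x₂ * (x₁ * u) * (x₂ * v) = B * x₁ * (u * v) := by field_simp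
  have e9 : B / x₂ * x₂ * (x₂ * (u * v)) = B * x₂ * (u * v) := by field_simp
  have e10 : B / x₂ * (x₂ * v) * (x₂ * (u * v)) = B * x₂ * (u * v ^ 2) := by field_simp
  have e11 : B / x₂ * x₂ * (x₁ * u) = B * x₁ * u := by field_simp
  have e12 : B / x₂ * (x₁ * u) * (x₂ * (u * v)) = B * x₁ * (v * u ^ 2) := by field_simp
  have e13 : B / x₂ * x₂ * (x₂ * v) = B * x₂ * v := by field_simp
  have e14 : x₁ / x₂ * (u / v) = (x₂ / x₁ * (v / u))⁻¹ := by field_simp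
  simp only [e1, e2, e3, e4, e5, e6, e7, e8, e9, e10, e11, e12, e13, e14] at h ⊢
  rw [theta_inv h0 h1 (by simp [hu, hv]), theta_inv h0 h1 hu, theta_inv h0 h1 hv,
    theta_inv h0 h1 (a := x₁ / x₂ * u) (by simp [*]),
    theta_inv h0 h1 (a := x₂ / x₁ * v) (by simp [*]),
    theta_inv h0 h1 (a := x₂ / x₁ * (v / u)) (by simp [*])] at h
  rw [theta_inv h0 h1 (a := x₂ / x₁ * (v / u)) (by simp [*])]
  generalize theta q (x₂ / x₁ * (v / u)) = T at *
  field_simp at h ⊢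
  linear_combination -h

end interpolation

/-! ### The elliptic interpolation coefficients -/

section coefficients

/-- The coefficients in the expansion of the value of a symmetric function at `(ξ, ξ t, …)`
in its values at points composed of the two progressions `x₁, x₁ t, …, x₁ t ^ (i - 1)` and
`x₂, x₂ t, …, x₂ t ^ (j - 1)`.  Here `η = ξ⁻¹`. -/
def interpCoeff (q : ℝ) (t B η x₁ x₂ : ℂ) (i j : ℕ) : ℂ :=
  (∏ l ∈ Finset.range (i + j), theta q (t ^ (l + 1))) /
    ((∏ l ∈ Finset.range i, theta q (t ^ (l + 1))) *
      ∏ l ∈ Finset.range j, theta q (t ^ (l + 1))) *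
  ((∏ l ∈ Finset.range i, theta q (η * x₂ * t ^ (-(l : ℤ)))) *
    ∏ l ∈ Finset.range i, theta q (B * x₂ * t ^ ((i : ℤ) + j - 1 - l))) *
  ((∏ l ∈ Finset.range j, theta q (η * x₁ * t ^ (-(l : ℤ)))) *
    ∏ l ∈ Finset.range j, theta q (B * x₁ * t ^ ((i : ℤ) + j - 1 - l))) /
  ((∏ l ∈ Finset.range i, theta q (x₂ / x₁ * t ^ ((j : ℤ) - l))) *
    ∏ l ∈ Finset.range j, theta q (x₁ / x₂ * t ^ ((i : ℤ) - l)))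

lemma interpCoeff_comm (q : ℝ) (t B η x₁ x₂ : ℂ) (i j : ℕ) :
    interpCoeff q t B η x₁ x₂ i j = interpCoeff q t B η x₂ x₁ j i := by
  unfold interpCoeff
  rw [add_comm (j : ℤ) i, add_comm j i]
  ring

variable {q : ℝ} (h0 : 0 < q) (h1 : q < 1) {t B η x₁ x₂ : ℂ}

include h0 h1

lemma interpCoeff_zero_succ (j : ℕ) (ht : ∀ k ∈ Finset.range (j + 1), theta q (t ^ (k + 1)) ≠ 0) :
    interpCoeff q t B η x₁ x₂ 0 (j + 1) =
      theta q (η * x₁ * t ^ (-(j : ℤ))) * theta q (B * x₁ * t ^ (j : ℤ)) /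
        theta q (x₁ / x₂ * t ^ (-(j : ℤ))) * interpCoeff q t B η x₁ x₂ 0 j := by
  unfold interpCoeff
  have hN : (∏ l ∈ Finset.range (j + 1), theta q (t ^ (l + 1))) ≠ 0 := Finset.prod_ne_zero_iff.2 ht
  have hN2 : (∏ l ∈ Finset.range j, theta q (t ^ (l + 1))) ≠ 0 :=
    Finset.prod_ne_zero_iff.2 fun k hk => ht k (by simp at hk ⊢; omega)
  simp only [Finset.range_zero, Finset.prod_empty, one_mul, zero_add, Nat.cast_zero, mul_one]
  rw [div_self hN, div_self hN2, Finset.prod_range_succ (fun l : ℕ => theta q (η * x₁ * _)),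
    Finset.prod_range_succ (fun l : ℕ => theta q (x₁ / x₂ * _)),
    Finset.prod_range_succ' (fun l : ℕ => theta q (B * x₁ * _))]
  simp only [Nat.cast_add, Nat.cast_one, zero_sub, Nat.cast_zero, sub_zero, add_sub_cancel_right]
  have e : ∀ l : ℕ, (j : ℤ) - (l + 1) = j - 1 - l := fun l => by ring
  simp only [e]
  ring

/-- The Pascal-type recursion of the interpolation coefficients, from the three-term relation. -/
lemma interpCoeff_succ_succ (htne : t ≠ 0) (hB : B ≠ 0) (hx₁ : x₁ ≠ 0) (hx₂ : x₂ ≠ 0) (i j : ℕ)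
    (ht : ∀ k ∈ Finset.range (i + j + 2), theta q (t ^ (k + 1)) ≠ 0)
    (hx : ∀ e : ℤ, |e| < i + j + 2 → theta q (x₂ / x₁ * t ^ e) ≠ 0) :
    interpCoeff q t B η x₁ x₂ (i + 1) (j + 1) =
      theta q (η * x₂ * t ^ (-(i : ℤ))) * theta q (B * x₂ * t ^ ((i : ℤ) + 2 * (j + 1))) /
        theta q (x₂ / x₁ * t ^ ((j : ℤ) + 1 - i)) * interpCoeff q t B η x₁ x₂ i (j + 1) +
      theta q (η * x₁ * t ^ (-(j : ℤ))) * theta q (B * x₁ * t ^ ((j : ℤ) + 2 * (i + 1))) /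
        theta q (x₁ / x₂ * t ^ ((i : ℤ) + 1 - j)) * interpCoeff q t B η x₁ x₂ (i + 1) j := by
  have hx' : ∀ e : ℤ, |e| < i + j + 2 → theta q (x₁ / x₂ * t ^ e) ≠ 0 := by
    intro e he
    have := hx (-e) (by rwa [abs_neg])
    rwa [show x₁ / x₂ * t ^ e = (x₂ / x₁ * t ^ (-e))⁻¹ by
      rw [zpow_neg]; field_simp, Ne, theta_inv_eq_zero_iff h0 h1 (by
        simp [hx₁, hx₂, htne, zpow_ne_zero])]
  have h3 := theta_three_term h0 h1 (B := B / t) (u := t ^ ((i : ℤ) + 1)) (v := t ^ ((j : ℤ) + 1))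
    (div_ne_zero hB htne) hx₁ hx₂ (zpow_ne_zero _ htne) (zpow_ne_zero _ htne)
    (by rw [← zpow_sub₀ htne]; refine hx _ (abs_lt.2 ⟨by omega, by omega⟩))
  have eB : ∀ (x : ℂ) (e : ℤ), B / t * x * t ^ e = B * x * t ^ (e - 1) := fun x e => by
    rw [zpow_sub_one₀ htne]; field_simp
  simp only [← zpow_natCast, ← zpow_mul, ← zpow_add₀ htne, ← zpow_sub₀ htne, eB] at h3
  have nT : ∀ k : ℕ, k ≤ i + j + 2 → (∏ l ∈ Finset.range k, theta q (t ^ (l + 1))) ≠ 0 :=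
    fun k hk => Finset.prod_ne_zero_iff.2 fun l hl => ht l (by simp at hl ⊢; omega)
  have n1 := nT (i + 1) (by omega)
  have n2 := nT (j + 1) (by omega)
  have nD1 : ∀ a b : ℕ, a + b ≤ i + j + 2 → 1 ≤ a → (∏ l ∈ Finset.range a,
      theta q (x₂ / x₁ * t ^ ((b : ℤ) - l))) ≠ 0 := fun a b hab ha =>
    Finset.prod_ne_zero_iff.2 fun l hl => hx _ (by
      simp at hl; exact abs_lt.2 ⟨by omega, by omega⟩)
  have nD2 : ∀ a b : ℕ, a + b ≤ i + j + 2 → 1 ≤ a → (∏ l ∈ Finset.range a,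
      theta q (x₁ / x₂ * t ^ ((b : ℤ) - l))) ≠ 0 := fun a b hab ha =>
    Finset.prod_ne_zero_iff.2 fun l hl => hx' _ (by
      simp at hl; exact abs_lt.2 ⟨by omega, by omega⟩)
  have m1 := nD1 (i + 1) (j + 1) (by omega) (by omega)
  have m2 := nD2 (j + 1) (i + 1) (by omega) (by omega)
  have m3 := nD1 (i + 1) j (by omega) (by omega)
  have m4 := nD2 (j + 1) i (by omega) (by omega)
  -- shifts of the products
  have s1 : theta q (x₁ / x₂ * t ^ ((i : ℤ) + 1)) *
      ∏ l ∈ Finset.range (j + 1), theta q (x₁ / x₂ * t ^ ((i : ℤ) - l)) =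
      (∏ l ∈ Finset.range (j + 1), theta q (x₁ / x₂ * t ^ (((i + 1 : ℕ) : ℤ) - l))) *
        theta q (x₁ / x₂ * t ^ ((i : ℤ) - j)) := by
    have a := Finset.prod_range_succ (fun l : ℕ => theta q (x₁ / x₂ * t ^ (((i + 1 : ℕ) : ℤ) - l)))
      (j + 1)
    rw [Finset.prod_range_succ'] at a
    push_cast at a ⊢
    simp only [add_sub_add_right_eq_sub, sub_zero] at a
    rw [← a]; ring
  have s2 : theta q (x₂ / x₁ * t ^ ((j : ℤ) + 1)) *
      ∏ l ∈ Finset.range (i + 1), theta q (x₂ / x₁ * t ^ ((j : ℤ) - l)) =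
      (∏ l ∈ Finset.range (i + 1), theta q (x₂ / x₁ * t ^ (((j + 1 : ℕ) : ℤ) - l))) *
        theta q (x₂ / x₁ * t ^ ((j : ℤ) - i)) := by
    have a := Finset.prod_range_succ (fun l : ℕ => theta q (x₂ / x₁ * t ^ (((j + 1 : ℕ) : ℤ) - l)))
      (i + 1)
    rw [Finset.prod_range_succ'] at a
    push_cast at a ⊢
    simp only [add_sub_add_right_eq_sub, sub_zero] at a
    rw [← a]; ring
  have z1 := hx' ((i : ℤ) - j) (abs_lt.2 ⟨by omega, by omega⟩)
  have z2 := hx ((j : ℤ) - i) (abs_lt.2 ⟨by omega, by omega⟩)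
  have z3 := hx' ((i : ℤ) + 1 - j) (abs_lt.2 ⟨by omega, by omega⟩)
  have z4 := hx ((j : ℤ) + 1 - i) (abs_lt.2 ⟨by omega, by omega⟩)
  have b1 : ∀ x : ℂ, ∀ k : ℕ, ∏ l ∈ Finset.range (k + 1),
      theta q (B * x * t ^ (((i + 1 : ℕ) : ℤ) + ((j + 1 : ℕ) : ℤ) - 1 - l)) =
      (∏ l ∈ Finset.range k, theta q (B * x * t ^ ((i : ℤ) + j - l))) *
        theta q (B * x * t ^ ((i : ℤ) + j + 1)) := by
    intro x k
    rw [Finset.prod_range_succ']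
    push_cast
    congr 1
    · refine Finset.prod_congr rfl fun l _ => ?_
      congr 3; ring
    · congr 3; ring
  have b2 : ∀ x : ℂ, ∀ k : ℕ, ∏ l ∈ Finset.range k,
      theta q (B * x * t ^ ((i : ℤ) + ((j + 1 : ℕ) : ℤ) - 1 - l)) =
      ∏ l ∈ Finset.range k, theta q (B * x * t ^ ((i : ℤ) + j - l)) := by
    intro x k
    push_cast
    refine Finset.prod_congr rfl fun l _ => ?_
    congr 3; ring
  have b3 : ∀ x : ℂ, ∀ k : ℕ, ∏ l ∈ Finset.range k,
      theta q (B * x * t ^ (((i + 1 : ℕ) : ℤ) + (j : ℤ) - 1 - l)) =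
      ∏ l ∈ Finset.range k, theta q (B * x * t ^ ((i : ℤ) + j - l)) := by
    intro x k
    push_cast
    refine Finset.prod_congr rfl fun l _ => ?_
    congr 3; ring
  unfold interpCoeff
  simp only [b1, b2, b3]
  rw [Finset.prod_range_succ (fun l : ℕ => theta q (B * x₁ * t ^ ((i : ℤ) + j - l))) j,
    Finset.prod_range_succ (fun l : ℕ => theta q (B * x₂ * t ^ ((i : ℤ) + j - l))) i,
    Finset.prod_range_succ (fun l : ℕ => theta q (η * x₂ * t ^ (-(l : ℤ)))) i,
    Finset.prod_range_succ (fun l : ℕ => theta q (η * x₁ * t ^ (-(l : ℤ)))) j]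
  rw [show i + 1 + (j + 1) = i + j + 1 + 1 by ring, show i + (j + 1) = i + j + 1 by ring,
    show i + 1 + j = i + j + 1 by ring, Finset.prod_range_succ _ (i + j + 1)]
  rw [show (i : ℤ) + j - j = i by ring, show (i : ℤ) + j - i = j by ring]
  -- the denominators of the two terms on the right
  have s1' : theta q (x₂ / x₁ * t ^ ((j : ℤ) + 1 - i)) *
      (∏ l ∈ Finset.range i, theta q (x₂ / x₁ * t ^ (((j + 1 : ℕ) : ℤ) - l))) =
      ∏ l ∈ Finset.range (i + 1), theta q (x₂ / x₁ * t ^ (((j + 1 : ℕ) : ℤ) - l)) := by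
    rw [Finset.prod_range_succ, mul_comm]; push_cast; rfl
  have s2' : theta q (x₁ / x₂ * t ^ ((i : ℤ) + 1 - j)) *
      (∏ l ∈ Finset.range j, theta q (x₁ / x₂ * t ^ (((i + 1 : ℕ) : ℤ) - l))) =
      ∏ l ∈ Finset.range (j + 1), theta q (x₁ / x₂ * t ^ (((i + 1 : ℕ) : ℤ) - l)) := by
    rw [Finset.prod_range_succ, mul_comm]; push_cast; rfl
  rw [← s1'] at m1 s2 ⊢
  rw [← s2'] at m2 s1 ⊢
  have n1' : (∏ l ∈ Finset.range (i + 1), theta q (t ^ (l + 1))) =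
      (∏ l ∈ Finset.range i, theta q (t ^ (l + 1))) * theta q (t ^ ((i : ℤ) + 1)) := by
    rw [Finset.prod_range_succ]; norm_cast
  have n2' : (∏ l ∈ Finset.range (j + 1), theta q (t ^ (l + 1))) =
      (∏ l ∈ Finset.range j, theta q (t ^ (l + 1))) * theta q (t ^ ((j : ℤ) + 1)) := by
    rw [Finset.prod_range_succ]; norm_cast
  rw [n1'] at n1
  rw [n2'] at n2
  rw [n1', n2']
  have n3 : theta q (t ^ (i + j + 1 + 1)) = theta q (t ^ ((i : ℤ) + 1 + (j + 1))) := by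
    congr 1
    rw [← zpow_natCast]; congr 1; push_cast; ring
  rw [n3]
  have r1 : (i : ℤ) + 1 + (j + 1) - 1 = i + j + 1 := by ring
  have r2 : (i : ℤ) + 1 + (j + 1) * ((2 : ℕ) : ℤ) - 1 = i + 2 * (j + 1) := by push_cast; ring
  have r3 : (j : ℤ) + 1 + (i + 1) * ((2 : ℕ) : ℤ) - 1 = j + 2 * (i + 1) := by push_cast; ring
  have r4 : (i : ℤ) + 1 - (j + 1) = i - j := by ring
  have r5 : (j : ℤ) + 1 - (i + 1) = j - i := by ring
  rw [r1, r2, r3, r4, r5, add_sub_cancel_right, add_sub_cancel_right] at h3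
  set N := ∏ l ∈ Finset.range (i + j + 1), theta q (t ^ (l + 1))
  set Ni := ∏ l ∈ Finset.range i, theta q (t ^ (l + 1))
  set Nj := ∏ l ∈ Finset.range j, theta q (t ^ (l + 1))
  set D1 := ∏ l ∈ Finset.range i, theta q (x₂ / x₁ * t ^ (((j + 1 : ℕ) : ℤ) - l))
  set D2 := ∏ l ∈ Finset.range j, theta q (x₁ / x₂ * t ^ (((i + 1 : ℕ) : ℤ) - l))
  set E1 := ∏ l ∈ Finset.range (i + 1), theta q (x₂ / x₁ * t ^ ((j : ℤ) - l))
  set E2 := ∏ l ∈ Finset.range (j + 1), theta q (x₁ / x₂ * t ^ ((i : ℤ) - l))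
  generalize theta q (x₁ / x₂ * t ^ ((i : ℤ) + 1)) = w1 at *
  generalize theta q (x₂ / x₁ * t ^ ((j : ℤ) + 1)) = w2 at *
  generalize theta q (x₁ / x₂ * t ^ ((i : ℤ) - j)) = y1 at *
  generalize theta q (x₂ / x₁ * t ^ ((j : ℤ) - i)) = y2 at *
  generalize theta q (x₁ / x₂ * t ^ ((i : ℤ) + 1 - j)) = y3 at *
  generalize theta q (x₂ / x₁ * t ^ ((j : ℤ) + 1 - i)) = y4 at *
  generalize theta q (t ^ ((i : ℤ) + 1)) = ti at *
  generalize theta q (t ^ ((j : ℤ) + 1)) = tj at *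
  have nNi : Ni ≠ 0 := left_ne_zero_of_mul n1
  have nti : ti ≠ 0 := right_ne_zero_of_mul n1
  have nNj : Nj ≠ 0 := left_ne_zero_of_mul n2
  have ntj : tj ≠ 0 := right_ne_zero_of_mul n2
  have nD1' : D1 ≠ 0 := right_ne_zero_of_mul m1
  have nD2' : D2 ≠ 0 := right_ne_zero_of_mul m2
  have i1 : 1 / E2 = w1 / (y3 * D2 * y1) := by
    rw [div_eq_div_iff m4 (by positivity)]; linear_combination -s1
  have i2 : 1 / E1 = w2 / (y4 * D1 * y2) := by
    rw [div_eq_div_iff m3 (by positivity)]; linear_combination -s2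
  clear_value N Ni Nj D1 D2 E1 E2
  clear s1 s2 s1' s2' n1' n2' n3 b1 b2 b3 nT nD1 nD2 hx hx' ht eB
  generalize (∏ x ∈ Finset.range i, theta q (η * x₂ * t ^ (-(x : ℤ)))) = P1
  generalize (∏ x ∈ Finset.range j, theta q (η * x₁ * t ^ (-(x : ℤ)))) = P2
  generalize (∏ l ∈ Finset.range i, theta q (B * x₂ * t ^ ((i : ℤ) + j - l))) = P3
  generalize (∏ l ∈ Finset.range j, theta q (B * x₁ * t ^ ((i : ℤ) + j - l))) = P4
  generalize theta q (η * x₂ * t ^ (-(i : ℤ))) = g1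
  generalize theta q (η * x₁ * t ^ (-(j : ℤ))) = g2
  rw [div_mul_eq_div_div _ D1 E2, div_eq_mul_one_div _ E2, i1, div_mul_eq_div_div _ E1 D2,
    div_eq_mul_one_div _ E1, i2]
  have h4 := congrArg (fun z => N * P1 * g1 * P3 * P2 * g2 * P4 /
    (Ni * ti * (Nj * tj) * (y4 * D1 * (y3 * D2))) * z) h3
  refine Eq.trans ?_ (h4.trans ?_)
  · ring
  · generalize theta q (B * x₂ * t ^ ((i : ℤ) + 2 * (j + 1))) = c1
    generalize theta q (B * x₁ * t ^ ((j : ℤ) + 2 * (i + 1))) = c2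
    generalize theta q (B * x₁ * t ^ (i : ℤ)) = c3
    generalize theta q (B * x₂ * t ^ (j : ℤ)) = c4
    field_simp

end coefficients

/-! ### Expansion of a symmetric function along two progressions -/

section expansion

/-- The point with coordinates `x₁, x₁ t, …, x₁ t ^ (i - 1)`, then `x₂, x₂ t, …, x₂ t ^ (m - i - 1)`,
then `ξ t ^ m, …, ξ t ^ (n - 1)`. -/
def mixedPoint (n : ℕ) (t x₁ x₂ ξ : ℂ) (m i : ℕ) : Fin n → ℂ := fun r =>
  if (r : ℕ) < i then x₁ * t ^ (r : ℕ)
  else if (r : ℕ) < m then x₂ * t ^ ((r : ℕ) - i) else ξ * t ^ (r : ℕ)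

lemma mixedPoint_ne_zero {n : ℕ} {t x₁ x₂ ξ : ℂ} (ht : t ≠ 0) (hx₁ : x₁ ≠ 0) (hx₂ : x₂ ≠ 0)
    (hξ : ξ ≠ 0) (m i : ℕ) (r : Fin n) : mixedPoint n t x₁ x₂ ξ m i r ≠ 0 := by
  unfold mixedPoint
  split_ifs <;> simp [*]

lemma mixedPoint_eq_zeta (n : ℕ) (t x₁ x₂ ξ : ℂ) (i : ℕ) :
    mixedPoint n t x₁ x₂ ξ n i = zeta n t i x₁ x₂ := by
  ext r
  simp [mixedPoint, zeta, r.2]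

lemma mixedPoint_zero (n : ℕ) (t x₁ x₂ ξ y : ℂ) :
    mixedPoint n t x₁ x₂ ξ 0 0 = zeta n t 0 y ξ := by
  ext r
  simp [mixedPoint, zeta]

lemma update_mixedPoint_right {n : ℕ} (t x₁ x₂ ξ : ℂ) {m i : ℕ} (hm : m < n) (hi : i ≤ m) :
    Function.update (mixedPoint n t x₁ x₂ ξ m i) ⟨m, hm⟩ (x₂ * t ^ (m - i)) =
      mixedPoint n t x₁ x₂ ξ (m + 1) i := by
  ext r
  by_cases hr : r = ⟨m, hm⟩
  · subst hr
    simp [mixedPoint, hi]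
  · have : (r : ℕ) ≠ m := fun h => hr (Fin.ext h)
    rw [Function.update_of_ne hr]
    have : (r : ℕ) < m ↔ (r : ℕ) < m + 1 := by omega
    simp [mixedPoint, this]

lemma update_mixedPoint_left {n : ℕ} (t x₁ x₂ ξ : ℂ) {m i : ℕ} (hm : m < n) (hi : i ≤ m) :
    ∃ σ : Equiv.Perm (Fin n), Function.update (mixedPoint n t x₁ x₂ ξ m i) ⟨m, hm⟩ (x₁ * t ^ i) =
      mixedPoint n t x₁ x₂ ξ (m + 1) (i + 1) ∘ σ := by
  refine ⟨⟨fun r => if (r : ℕ) = m then ⟨i, by omega⟩ else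
      if h : i ≤ (r : ℕ) ∧ (r : ℕ) < m then ⟨r + 1, by omega⟩ else r,
    fun r => if (r : ℕ) = i then ⟨m, hm⟩ else
      if h : i < (r : ℕ) ∧ (r : ℕ) ≤ m then ⟨r - 1, by omega⟩ else r, ?_, ?_⟩, ?_⟩
  · intro r
    apply Fin.ext
    dsimp only
    split_ifs <;> simp_all <;> omega
  · intro r
    apply Fin.ext
    dsimp only
    split_ifs <;> simp_all <;> omega
  · ext r
    by_cases hr : r = ⟨m, hm⟩
    · subst hr
      simp [mixedPoint]
    · have hr' : (r : ℕ) ≠ m := fun h => hr (Fin.ext h)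
      rw [Function.update_of_ne hr]
      simp only [Function.comp_apply, Equiv.coe_fn_mk, hr', if_false]
      split_ifs with h
      · simp only [mixedPoint]
        rw [if_neg (by omega), if_pos h.2, if_neg (by omega), if_pos (by omega)]
        congr 2; omega
      · simp only [mixedPoint]
        rcases lt_or_ge (r : ℕ) i with h2 | h2
        · rw [if_pos h2, if_pos (by omega)]
        · rw [if_neg (by omega), if_neg (by omega), if_neg (by omega), if_neg (by omega)]

lemma sum_pascal (m : ℕ) (c a b : ℕ → ℕ → ℂ) {G : ℕ → ℂ} (hc0 : c 0 (m + 1) = b 0 m * c 0 m)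
    (hcm : c (m + 1) 0 = a m 0 * c m 0)
    (hc : ∀ i j, i + j + 1 = m →
      c (i + 1) (j + 1) = a i (j + 1) * c i (j + 1) + b (i + 1) j * c (i + 1) j) :
    ∑ i ∈ Finset.range (m + 1), c i (m - i) * (a i (m - i) * G (i + 1) + b i (m - i) * G i) =
      ∑ i ∈ Finset.range (m + 1 + 1), c i (m + 1 - i) * G i := by
  have hmid : ∑ i ∈ Finset.range m, c (i + 1) (m + 1 - (i + 1)) * G (i + 1) =
      ∑ i ∈ Finset.range m, c i (m - i) * (a i (m - i) * G (i + 1)) +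
      ∑ i ∈ Finset.range m, c (i + 1) (m - (i + 1)) * (b (i + 1) (m - (i + 1)) * G (i + 1)) := by
    rw [← Finset.sum_add_distrib]
    refine Finset.sum_congr rfl fun i hi => ?_
    obtain ⟨j, hj⟩ : ∃ j, m = i + j + 1 := ⟨m - i - 1, by simp at hi; omega⟩
    rw [show m + 1 - (i + 1) = j + 1 by omega, show m - i = j + 1 by omega,
      show m - (i + 1) = j by omega, hc i j hj.symm]
    ring
  simp only [mul_add, Finset.sum_add_distrib]
  rw [Finset.sum_range_succ' (fun i => c i (m + 1 - i) * G i) (m + 1),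
    Finset.sum_range_succ (fun i => c (i + 1) (m + 1 - (i + 1)) * G (i + 1)) m, hmid,
    Finset.sum_range_succ _ m, Finset.sum_range_succ' _ m]
  simp only [Nat.sub_self, Nat.sub_zero, hc0, hcm]
  ring

variable {q : ℝ} (h0 : 0 < q) (h1 : q < 1)

include h0 h1

/-- A symmetric function on `(ℂ^*)^n` that is a theta function of degree two in each variable is
expanded at `(ξ, ξ t, …, ξ t ^ (n - 1))` in its values at the points `ζ_i(x₁, x₂)`. -/
theorem symmetric_expansion {n : ℕ} {t B η x₁ x₂ : ℂ} (htne : t ≠ 0) (hB : B ≠ 0) (hη : η ≠ 0)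
    (hx₁ : x₁ ≠ 0) (hx₂ : x₂ ≠ 0)
    (ht : ∀ k ∈ Finset.range n, theta q (t ^ (k + 1)) ≠ 0)
    (hx : ∀ e : ℤ, |e| < n → theta q (x₂ / x₁ * t ^ e) ≠ 0)
    {F : (Fin n → ℂ) → ℂ}
    (hsym : ∀ (σ : Equiv.Perm (Fin n)) (x : Fin n → ℂ), (∀ i, x i ≠ 0) → F (x ∘ σ) = F x)
    (hV : ∀ x : Fin n → ℂ, (∀ i, x i ≠ 0) → ∀ k,
      IsTwoTheta q (B * η) (fun y => F (Function.update x k y))) :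
    (∏ l ∈ Finset.range n, theta q (B * η * x₁ * x₂ * t ^ l)) * F (zeta n t 0 x₁ η⁻¹) =
      ∑ i ∈ Finset.range (n + 1),
        interpCoeff q t B η x₁ x₂ i (n - i) * F (zeta n t i x₁ x₂) := by
  set ξ := η⁻¹ with hξdef
  have hξ : ξ ≠ 0 := inv_ne_zero hη
  have main : ∀ m ≤ n,
      (∏ l ∈ Finset.range m, theta q (B * η * x₁ * x₂ * t ^ l)) *
        F (mixedPoint n t x₁ x₂ ξ 0 0) =
      ∑ i ∈ Finset.range (m + 1),
        interpCoeff q t B η x₁ x₂ i (m - i) * F (mixedPoint n t x₁ x₂ ξ m i) := by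
    intro m
    induction m with
    | zero => intro _; simp [interpCoeff]
    | succ m ih =>
      intro hm
      have hmn : m < n := hm
      rw [Finset.prod_range_succ, mul_right_comm, ih hmn.le, Finset.sum_mul]
      -- one interpolation step in the coordinate of index `m`
      have step : ∀ i ≤ m, F (mixedPoint n t x₁ x₂ ξ m i) * theta q (B * η * x₁ * x₂ * t ^ m) =
          theta q (η * x₂ * t ^ (-(i : ℤ))) * theta q (B * x₂ * t ^ ((i : ℤ) + 2 * ((m - i : ℕ) : ℤ)))
            / theta q (x₂ / x₁ * t ^ (((m - i : ℕ) : ℤ) - i)) *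
            F (mixedPoint n t x₁ x₂ ξ (m + 1) (i + 1)) +
          theta q (η * x₁ * t ^ (-((m - i : ℕ) : ℤ))) *
            theta q (B * x₁ * t ^ (((m - i : ℕ) : ℤ) + 2 * (i : ℤ)))
            / theta q (x₁ / x₂ * t ^ ((i : ℤ) - ((m - i : ℕ) : ℤ))) *
            F (mixedPoint n t x₁ x₂ ξ (m + 1) i) := by
        intro i hi
        obtain ⟨j, rfl⟩ : ∃ j, m = i + j := ⟨m - i, by omega⟩
        have hmp := mixedPoint_ne_zero (n := n) htne hx₁ hx₂ hξ (i + j) i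
        have h := (hV _ hmp ⟨i + j, hmn⟩).interpolation h0 h1 (mul_ne_zero hB hη)
          (X₁ := x₁ * t ^ i) (X₂ := x₂ * t ^ j) (y := ξ * t ^ (i + j))
          (by simp [hx₁, htne]) (by simp [hx₂, htne]) (by simp [hξ, htne])
          (by
            have := hx ((j : ℤ) - i) (abs_lt.2 ⟨by omega, by omega⟩)
            rwa [zpow_sub₀ htne, zpow_natCast, zpow_natCast, div_mul_div_comm] at this)
        obtain ⟨σ, hσ⟩ := update_mixedPoint_left t x₁ x₂ ξ hmn hi
        have hR := update_mixedPoint_right t x₁ x₂ ξ hmn hi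
        rw [Nat.add_sub_cancel_left] at hR ⊢
        rw [hσ, hR, hsym σ _ (mixedPoint_ne_zero htne hx₁ hx₂ hξ _ _)] at h
        have hself : Function.update (mixedPoint n t x₁ x₂ ξ (i + j) i) ⟨i + j, hmn⟩
            (ξ * t ^ (i + j)) = mixedPoint n t x₁ x₂ ξ (i + j) i := by
          rw [Function.update_eq_self_iff]
          simp [mixedPoint]
        rw [hself] at h
        have e1 : B * η * (x₁ * t ^ i) * (x₂ * t ^ j) = B * η * x₁ * x₂ * t ^ (i + j) := by
          rw [pow_add]; ring
        have e2 : x₂ * t ^ j / (ξ * t ^ (i + j)) = η * x₂ * t ^ (-(i : ℤ)) := by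
          rw [pow_add, zpow_neg, zpow_natCast, hξdef]; field_simp
        have e3 : x₁ * t ^ i / (ξ * t ^ (i + j)) = η * x₁ * t ^ (-(j : ℤ)) := by
          rw [pow_add, zpow_neg, zpow_natCast, hξdef]; field_simp
        have e4 : B * η * (x₂ * t ^ j) * (ξ * t ^ (i + j)) =
            B * x₂ * t ^ ((i : ℤ) + 2 * j) := by
          rw [show (i : ℤ) + 2 * j = ((i + 2 * j : ℕ) : ℤ) by push_cast; ring, zpow_natCast, hξdef]
          field_simp
          ring
        have e5 : B * η * (x₁ * t ^ i) * (ξ * t ^ (i + j)) =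
            B * x₁ * t ^ ((j : ℤ) + 2 * i) := by
          rw [show (j : ℤ) + 2 * i = ((j + 2 * i : ℕ) : ℤ) by push_cast; ring, zpow_natCast, hξdef]
          field_simp
          ring
        have e6 : x₂ * t ^ j / (x₁ * t ^ i) = x₂ / x₁ * t ^ ((j : ℤ) - i) := by
          rw [zpow_sub₀ htne, zpow_natCast, zpow_natCast, div_mul_div_comm]
        have e7 : x₁ * t ^ i / (x₂ * t ^ j) = x₁ / x₂ * t ^ ((i : ℤ) - j) := by
          rw [zpow_sub₀ htne, zpow_natCast, zpow_natCast, div_mul_div_comm]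
        rw [e1, e2, e3, e4, e5, e6, e7] at h
        rw [mul_comm, h]
      have hb : ∀ k ∈ Finset.range (m + 1), theta q (t ^ (k + 1)) ≠ 0 := fun k hk =>
        ht k (by simp at hk ⊢; omega)
      rw [← sum_pascal m (interpCoeff q t B η x₁ x₂)
        (fun i j => theta q (η * x₂ * t ^ (-(i : ℤ))) * theta q (B * x₂ * t ^ ((i : ℤ) + 2 * (j : ℤ)))
            / theta q (x₂ / x₁ * t ^ ((j : ℤ) - i)))
        (fun i j => theta q (η * x₁ * t ^ (-(j : ℤ))) * theta q (B * x₁ * t ^ ((j : ℤ) + 2 * (i : ℤ)))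
            / theta q (x₁ / x₂ * t ^ ((i : ℤ) - j)))]
      · refine Finset.sum_congr rfl fun i hi => ?_
        rw [mul_assoc, step i (by simp at hi; omega)]
      · rw [interpCoeff_zero_succ h0 h1 m hb]
        simp
      · rw [interpCoeff_comm, interpCoeff_zero_succ h0 h1 m hb, interpCoeff_comm _ _ _ _ _ _ 0 m]
        simp
      · intro i j hij
        rw [interpCoeff_succ_succ h0 h1 htne hB hx₁ hx₂ i j
          (fun l hl => ht l (by simp at hl ⊢; omega))
          (fun e he => hx e (he.trans_le (by omega)))]
        push_cast
        rfl
  have := main n le_rfl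
  rw [mixedPoint_zero n t x₁ x₂ ξ x₁] at this
  simpa only [mixedPoint_eq_zeta] using this

end expansion

/-! ### The regularized terms of the series -/

section terms

/-- The factor of the regularized term that belongs to one coordinate `x`, at `x q ^ ν`. -/
def oneVar (q : ℝ) (α b : Fin 2 → ℂ) (x : ℂ) (ν : ℤ) : ℂ :=
  (q : ℂ) ^ ν * ∏ l, (qPoch q (q * α l * (x * (q : ℂ) ^ ν)) * thetaQuot q (b l * x) ν)

/-- The factor of the regularized term that belongs to a pair of coordinates `x`, `y`, at
`x q ^ k`, `y q ^ l`.  It is normalized so as to be antisymmetric. -/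
def pairFn (q : ℝ) (t x y : ℂ) (k l : ℤ) : ℂ :=
  x * t ^ (2 * k) * (1 - y / x * (q : ℂ) ^ (l - k)) *
    qPoch q (q * t⁻¹ * (y / x * (q : ℂ) ^ (l - k))) * thetaQuot q (t * (y / x)) (l - k)

/-- The regularized term of index `ν`: a holomorphic function of `x ∈ (ℂ^*)^n`.
The parameter `α` stands for `a⁻¹`. -/
def regTerm (q : ℝ) (t : ℂ) (α b : Fin 2 → ℂ) {n : ℕ} (x : Fin n → ℂ) (ν : Fin n → ℤ) : ℂ :=
  (∏ i, oneVar q α b (x i) (ν i)) *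
    ∏ i, ∏ j ∈ Finset.Ioi i, pairFn q t (x i) (x j) (ν i) (ν j)

/-- The sum of the regularized terms: it is antisymmetric, and holomorphic on `(ℂ^*)^n`. -/
def regSum (q : ℝ) (t : ℂ) (α b : Fin 2 → ℂ) {n : ℕ} (x : Fin n → ℂ) : ℂ :=
  ∑' ν : Fin n → ℤ, regTerm q t α b x ν

/-- The elliptic Vandermonde product. -/
def thetaVandermonde (q : ℝ) {n : ℕ} (x : Fin n → ℂ) : ℂ :=
  ∏ i, ∏ j ∈ Finset.Ioi i, x i * theta q (x j / x i)

variable {q : ℝ} (h0 : 0 < q) (h1 : q < 1)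

include h0 h1

lemma oneVar_q_mul (α : Fin 2 → ℂ) {b : Fin 2 → ℂ} (hb : ∀ l, b l ≠ 0) {x : ℂ} (hx : x ≠ 0)
    (ν : ℤ) :
    oneVar q α b (q * x) ν = (q * (b 0 * b 1))⁻¹ * (x ^ 2)⁻¹ * oneVar q α b x (ν + 1) := by
  have hq := q_ne h0
  have hb0 := hb 0
  have hb1 := hb 1
  unfold oneVar
  have e : ∀ l, b l * (q * x) = q * (b l * x) := fun l => by ring
  have e2 : (q : ℂ) * x * (q : ℂ) ^ ν = x * (q : ℂ) ^ (ν + 1) := by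
    rw [zpow_add_one₀ hq]; ring
  simp only [e, e2, thetaQuot_q_mul h0 h1 (mul_ne_zero (hb _) hx), Fin.prod_univ_two]
  rw [zpow_add_one₀ hq ν]
  field_simp

lemma pairFn_q_mul {t x y : ℂ} (ht : t ≠ 0) (hx : x ≠ 0) (hy : y ≠ 0) (k l : ℤ) :
    pairFn q t (q * x) y k l = -(y / (x * t)) * pairFn q t x y (k + 1) l := by
  have hq := q_ne h0
  unfold pairFn
  have e : y / (q * x) * (q : ℂ) ^ (l - k) = y / x * (q : ℂ) ^ (l - (k + 1)) := by
    rw [show l - k = l - (k + 1) + 1 by ring, zpow_add_one₀ hq]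
    field_simp
  have h := thetaQuot_q_mul h0 h1 (w := t * (y / (q * x))) (by simp [*]) (l - (k + 1))
  rw [show (q : ℂ) * (t * (y / (q * x))) = t * (y / x) by field_simp,
    show l - (k + 1) + 1 = l - k by ring] at h
  have h2 : thetaQuot q (t * (y / (q * x))) (l - k) =
      -(t * (y / (q * x))) * thetaQuot q (t * (y / x)) (l - (k + 1)) := by
    rw [h]
    field_simp
  rw [e, h2, show 2 * (k + 1) = 2 * k + 1 + 1 by ring, zpow_add_one₀ ht, zpow_add_one₀ ht]
  field_simp

lemma pairFn_antisymm {t x y : ℂ} (ht : t ≠ 0) (hx : x ≠ 0) (hy : y ≠ 0) (k l : ℤ) :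
    pairFn q t x y k l = -pairFn q t y x l k := by
  have hq := q_ne h0
  have hqz : (q : ℂ) ^ (l - k) ≠ 0 := zpow_ne_zero _ hq
  unfold pairFn thetaQuot
  rw [show k - l = -(l - k) by ring, tri_neg]
  have hk : 2 * k = 2 * l - (l - k) - (l - k) := by ring
  rw [hk]
  generalize l - k = m at *
  rw [zpow_sub₀ ht, zpow_sub₀ ht, zpow_add₀ hq, zpow_neg, zpow_neg,
    show -(t * (x / y)) = t ^ 2 * (-(t * (y / x)))⁻¹ by field_simp, mul_zpow, inv_zpow]
  have e1 : q * t⁻¹ * (x / y * ((q : ℂ) ^ m)⁻¹) = q / (t * (y / x) * (q : ℂ) ^ m) := by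
    field_simp
  have e2 : (q : ℂ) / (t * (x / y) * ((q : ℂ) ^ m)⁻¹) = q * t⁻¹ * (y / x * (q : ℂ) ^ m) := by
    field_simp
  rw [e1, e2, ← zpow_natCast t 2, ← zpow_mul, show ((2 : ℕ) : ℤ) * m = m + m by push_cast; ring,
    zpow_add₀ ht]
  have hw : (-(t * (y / x))) ^ m ≠ 0 := zpow_ne_zero _ (by simp [*])
  have htm : t ^ m ≠ 0 := zpow_ne_zero _ ht
  generalize qPoch q (q / (t * (y / x) * (q : ℂ) ^ m)) = A
  generalize qPoch q (q * t⁻¹ * (y / x * (q : ℂ) ^ m)) = B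
  generalize (-(t * (y / x))) ^ m = W at *
  generalize (q : ℂ) ^ (m * (m - 1) / 2) = Z at *
  field_simp
  ring

lemma theta_mul_antisymm {x y : ℂ} (hx : x ≠ 0) (hy : y ≠ 0) :
    x * theta q (y / x) = -(y * theta q (x / y)) := by
  rw [← inv_div y x, theta_inv h0 h1 (div_ne_zero hy hx)]
  field_simp

variable {n : ℕ}

lemma regTerm_perm {t : ℂ} (ht : t ≠ 0) (α b : Fin 2 → ℂ) {x : Fin n → ℂ} (hx : ∀ i, x i ≠ 0)
    (ν : Fin n → ℤ) (σ : Equiv.Perm (Fin n)) :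
    regTerm q t α b (x ∘ σ) (ν ∘ σ) = (Equiv.Perm.sign σ : ℤ) * regTerm q t α b x ν := by
  unfold regTerm
  have e := σ.prod_Ioi_comp_eq_sign_mul_prod
    (f := fun i j => pairFn q t (x i) (x j) (ν i) (ν j))
    (fun i j => pairFn_antisymm h0 h1 ht (hx i) (hx j) _ _)
  simp only [Function.comp_apply]
  rw [e, Equiv.prod_comp σ (fun i => oneVar q α b (x i) (ν i))]
  ring

lemma regSum_perm {t : ℂ} (ht : t ≠ 0) (α b : Fin 2 → ℂ) {x : Fin n → ℂ} (hx : ∀ i, x i ≠ 0)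
    (σ : Equiv.Perm (Fin n)) :
    regSum q t α b (x ∘ σ) = (Equiv.Perm.sign σ : ℤ) * regSum q t α b x := by
  unfold regSum
  rw [← (Equiv.arrowCongr σ.symm (Equiv.refl ℤ)).tsum_eq, ← tsum_mul_left]
  refine tsum_congr fun ν => ?_
  rw [← regTerm_perm h0 h1 ht α b hx]
  rfl

lemma thetaVandermonde_perm {x : Fin n → ℂ} (hx : ∀ i, x i ≠ 0) (σ : Equiv.Perm (Fin n)) :
    thetaVandermonde q (x ∘ σ) = (Equiv.Perm.sign σ : ℤ) * thetaVandermonde q x := by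
  unfold thetaVandermonde
  have e := σ.prod_Ioi_comp_eq_sign_mul_prod (f := fun i j => x i * theta q (x j / x i))
    (fun i j => theta_mul_antisymm h0 h1 (hx i) (hx j))
  simp only [Function.comp_apply]
  exact e

omit h0 h1 in
lemma eq_zero_of_perm_antisymm {f : (Fin n → ℂ) → ℂ}
    (hf : ∀ (x : Fin n → ℂ), (∀ i, x i ≠ 0) → ∀ σ : Equiv.Perm (Fin n),
      f (x ∘ σ) = (Equiv.Perm.sign σ : ℤ) * f x) {x : Fin n → ℂ} (hx : ∀ i, x i ≠ 0) {i j : Fin n}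
    (hij : i ≠ j) (hxij : x i = x j) : f x = 0 := by
  have h := hf x hx (Equiv.swap i j)
  have e : x ∘ Equiv.swap i j = x := by
    ext k
    simp only [Function.comp_apply, Equiv.swap_apply_def]
    split_ifs with h1 h2
    · rw [h1, hxij]
    · rw [h2, hxij]
    · rfl
  rw [e, Equiv.Perm.sign_swap hij] at h
  push_cast at h
  linear_combination h / 2

omit h0 h1 in
/-- Rescaling one coordinate in a product over pairs. -/
lemma prod_pairs_rescale (k : Fin n) (m : Fin n → ℂ) {P P' : Fin n → Fin n → ℂ}
    (h1 : ∀ j, j ≠ k → P' k j = m j * P k j) (h2 : ∀ i, i ≠ k → P' i k = m i * P i k)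
    (h3 : ∀ i j, i ≠ k → j ≠ k → P' i j = P i j) :
    ∏ i, ∏ j ∈ Finset.Ioi i, P' i j =
      (∏ j ∈ Finset.univ.erase k, m j) * ∏ i, ∏ j ∈ Finset.Ioi i, P i j := by
  have e : ∀ i, ∏ j ∈ Finset.Ioi i, P' i j =
      (∏ j ∈ Finset.Ioi i, ((if i = k then m j else 1) * if j = k then m i else 1)) *
        ∏ j ∈ Finset.Ioi i, P i j := by
    intro i
    rw [← Finset.prod_mul_distrib]
    refine Finset.prod_congr rfl fun j hj => ?_
    have hij : i ≠ j := (Finset.mem_Ioi.1 hj).ne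
    by_cases hi : i = k
    · subst hi
      rw [h1 j hij.symm]
      simp [hij.symm]
    · by_cases hj : j = k
      · subst hj
        rw [h2 i hi]
        simp [hi]
      · rw [h3 i j hi hj]
        simp [hi, hj]
  simp only [e]
  rw [Finset.prod_mul_distrib]
  congr 1
  simp only [Finset.prod_mul_distrib]
  have e1 : ∏ i, ∏ j ∈ Finset.Ioi i, (if i = k then m j else 1) = ∏ j ∈ Finset.Ioi k, m j := by
    rw [Finset.prod_eq_single k]
    · simp
    · intro i _ hi
      simp [hi]
    · simp
  have e2 : ∏ i, ∏ j ∈ Finset.Ioi i, (if j = k then m i else 1) = ∏ j ∈ Finset.Iio k, m j := by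
    rw [← Finset.prod_subset (Finset.subset_univ (Finset.Iio k))]
    · refine Finset.prod_congr rfl fun i hi => ?_
      rw [Finset.prod_eq_single k]
      · simp
      · intro j _ hj
        simp [hj]
      · intro h
        exact absurd (Finset.mem_Ioi.2 (Finset.mem_Iio.1 hi)) h
    · intro i _ hi
      refine Finset.prod_eq_one fun j hj => ?_
      have : j ≠ k := by
        rintro rfl
        exact hi (Finset.mem_Iio.2 (Finset.mem_Ioi.1 hj))
      simp [this]
  rw [e1, e2, ← Finset.prod_union]
  · refine Finset.prod_congr ?_ fun _ _ => rfl
    ext j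
    simp only [Finset.mem_union, Finset.mem_Ioi, Finset.mem_Iio, Finset.mem_erase,
      Finset.mem_univ, and_true]
    omega
  · rw [Finset.disjoint_left]
    intro j hj hj2
    simp at hj hj2
    omega

lemma regSum_update_q_mul {t : ℂ} (ht : t ≠ 0) (α : Fin 2 → ℂ) {b : Fin 2 → ℂ} (hb : ∀ l, b l ≠ 0)
    {x : Fin n → ℂ} (hx : ∀ i, x i ≠ 0) (k : Fin n) :
    regSum q t α b (Function.update x k (q * x k)) =
      (q * (b 0 * b 1))⁻¹ * (x k ^ 2)⁻¹ * (∏ j ∈ Finset.univ.erase k, -(x j / (x k * t))) *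
        regSum q t α b x := by
  unfold regSum
  rw [← (Equiv.addRight (Pi.single k (1 : ℤ) : Fin n → ℤ)).tsum_eq (regTerm q t α b x),
    ← tsum_mul_left]
  refine tsum_congr fun ν => ?_
  unfold regTerm
  rw [prod_pairs_rescale k (fun j => -(x j / (x k * t)))
    (P := fun i j => pairFn q t (x i) (x j) ((Equiv.addRight (Pi.single k (1 : ℤ))) ν i)
      ((Equiv.addRight (Pi.single k (1 : ℤ))) ν j))]
  · rw [← Finset.mul_prod_erase _ _ (Finset.mem_univ k),
      ← Finset.mul_prod_erase Finset.univ (fun i => oneVar q α b (x i) _) (Finset.mem_univ k)]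
    rw [Function.update_self, oneVar_q_mul h0 h1 α hb (hx k)]
    have e : ∏ i ∈ Finset.univ.erase k, oneVar q α b (Function.update x k (q * x k) i) (ν i) =
        ∏ i ∈ Finset.univ.erase k,
          oneVar q α b (x i) ((Equiv.addRight (Pi.single k (1 : ℤ))) ν i) := by
      refine Finset.prod_congr rfl fun i hi => ?_
      have hik : i ≠ k := Finset.ne_of_mem_erase hi
      simp [hik]
    rw [e]
    simp only [Equiv.coe_addRight, Pi.add_apply, Pi.single_eq_same]
    ring
  · intro j hj
    simp only [Function.update_self, Function.update_of_ne hj]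
    rw [pairFn_q_mul h0 h1 ht (hx k) (hx j)]
    simp [hj]
  · intro i hi
    simp only [Function.update_self, Function.update_of_ne hi]
    rw [pairFn_antisymm h0 h1 ht (hx i) (mul_ne_zero (q_ne h0) (hx k)),
      pairFn_q_mul h0 h1 ht (hx k) (hx i),
      pairFn_antisymm h0 h1 ht (hx i) (hx k)]
    simp [hi]
  · intro i j hi hj
    simp [hi, hj]

lemma thetaVandermonde_update_q_mul {x : Fin n → ℂ} (hx : ∀ i, x i ≠ 0) (k : Fin n) :
    thetaVandermonde q (Function.update x k (q * x k)) =
      (∏ j ∈ Finset.univ.erase k, -(x j / x k)) * thetaVandermonde q x := by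
  have hq := q_ne h0
  have key : ∀ x y : ℂ, x ≠ 0 → y ≠ 0 →
      q * x * theta q (y / (q * x)) = -(y / x) * (x * theta q (y / x)) := by
    intro x y hx hy
    have := theta_q_mul h0 h1 (a := y / (q * x)) (by simp [*])
    rw [show (q : ℂ) * (y / (q * x)) = y / x by field_simp] at this
    rw [this]
    field_simp
  unfold thetaVandermonde
  refine prod_pairs_rescale k (fun j => -(x j / x k)) ?_ ?_ ?_
  · intro j hj
    simp only [Function.update_self, Function.update_of_ne hj]
    exact key _ _ (hx k) (hx j)
  · intro i hi
    simp only [Function.update_self, Function.update_of_ne hi]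
    rw [theta_mul_antisymm h0 h1 (hx i) (mul_ne_zero hq (hx k)), key _ _ (hx k) (hx i),
      theta_mul_antisymm h0 h1 (hx i) (hx k)]
    ring
  · intro i j hi hj
    simp [hi, hj]

lemma thetaVandermonde_ne_zero {x : Fin n → ℂ} (hx : ∀ i, x i ≠ 0)
    (h : ∀ i j, i < j → theta q (x j / x i) ≠ 0) : thetaVandermonde q x ≠ 0 :=
  Finset.prod_ne_zero_iff.2 fun i _ => Finset.prod_ne_zero_iff.2 fun j hj =>
    mul_ne_zero (hx i) (h i j (Finset.mem_Ioi.1 hj))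

end terms

/-! ### Majorants of the terms -/

section bounds

variable {q : ℝ} (h0 : 0 < q) (h1 : q < 1)

/-- The geometric majorant of the one-variable factor: `q ^ ν` for `ν ≥ 0`, `P ^ |ν|` for `ν < 0`. -/
def geomMaj (q P : ℝ) (ν : ℤ) : ℝ := if 0 ≤ ν then q ^ ν else P ^ (-ν)

lemma geomMaj_nonneg {P : ℝ} (h0 : 0 < q) (hP : 0 ≤ P) (ν : ℤ) : 0 ≤ geomMaj q P ν := by
  unfold geomMaj
  split_ifs <;> positivity

/-- The majorant of the terms of the series: `T₁` and `T₂` are bounds for the modulus of `t`. -/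
def termMaj (q P T₁ T₂ : ℝ) {n : ℕ} (ν : Fin n → ℤ) : ℝ :=
  ∑ σ : Equiv.Perm (Fin n), ∏ i, (geomMaj q P (ν i) *
    (T₁ ^ (2 * ((σ i : ℕ) : ℤ) * ν i) + T₂ ^ (2 * ((σ i : ℕ) : ℤ) * ν i)))

lemma summable_prod_pi {n : ℕ} {f : Fin n → ℤ → ℝ} (hf : ∀ i k, 0 ≤ f i k)
    (hs : ∀ i, Summable (f i)) : Summable fun ν : Fin n → ℤ => ∏ i, f i (ν i) := by
  classical
  refine summable_of_sum_le (c := ∏ i, ∑' k, f i k)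
    (fun ν => Finset.prod_nonneg fun i _ => hf i _) fun u => ?_
  calc ∑ ν ∈ u, ∏ i, f i (ν i)
      ≤ ∑ ν ∈ Fintype.piFinset fun i => u.image fun ν => ν i, ∏ i, f i (ν i) := by
        refine Finset.sum_le_sum_of_subset_of_nonneg (fun ν hν => ?_)
          (fun ν _ _ => Finset.prod_nonneg fun i _ => hf i _)
        rw [Fintype.mem_piFinset]
        exact fun i => Finset.mem_image_of_mem _ hν
    _ = ∏ i, ∑ k ∈ u.image fun ν => ν i, f i k := (Finset.prod_univ_sum _ _).symm
    _ ≤ ∏ i, ∑' k, f i k := Finset.prod_le_prod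
        (fun i _ => Finset.sum_nonneg fun k _ => hf i k)
        (fun i _ => (hs i).sum_le_tsum _ fun k _ => hf i k)

lemma summable_geomMaj_mul {P T : ℝ} (h0 : 0 < q) (hP : 0 ≤ P) (hT : 0 < T) (k : ℕ)
    (hq : q * T ^ (2 * k) < 1) (hPT : P < T ^ (2 * k)) :
    Summable fun ν : ℤ => geomMaj q P ν * T ^ (2 * (k : ℤ) * ν) := by
  refine Summable.of_nat_of_neg ?_ ?_
  · refine (summable_geometric_of_lt_one (r := q * T ^ (2 * k)) (by positivity) hq).congr
      fun n => ?_
    rw [geomMaj, if_pos (by positivity), mul_pow, zpow_natCast, ← pow_mul]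
    rw [show 2 * (k : ℤ) * n = ((2 * k * n : ℕ) : ℤ) by push_cast; ring, zpow_natCast]
  · have hpos : 0 < T ^ (2 * k) := by positivity
    refine (summable_geometric_of_lt_one (r := P / T ^ (2 * k)) (by positivity)
      ((div_lt_one hpos).2 hPT)).congr fun n => ?_
    have e : T ^ (2 * (k : ℤ) * -(n : ℤ)) = ((T ^ (2 * k)) ^ n)⁻¹ := by
      rw [mul_neg, zpow_neg, show 2 * (k : ℤ) * n = ((2 * k * n : ℕ) : ℤ) by push_cast; ring,
        zpow_natCast, pow_mul]
    rw [e, div_pow, div_eq_mul_inv]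
    congr 1
    unfold geomMaj
    split_ifs with h
    · have : n = 0 := by omega
      subst this; simp
    · rw [neg_neg, zpow_natCast]

lemma termMaj_summable {n : ℕ} {P T₁ T₂ : ℝ} (h0 : 0 < q) (hP : 0 ≤ P) (hT₁ : 0 < T₁)
    (hT₂ : 0 < T₂) (hc₁ : ∀ k < n, q * T₁ ^ (2 * k) < 1 ∧ P < T₁ ^ (2 * k))
    (hc₂ : ∀ k < n, q * T₂ ^ (2 * k) < 1 ∧ P < T₂ ^ (2 * k)) :
    Summable (termMaj q P T₁ T₂ : (Fin n → ℤ) → ℝ) := by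
  unfold termMaj
  refine summable_sum fun σ _ => ?_
  refine summable_prod_pi (f := fun i k => geomMaj q P k *
    (T₁ ^ (2 * ((σ i : ℕ) : ℤ) * k) + T₂ ^ (2 * ((σ i : ℕ) : ℤ) * k))) (fun i k => ?_) (fun i => ?_)
  · have := geomMaj_nonneg h0 hP k
    positivity
  · simp only [mul_add]
    exact (summable_geomMaj_mul h0 hP hT₁ _ (hc₁ _ (σ i).2).1 (hc₁ _ (σ i).2).2).add
      (summable_geomMaj_mul h0 hP hT₂ _ (hc₂ _ (σ i).2).1 (hc₂ _ (σ i).2).2)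

/-- Sorting the exponents. -/
lemma exists_perm_prod_min {n : ℕ} {T : ℝ} (hT : 0 < T) (ν : Fin n → ℤ) :
    ∃ σ : Equiv.Perm (Fin n), ∏ i, ∏ j ∈ Finset.Ioi i, T ^ (2 * min (ν i) (ν j)) =
      ∏ i, T ^ (2 * ((σ i : ℕ) : ℤ) * ν i) := by
  set s := Tuple.sort ν with hs
  have hmono : Monotone (ν ∘ s) := Tuple.monotone_sort ν
  refine ⟨s.symm.trans Fin.revPerm, ?_⟩
  -- the product over pairs is, up to sign, invariant under `s`
  let f : Fin n → Fin n → ℝ := fun i j =>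
    (if i < j then 1 else if j < i then -1 else 0) * T ^ (2 * min (ν i) (ν j))
  have hf : ∀ i j, f i j = -f j i := by
    intro i j
    simp only [f, min_comm (ν j) (ν i)]
    rcases lt_trichotomy i j with h | h | h
    · simp [h, h.not_gt]
    · simp [h]
    · simp [h, h.not_gt]
  have habs : ∀ i j, i ≠ j → |f i j| = T ^ (2 * min (ν i) (ν j)) := by
    intro i j hij
    simp only [f, abs_mul, abs_of_pos (zpow_pos hT _)]
    rcases lt_or_gt_of_ne hij with h | h
    · simp [h]
    · simp [h, h.not_gt]
  have key := congrArg abs (s.prod_Ioi_comp_eq_sign_mul_prod hf)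
  rw [abs_mul, Finset.abs_prod, Finset.abs_prod] at key
  simp only [Finset.abs_prod] at key
  have e1 : ∏ i, ∏ j ∈ Finset.Ioi i, |f i j| =
      ∏ i, ∏ j ∈ Finset.Ioi i, T ^ (2 * min (ν i) (ν j)) :=
    Finset.prod_congr rfl fun i _ => Finset.prod_congr rfl fun j hj =>
      habs i j (Finset.mem_Ioi.1 hj).ne
  have e2 : ∏ i, ∏ j ∈ Finset.Ioi i, |f (s i) (s j)| =
      ∏ i, ∏ j ∈ Finset.Ioi i, T ^ (2 * ν (s i)) :=
    Finset.prod_congr rfl fun i _ => Finset.prod_congr rfl fun j hj => by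
      have hij := Finset.mem_Ioi.1 hj
      rw [habs _ _ (fun h => hij.ne (s.injective h)), min_eq_left (show ν (s i) ≤ ν (s j) from hmono hij.le)]
  rw [e1, e2] at key
  have hsgn' : |(((Equiv.Perm.sign s : ℤˣ) : ℤ) : ℝ)| = 1 := by
    rcases Int.units_eq_one_or (Equiv.Perm.sign s) with h | h <;> simp [h]
  rw [hsgn', one_mul] at key
  rw [← key, ← Equiv.prod_comp s (fun i => T ^ _)]
  refine Finset.prod_congr rfl fun i _ => ?_
  rw [Finset.prod_const, Fin.card_Ioi, ← zpow_natCast, ← zpow_mul]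
  congr 1
  simp only [Equiv.trans_apply, Equiv.symm_apply_apply, Fin.revPerm_apply, Fin.val_rev]
  have : ((n - 1 - (i : ℕ) : ℕ) : ℤ) = ((n - ((i : ℕ) + 1) : ℕ) : ℤ) := by omega
  rw [this]; ring

/-- Termwise estimate by the majorant. -/
lemma norm_prod_le_termMaj {n : ℕ} {P T₁ T₂ T C₁ C₂ : ℝ} (h0 : 0 < q) (hP : 0 ≤ P) (hT₁ : 0 < T₁)
    (hT : T₁ ≤ T) (hT' : T ≤ T₂) (hC₁ : 0 ≤ C₁) (hC₂ : 0 ≤ C₂) (ν : Fin n → ℤ)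
    {e : Fin n → ℂ} {p : Fin n → Fin n → ℂ} (he : ∀ i, ‖e i‖ ≤ C₁ * geomMaj q P (ν i))
    (hp : ∀ i j, i < j → ‖p i j‖ ≤ C₂ * T ^ (2 * min (ν i) (ν j))) :
    ‖(∏ i, e i) * ∏ i, ∏ j ∈ Finset.Ioi i, p i j‖ ≤
      (∏ _i : Fin n, C₁) * (∏ i : Fin n, ∏ _j ∈ Finset.Ioi i, C₂) * termMaj q P T₁ T₂ ν := by
  have hTpos : 0 < T := hT₁.trans_le hT
  obtain ⟨σ, hσ⟩ := exists_perm_prod_min hTpos ν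
  rw [norm_mul, norm_prod, norm_prod]
  simp only [norm_prod]
  calc (∏ i, ‖e i‖) * ∏ i, ∏ j ∈ Finset.Ioi i, ‖p i j‖
      ≤ (∏ i, (C₁ * geomMaj q P (ν i))) *
        ∏ i, ∏ j ∈ Finset.Ioi i, (C₂ * T ^ (2 * min (ν i) (ν j))) := by
        refine mul_le_mul (Finset.prod_le_prod (fun _ _ => norm_nonneg _) fun i _ => he i)
          (Finset.prod_le_prod (fun _ _ => Finset.prod_nonneg fun _ _ => norm_nonneg _)
            fun i _ => Finset.prod_le_prod (fun _ _ => norm_nonneg _)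
              fun j hj => hp i j (Finset.mem_Ioi.1 hj))
          (Finset.prod_nonneg fun _ _ => Finset.prod_nonneg fun _ _ => norm_nonneg _)
          (Finset.prod_nonneg fun i _ => mul_nonneg hC₁ (geomMaj_nonneg h0 hP _))
    _ = (∏ _i : Fin n, C₁) * (∏ i : Fin n, ∏ _j ∈ Finset.Ioi i, C₂) *
        ∏ i, (geomMaj q P (ν i) * T ^ (2 * ((σ i : ℕ) : ℤ) * ν i)) := by
        simp only [Finset.prod_mul_distrib]
        rw [hσ]
        ring
    _ ≤ _ := by
        have hC : 0 ≤ (∏ _i : Fin n, C₁) * (∏ i : Fin n, ∏ _j ∈ Finset.Ioi i, C₂) :=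
          mul_nonneg (Finset.prod_nonneg fun _ _ => hC₁)
            (Finset.prod_nonneg fun _ _ => Finset.prod_nonneg fun _ _ => hC₂)
        refine mul_le_mul_of_nonneg_left ?_ hC
        have hT₂ : 0 < T₂ := hTpos.trans_le hT'
        have hzpow : ∀ m : ℤ, T ^ m ≤ T₁ ^ m + T₂ ^ m := by
          intro m
          rcases le_or_gt 0 m with hm | hm
          · have := zpow_le_zpow_left₀ hm hTpos.le hT'
            have := zpow_pos hT₁ m
            linarith
          · have : T ^ m ≤ T₁ ^ m := by
              obtain ⟨k, rfl⟩ : ∃ k : ℤ, m = -k := ⟨-m, by ring⟩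
              rw [zpow_neg, zpow_neg]
              exact inv_anti₀ (zpow_pos hT₁ _) (zpow_le_zpow_left₀ (by omega) hT₁.le hT)
            have := zpow_pos hT₂ m
            linarith
        unfold termMaj
        refine le_trans ?_ (Finset.single_le_sum (f := fun σ : Equiv.Perm (Fin n) =>
          ∏ i, (geomMaj q P (ν i) *
            (T₁ ^ (2 * ((σ i : ℕ) : ℤ) * ν i) + T₂ ^ (2 * ((σ i : ℕ) : ℤ) * ν i))))
          (fun σ _ => Finset.prod_nonneg fun i _ => ?_) (Finset.mem_univ σ))
        · refine Finset.prod_le_prod (fun i _ => ?_) (fun i _ => ?_)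
          · exact mul_nonneg (geomMaj_nonneg h0 hP _) (zpow_pos hTpos _).le
          · exact mul_le_mul_of_nonneg_left (hzpow _) (geomMaj_nonneg h0 hP _)
        · exact mul_nonneg (geomMaj_nonneg h0 hP _)
            (add_nonneg (zpow_pos hT₁ _).le (zpow_pos hT₂ _).le)

include h0 h1

lemma qPoch_mul_thetaQuot_neg {y w : ℂ} (hw : w ≠ 0) (k : ℕ) :
    qPoch q (y * (q : ℂ) ^ (-(k : ℤ))) * thetaQuot q w (-(k : ℤ)) =
      qPoch q (q / w * (q : ℂ) ^ k) * qPoch q y *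
        ∏ j ∈ Finset.range k, ((y - (q : ℂ) ^ (j + 1)) / w) := by
  have hq := q_ne h0
  have hw' : -w ≠ 0 := neg_ne_zero.2 hw
  have key : qPoch q (y * (q : ℂ) ^ (-(k : ℤ))) * ((-w) ^ (-(k : ℤ)) *
      (q : ℂ) ^ (-(k : ℤ) * (-(k : ℤ) - 1) / 2)) =
      qPoch q y * ∏ j ∈ Finset.range k, ((y - (q : ℂ) ^ (j + 1)) / w) := by
    induction k with
    | zero => simp
    | succ k ih =>
      rw [Finset.prod_range_succ, ← mul_assoc (qPoch q y), ← ih,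
        qPoch_step h0 h1 (y * (q : ℂ) ^ (-((k + 1 : ℕ) : ℤ)))]
      have e1 : (q : ℂ) * (y * (q : ℂ) ^ (-((k + 1 : ℕ) : ℤ))) = y * (q : ℂ) ^ (-(k : ℤ)) := by
        push_cast
        rw [neg_add, zpow_add₀ hq, zpow_neg_one]; field_simp
      have e2 := tri_succ (-((k + 1 : ℕ) : ℤ))
      rw [show -((k + 1 : ℕ) : ℤ) + 1 = -(k : ℤ) by push_cast; ring] at e2
      have e3 : (-w) ^ (-((k + 1 : ℕ) : ℤ)) = (-w) ^ (-(k : ℤ)) * (-w)⁻¹ := by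
        push_cast
        rw [neg_add, zpow_add₀ hw', zpow_neg_one]
      have e4 : (q : ℂ) ^ (-((k + 1 : ℕ) : ℤ)) = ((q : ℂ) ^ (k + 1))⁻¹ := by
        rw [zpow_neg, zpow_natCast]
      rw [e1, e2, e3, zpow_add₀ hq, e4]
      field_simp
      ring
  unfold thetaQuot
  have e5 : (q : ℂ) / (w * (q : ℂ) ^ (-(k : ℤ))) = q / w * (q : ℂ) ^ k := by
    rw [zpow_neg, zpow_natCast]; field_simp
  rw [e5]
  linear_combination qPoch q (q / w * (q : ℂ) ^ k) * key

lemma norm_q_zpow (m : ℤ) : ‖(q : ℂ) ^ m‖ = q ^ m := by rw [norm_zpow, norm_q h0]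

lemma norm_qPoch_mul_pow_le {y : ℂ} {Y : ℝ} (hy : ‖y‖ ≤ Y) (k : ℕ) :
    ‖qPoch q (y * (q : ℂ) ^ k)‖ ≤ Real.exp (Y / (1 - q)) := by
  apply norm_qPoch_le' h0 h1
  rw [norm_mul, norm_pow, norm_q h0]
  have : q ^ k ≤ 1 := pow_le_one₀ h0.le h1.le
  nlinarith [norm_nonneg y, pow_pos h0 k]

lemma norm_thetaQuot_natCast_le {w : ℂ} {r R : ℝ} (hr : 0 < r) (hw : r ≤ ‖w‖) (hR : ‖w‖ ≤ R)
    (k : ℕ) :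
    ‖thetaQuot q w k‖ ≤ Real.exp (q / r / (1 - q)) * Real.exp (R / (1 - q)) := by
  have h1q : 0 < 1 - q := by linarith
  have hw0 : w ≠ 0 := norm_pos_iff.1 (hr.trans_le hw)
  rw [thetaQuot_natCast h0 h1 hw0, norm_mul]
  refine mul_le_mul ?_ ?_ (norm_nonneg _) (Real.exp_pos _).le
  · apply norm_qPoch_le' h0 h1
    rw [norm_div, norm_q h0]
    gcongr
  · refine (norm_prod_one_sub_geom_le h0 h1 w k).trans (Real.exp_le_exp.2 ?_)
    gcongr

/-- Exponential decay to the left: numerator and denominator of a quotient together. -/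
lemma norm_qPoch_mul_thetaQuot_neg_le {y w : ℂ} {Y r : ℝ} (hY : 0 < Y) (hy : ‖y‖ ≤ Y)
    (hr : 0 < r) (hw : r ≤ ‖w‖) (k : ℕ) :
    ‖qPoch q (y * (q : ℂ) ^ (-(k : ℤ))) * thetaQuot q w (-(k : ℤ))‖ ≤
      Real.exp (q / r / (1 - q)) * Real.exp (Y / (1 - q)) * Real.exp (q / Y / (1 - q)) *
        (Y / ‖w‖) ^ k := by
  have h1q : 0 < 1 - q := by linarith
  have hwpos : 0 < ‖w‖ := hr.trans_le hw
  have hw0 : w ≠ 0 := norm_pos_iff.1 hwpos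
  rw [qPoch_mul_thetaQuot_neg h0 h1 hw0, norm_mul, norm_mul, mul_assoc _ (Real.exp (q / Y / _))]
  have b1 : ‖qPoch q (q / w * (q : ℂ) ^ k)‖ ≤ Real.exp (q / r / (1 - q)) := by
    apply norm_qPoch_mul_pow_le h0 h1
    rw [norm_div, norm_q h0]
    gcongr
  have b2 := norm_qPoch_le' h0 h1 hy
  have b3 : ‖∏ j ∈ Finset.range k, ((y - (q : ℂ) ^ (j + 1)) / w)‖ ≤
      Real.exp (q / Y / (1 - q)) * (Y / ‖w‖) ^ k := by
    rw [norm_prod]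
    calc ∏ j ∈ Finset.range k, ‖(y - (q : ℂ) ^ (j + 1)) / w‖
        ≤ ∏ j ∈ Finset.range k, ((1 + q ^ j * (q / Y)) * (Y / ‖w‖)) := by
          refine Finset.prod_le_prod (fun _ _ => norm_nonneg _) fun j _ => ?_
          rw [norm_div, ← mul_div_assoc]
          gcongr
          calc ‖y - (q : ℂ) ^ (j + 1)‖ ≤ ‖y‖ + ‖(q : ℂ) ^ (j + 1)‖ := norm_sub_le _ _
            _ ≤ Y + q ^ (j + 1) := by rw [norm_pow, norm_q h0]; gcongr
            _ = (1 + q ^ j * (q / Y)) * Y := by field_simp; ring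
      _ = (∏ j ∈ Finset.range k, (1 + q ^ j * (q / Y))) * (Y / ‖w‖) ^ k := by
          rw [Finset.prod_mul_distrib, Finset.prod_const, Finset.card_range]
      _ ≤ _ := by
          gcongr
          exact prod_one_add_geom_le h0 h1 (by positivity) k
  gcongr

lemma exists_oneVar_bound {b : Fin 2 → ℂ} (hb : ∀ l, b l ≠ 0) {ρ : Fin 2 → ℝ} (hρ : ∀ l, 0 < ρ l)
    {r R : ℝ} (hr : 0 < r) :
    ∃ C : ℝ, 0 ≤ C ∧ ∀ (α : Fin 2 → ℂ) (x : ℂ) (ν : ℤ), (∀ l, ‖α l‖ ≤ ρ l) → r ≤ ‖x‖ → ‖x‖ ≤ R →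
      ‖oneVar q α b x ν‖ ≤ C * geomMaj q (q * (ρ 0 * ρ 1) / (‖b 0‖ * ‖b 1‖)) ν := by
  have h1q : 0 < 1 - q := by linarith
  have hbpos : ∀ l, 0 < ‖b l‖ := fun l => norm_pos_iff.2 (hb l)
  -- the bounds for the two factors
  let A : Fin 2 → ℝ := fun l => Real.exp (q * ρ l * R / (1 - q)) *
    (Real.exp (q / (‖b l‖ * r) / (1 - q)) * Real.exp (‖b l‖ * R / (1 - q)))
  let A' : Fin 2 → ℝ := fun l => Real.exp (q / (‖b l‖ * r) / (1 - q)) *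
    Real.exp (q * ρ l * R / (1 - q)) * Real.exp (q / (q * ρ l * r) / (1 - q))
  have hA : ∀ l, 0 < A l := fun l => by positivity
  have hA' : ∀ l, 0 < A' l := fun l => by positivity
  refine ⟨A 0 * A 1 + A' 0 * A' 1, by have := hA 0; have := hA 1; have := hA' 0; have := hA' 1; positivity, ?_⟩
  intro α x ν hα hrx hxR
  have hxpos : 0 < ‖x‖ := hr.trans_le hrx
  have hx0 : x ≠ 0 := norm_pos_iff.1 hxpos
  have hwr : ∀ l, ‖b l‖ * r ≤ ‖b l * x‖ := fun l => by
    rw [norm_mul]; exact mul_le_mul_of_nonneg_left hrx (norm_nonneg _)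
  have hwR : ∀ l, ‖b l * x‖ ≤ ‖b l‖ * R := fun l => by
    rw [norm_mul]; exact mul_le_mul_of_nonneg_left hxR (norm_nonneg _)
  have hy : ∀ l, ‖q * α l * x‖ ≤ q * ρ l * ‖x‖ := fun l => by
    rw [norm_mul, norm_mul, norm_q h0]
    have := hα l
    gcongr
  have hyR : ∀ l, q * ρ l * ‖x‖ ≤ q * ρ l * R := fun l => by
    have := hρ l
    gcongr
  have hp0 := hA 0
  have hp1 := hA 1
  have hp0' := hA' 0
  have hp1' := hA' 1
  rcases le_or_gt 0 ν with hν | hν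
  · obtain ⟨k, rfl⟩ := Int.eq_ofNat_of_zero_le hν
    have hl : ∀ l, ‖qPoch q (q * α l * (x * (q : ℂ) ^ (k : ℤ))) * thetaQuot q (b l * x) k‖ ≤ A l := by
      intro l
      rw [norm_mul]
      refine mul_le_mul ?_ (norm_thetaQuot_natCast_le h0 h1 (mul_pos (hbpos l) hr) (hwr l) (hwR l) k)
        (norm_nonneg _) (Real.exp_pos _).le
      rw [← mul_assoc, zpow_natCast]
      exact norm_qPoch_mul_pow_le h0 h1 ((hy l).trans (hyR l)) k
    rw [oneVar, geomMaj, if_pos hν, Fin.prod_univ_two, norm_mul, norm_mul, norm_q_zpow h0 h1,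
      mul_comm]
    have := zpow_pos h0 (k : ℤ)
    gcongr
    calc _ ≤ A 0 * A 1 := mul_le_mul (hl 0) (hl 1) (norm_nonneg _) (hA 0).le
      _ ≤ _ := by linarith [mul_pos hp0' hp1']
  · obtain ⟨k, rfl⟩ : ∃ k : ℕ, ν = -(k : ℤ) := ⟨ν.natAbs, by omega⟩
    have hl : ∀ l, ‖qPoch q (q * α l * (x * (q : ℂ) ^ (-(k : ℤ)))) *
        thetaQuot q (b l * x) (-(k : ℤ))‖ ≤ A' l * (q * ρ l / ‖b l‖) ^ k := by
      intro l
      have hρl := hρ l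
      have hbl := hbpos l
      have h := norm_qPoch_mul_thetaQuot_neg_le h0 h1 (Y := q * ρ l * ‖x‖) (by positivity) (hy l)
        (mul_pos hbl hr) (hwr l) k
      rw [← mul_assoc]
      refine h.trans ?_
      have e : q * ρ l * ‖x‖ / ‖b l * x‖ = q * ρ l / ‖b l‖ := by
        rw [norm_mul]; field_simp
      rw [e]
      simp only [A']
      gcongr
    rw [oneVar, geomMaj, if_neg (by omega), Fin.prod_univ_two, norm_mul, norm_mul,
      norm_q_zpow h0 h1, neg_neg, zpow_natCast, zpow_neg, zpow_natCast]
    have hρ0 := hρ 0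
    have hρ1 := hρ 1
    have hb0 := hbpos 0
    have hb1 := hbpos 1
    calc _ ≤ (q ^ k)⁻¹ * ((A' 0 * (q * ρ 0 / ‖b 0‖) ^ k) * (A' 1 * (q * ρ 1 / ‖b 1‖) ^ k)) := by
          gcongr
          · exact hl 0
          · exact hl 1
      _ = (A' 0 * A' 1) * (q * (ρ 0 * ρ 1) / (‖b 0‖ * ‖b 1‖)) ^ k := by
          rw [show q * (ρ 0 * ρ 1) / (‖b 0‖ * ‖b 1‖) = q⁻¹ * (q * ρ 0 / ‖b 0‖) * (q * ρ 1 / ‖b 1‖) by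
            field_simp, mul_pow, mul_pow, inv_pow]
          ring
      _ ≤ _ := by
          gcongr
          linarith [mul_pos hp0 hp1]

lemma exists_pairFn_bound {r R T₁ T₂ : ℝ} (hr : 0 < r) (hT₁ : 0 < T₁) :
    ∃ C : ℝ, 0 ≤ C ∧ ∀ (t x y : ℂ) (k l : ℤ), T₁ ≤ ‖t‖ → ‖t‖ ≤ T₂ → r ≤ ‖x‖ → ‖x‖ ≤ R →
      r ≤ ‖y‖ → ‖y‖ ≤ R → ‖pairFn q t x y k l‖ ≤ C * ‖t‖ ^ (2 * min k l) := by
  have h1q : 0 < 1 - q := by linarith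
  set C : ℝ := max R 0 * (1 + max R 0 / r) * Real.exp (q * T₁⁻¹ * (max R 0 / r) / (1 - q)) *
    (Real.exp (q / (T₁ * (r / max R 0)) / (1 - q)) * Real.exp (T₂ * (max R 0 / r) / (1 - q))) with hC
  have hC0 : 0 ≤ C := by positivity
  have main : ∀ (t x y : ℂ) (k l : ℤ), T₁ ≤ ‖t‖ → ‖t‖ ≤ T₂ → r ≤ ‖x‖ → ‖x‖ ≤ R →
      r ≤ ‖y‖ → ‖y‖ ≤ R → k ≤ l → ‖pairFn q t x y k l‖ ≤ C * ‖t‖ ^ (2 * k) := by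
    intro t x y k l ht1 ht2 hx1 hx2 hy1 hy2 hkl
    have hR : 0 < R := hr.trans_le (hx1.trans hx2)
    rw [max_eq_left hR.le] at hC
    obtain ⟨m, hm⟩ : ∃ m : ℕ, l - k = m := ⟨(l - k).natAbs, by omega⟩
    have hx0 : 0 < ‖x‖ := hr.trans_le hx1
    have hy0 : 0 < ‖y‖ := hr.trans_le hy1
    have ht0 : 0 < ‖t‖ := hT₁.trans_le ht1
    have hT₂ : 0 < T₂ := ht0.trans_le ht2
    have hw1 : ‖y / x‖ ≤ R / r := by
      rw [norm_div]; gcongr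
    have hw2 : r / R ≤ ‖y / x‖ := by
      rw [norm_div]; gcongr
    unfold pairFn
    rw [hm, norm_mul, norm_mul, norm_mul, norm_mul, norm_zpow, hC]
    have qm : q ^ m ≤ 1 := pow_le_one₀ h0.le h1.le
    have b1 : ‖1 - y / x * (q : ℂ) ^ (m : ℤ)‖ ≤ 1 + R / r := by
      refine (norm_sub_le _ _).trans ?_
      rw [norm_one, norm_mul, zpow_natCast, norm_pow, norm_q h0]
      have : ‖y / x‖ * q ^ m ≤ ‖y / x‖ := mul_le_of_le_one_right (norm_nonneg _) qm
      linarith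
    have b2 : ‖qPoch q (q * t⁻¹ * (y / x * (q : ℂ) ^ (m : ℤ)))‖ ≤
        Real.exp (q * T₁⁻¹ * (R / r) / (1 - q)) := by
      rw [← mul_assoc, zpow_natCast]
      apply norm_qPoch_mul_pow_le h0 h1
      rw [norm_mul, norm_mul, norm_inv, norm_q h0]
      gcongr
    have b3 : ‖thetaQuot q (t * (y / x)) (m : ℤ)‖ ≤
        Real.exp (q / (T₁ * (r / R)) / (1 - q)) * Real.exp (T₂ * (R / r) / (1 - q)) := by
      apply norm_thetaQuot_natCast_le h0 h1 (by positivity)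
      · rw [norm_mul]; gcongr
      · rw [norm_mul]; gcongr
    calc _ = ‖x‖ * ‖1 - y / x * (q : ℂ) ^ (m : ℤ)‖ *
          ‖qPoch q (q * t⁻¹ * (y / x * (q : ℂ) ^ (m : ℤ)))‖ *
          ‖thetaQuot q (t * (y / x)) (m : ℤ)‖ * ‖t‖ ^ (2 * k) := by ring
      _ ≤ _ := by gcongr
  refine ⟨C, hC0, fun t x y k l ht1 ht2 hx1 hx2 hy1 hy2 => ?_⟩
  rcases le_total k l with hkl | hkl
  · rw [min_eq_left hkl]
    exact main t x y k l ht1 ht2 hx1 hx2 hy1 hy2 hkl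
  · have ht0 : t ≠ 0 := norm_pos_iff.1 (hT₁.trans_le ht1)
    have hx0 : x ≠ 0 := norm_pos_iff.1 (hr.trans_le hx1)
    have hy0 : y ≠ 0 := norm_pos_iff.1 (hr.trans_le hy1)
    rw [min_eq_right hkl, pairFn_antisymm h0 h1 ht0 hx0 hy0, norm_neg]
    exact main t y x l k ht1 ht2 hy1 hy2 hx1 hx2 hkl

end bounds

/-! ### Analyticity of the regularized sum -/

section analytic

variable {q : ℝ} (h0 : 0 < q) (h1 : q < 1)

/-- The convergence condition, in terms of `α = a⁻¹`. -/
def ConvCond (q : ℝ) (t : ℂ) (α b : Fin 2 → ℂ) (n : ℕ) : Prop :=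
  ∀ k < n, q * ‖t‖ ^ (2 * k) < 1 ∧ q * (‖α 0‖ * ‖α 1‖) < ‖b 0‖ * ‖b 1‖ * ‖t‖ ^ (2 * k)

lemma differentiableAt_prod {E ι : Type*} [NormedAddCommGroup E] [NormedSpace ℂ E] {e : E}
    (s : Finset ι) {f : ι → E → ℂ} (hf : ∀ i ∈ s, DifferentiableAt ℂ (f i) e) :
    DifferentiableAt ℂ (fun e => ∏ i ∈ s, f i e) e := by
  classical
  induction s using Finset.induction_on with
  | empty => simp
  | insert a s ha ih =>
    simp only [Finset.prod_insert ha]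
    exact (hf a (Finset.mem_insert_self _ _)).mul
      (ih fun i hi => hf i (Finset.mem_insert_of_mem hi))

lemma differentiableAt_div {E : Type*} [NormedAddCommGroup E] [NormedSpace ℂ E]
    {e : E} {f g : E → ℂ} (hf : DifferentiableAt ℂ f e) (hg : DifferentiableAt ℂ g e)
    (h : g e ≠ 0) : DifferentiableAt ℂ (fun e => f e / g e) e := by
  simp only [div_eq_mul_inv]
  exact hf.mul (hg.inv h)

section smooth

include h0 h1

variable {E : Type*} [NormedAddCommGroup E] [NormedSpace ℂ E] {e : E}

lemma qPoch_comp_differentiableAt {f : E → ℂ} (hf : DifferentiableAt ℂ f e) :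
    DifferentiableAt ℂ (fun e => qPoch q (f e)) e :=
  DifferentiableAt.comp (g := qPoch q) e ((qPoch_differentiable h0 h1) _) hf

lemma theta_comp_differentiableAt {f : E → ℂ} (hf : DifferentiableAt ℂ f e) (h : f e ≠ 0) :
    DifferentiableAt ℂ (fun e => theta q (f e)) e :=
  DifferentiableAt.comp (g := theta q) e (theta_differentiableAt h0 h1 h) hf

lemma thetaQuot_comp_differentiableAt {f : E → ℂ} (hf : DifferentiableAt ℂ f e) (h : f e ≠ 0)
    (m : ℤ) : DifferentiableAt ℂ (fun e => thetaQuot q (f e) m) e :=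
  DifferentiableAt.comp (g := fun w => thetaQuot q w m) e (thetaQuot_differentiableAt h0 h1 h m) hf

lemma oneVar_comp_differentiableAt {α b : E → Fin 2 → ℂ} {x : E → ℂ}
    (hα : ∀ l, DifferentiableAt ℂ (fun e => α e l) e)
    (hb : ∀ l, DifferentiableAt ℂ (fun e => b e l) e) (hb0 : ∀ l, b e l ≠ 0)
    (hx : DifferentiableAt ℂ x e) (hx0 : x e ≠ 0) (ν : ℤ) :
    DifferentiableAt ℂ (fun e => oneVar q (α e) (b e) (x e) ν) e := by
  unfold oneVar
  refine (differentiableAt_prod _ fun l _ => ?_).const_mul _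
  exact (qPoch_comp_differentiableAt h0 h1 (((hα l).const_mul _).mul (hx.mul_const _))).mul
    (thetaQuot_comp_differentiableAt h0 h1 ((hb l).mul hx) (mul_ne_zero (hb0 l) hx0) _)

lemma pairFn_comp_differentiableAt {t x y : E → ℂ} (ht : DifferentiableAt ℂ t e) (ht0 : t e ≠ 0)
    (hx : DifferentiableAt ℂ x e) (hx0 : x e ≠ 0) (hy : DifferentiableAt ℂ y e) (hy0 : y e ≠ 0)
    (k l : ℤ) : DifferentiableAt ℂ (fun e => pairFn q (t e) (x e) (y e) k l) e := by
  unfold pairFn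
  have hyx : DifferentiableAt ℂ (fun e => y e / x e) e := differentiableAt_div hy hx hx0
  have hW : DifferentiableAt ℂ (fun e => y e / x e * (q : ℂ) ^ (l - k)) e := hyx.mul_const _
  refine (((hx.mul (ht.zpow (Or.inl ht0))).mul (hW.const_sub 1)).mul ?_).mul ?_
  · exact qPoch_comp_differentiableAt h0 h1 (((ht.inv ht0).const_mul _).mul hW)
  · exact thetaQuot_comp_differentiableAt h0 h1 (ht.mul hyx)
      (mul_ne_zero ht0 (div_ne_zero hy0 hx0)) _

lemma regTerm_comp_differentiableAt {n : ℕ} {t : E → ℂ} {α b : E → Fin 2 → ℂ} {x : E → Fin n → ℂ}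
    (ht : DifferentiableAt ℂ t e) (ht0 : t e ≠ 0)
    (hα : ∀ l, DifferentiableAt ℂ (fun e => α e l) e)
    (hb : ∀ l, DifferentiableAt ℂ (fun e => b e l) e) (hb0 : ∀ l, b e l ≠ 0)
    (hx : ∀ i, DifferentiableAt ℂ (fun e => x e i) e) (hx0 : ∀ i, x e i ≠ 0) (ν : Fin n → ℤ) :
    DifferentiableAt ℂ (fun e => regTerm q (t e) (α e) (b e) (x e) ν) e := by
  unfold regTerm
  refine DifferentiableAt.mul (differentiableAt_prod _ fun i _ => ?_)
    (differentiableAt_prod _ fun i _ => differentiableAt_prod _ fun j _ => ?_)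
  · exact oneVar_comp_differentiableAt h0 h1 hα hb hb0 (hx i) (hx0 i) _
  · exact pairFn_comp_differentiableAt h0 h1 ht ht0 (hx i) (hx0 i) (hx j) (hx0 j) _ _

end smooth

variable {n : ℕ} {t : ℂ} {α b : Fin 2 → ℂ}

lemma exists_radii (hb : ∀ l, b l ≠ 0) (hc : ConvCond q t α b n) :
    ∃ ρ : Fin 2 → ℝ, (∀ l, ‖α l‖ < ρ l) ∧
      ∀ k < n, q * (ρ 0 * ρ 1) / (‖b 0‖ * ‖b 1‖) < ‖t‖ ^ (2 * k) := by
  have hb0 : 0 < ‖b 0‖ * ‖b 1‖ := mul_pos (norm_pos_iff.2 (hb 0)) (norm_pos_iff.2 (hb 1))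
  have hev : ∀ᶠ ε : ℝ in 𝓝[>] 0, ∀ k ∈ Finset.range n,
      q * ((‖α 0‖ + ε) * (‖α 1‖ + ε)) / (‖b 0‖ * ‖b 1‖) < ‖t‖ ^ (2 * k) := by
    rw [Filter.eventually_all_finset]
    intro k hk
    have hcont : Continuous fun ε : ℝ => q * ((‖α 0‖ + ε) * (‖α 1‖ + ε)) / (‖b 0‖ * ‖b 1‖) := by
      fun_prop
    refine nhdsWithin_le_nhds (hcont.tendsto 0 (Iio_mem_nhds ?_))
    rw [add_zero, add_zero, div_lt_iff₀ hb0, mul_comm (‖t‖ ^ _)]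
    exact (hc k (Finset.mem_range.1 hk)).2
  obtain ⟨ε, h, hε⟩ := (hev.and self_mem_nhdsWithin).exists
  have hε : 0 < ε := hε
  exact ⟨fun l => ‖α l‖ + ε, fun l => by linarith, fun k hk => h k (Finset.mem_range.2 hk)⟩

include h0 h1

lemma exists_regTerm_majorant (ht : t ≠ 0) (hb : ∀ l, b l ≠ 0) (hc : ConvCond q t α b n) :
    ∃ ρ : Fin 2 → ℝ, (∀ l, ‖α l‖ < ρ l) ∧ ∀ r R : ℝ, 0 < r → ∃ u : (Fin n → ℤ) → ℝ, Summable u ∧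
      ∀ (α' : Fin 2 → ℂ) (x : Fin n → ℂ) (ν : Fin n → ℤ), (∀ l, ‖α' l‖ ≤ ρ l) →
        (∀ i, r ≤ ‖x i‖ ∧ ‖x i‖ ≤ R) → ‖regTerm q t α' b x ν‖ ≤ u ν := by
  obtain ⟨ρ, hρ, hρ2⟩ := exists_radii hb hc
  refine ⟨ρ, hρ, fun r R hr => ?_⟩
  have hρpos : ∀ l, 0 < ρ l := fun l => (norm_nonneg _).trans_lt (hρ l)
  have htpos : 0 < ‖t‖ := norm_pos_iff.2 ht
  obtain ⟨C₁, hC₁, hb₁⟩ := exists_oneVar_bound h0 h1 hb hρpos hr (R := R)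
  obtain ⟨C₂, hC₂, hb₂⟩ := exists_pairFn_bound h0 h1 hr htpos (R := R) (T₂ := ‖t‖)
  have hP : 0 ≤ q * (ρ 0 * ρ 1) / (‖b 0‖ * ‖b 1‖) := by
    have := hρpos 0
    have := hρpos 1
    positivity
  have hcc : ∀ k < n, q * ‖t‖ ^ (2 * k) < 1 ∧
      q * (ρ 0 * ρ 1) / (‖b 0‖ * ‖b 1‖) < ‖t‖ ^ (2 * k) :=
    fun k hk => ⟨(hc k hk).1, hρ2 k hk⟩
  refine ⟨_, (termMaj_summable h0 hP htpos htpos hcc hcc).mul_left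
    ((∏ _i : Fin n, C₁) * (∏ i : Fin n, ∏ _j ∈ Finset.Ioi i, C₂)), fun α' x ν hα' hx => ?_⟩
  exact norm_prod_le_termMaj h0 hP htpos le_rfl le_rfl hC₁ hC₂ ν
    (fun i => hb₁ α' _ _ hα' (hx i).1 (hx i).2)
    (fun i j _ => hb₂ t _ _ _ _ le_rfl le_rfl (hx i).1 (hx i).2 (hx j).1 (hx j).2)

omit h0 h1 in
lemma exists_annulus {x : Fin n → ℂ} (hx : ∀ i, x i ≠ 0) :
    ∃ r R : ℝ, 0 < r ∧ ∀ i, r < ‖x i‖ ∧ ‖x i‖ < R := by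
  have hev : ∀ᶠ r : ℝ in 𝓝[>] 0, ∀ i, r < ‖x i‖ := by
    rw [Filter.eventually_all]
    exact fun i => nhdsWithin_le_nhds (Iio_mem_nhds (norm_pos_iff.2 (hx i)))
  obtain ⟨r, hr, hr0⟩ := (hev.and self_mem_nhdsWithin).exists
  have hev2 : ∀ᶠ R : ℝ in atTop, ∀ i, ‖x i‖ < R := by
    rw [Filter.eventually_all]
    exact fun i => eventually_gt_atTop _
  obtain ⟨R, hR⟩ := hev2.exists
  exact ⟨r, R, hr0, fun i => ⟨hr i, hR i⟩⟩

lemma regTerm_summable (ht : t ≠ 0) (hb : ∀ l, b l ≠ 0) (hc : ConvCond q t α b n)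
    {x : Fin n → ℂ} (hx : ∀ i, x i ≠ 0) : Summable (regTerm q t α b x) := by
  obtain ⟨ρ, hρ, h⟩ := exists_regTerm_majorant h0 h1 ht hb hc
  obtain ⟨r, R, hr, hrR⟩ := exists_annulus hx
  obtain ⟨u, hu, hle⟩ := h r R hr
  exact hu.of_norm_bounded fun ν => hle α x ν (fun l => (hρ l).le)
    fun i => ⟨(hrR i).1.le, (hrR i).2.le⟩

lemma regSum_continuousAt (ht : t ≠ 0) (hb : ∀ l, b l ≠ 0) (hc : ConvCond q t α b n)
    {x : Fin n → ℂ} (hx : ∀ i, x i ≠ 0) : ContinuousAt (regSum q t α b) x := by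
  obtain ⟨ρ, hρ, h⟩ := exists_regTerm_majorant h0 h1 ht hb hc
  obtain ⟨r, R, hr, hrR⟩ := exists_annulus hx
  obtain ⟨u, hu, hle⟩ := h r R hr
  have hopen : IsOpen {y : Fin n → ℂ | ∀ i, r < ‖y i‖ ∧ ‖y i‖ < R} := by
    rw [show {y : Fin n → ℂ | ∀ i, r < ‖y i‖ ∧ ‖y i‖ < R} = ⋂ i, {y | r < ‖y i‖ ∧ ‖y i‖ < R} by
      ext; simp]
    refine isOpen_iInter_of_finite fun i => ?_
    have hc : Continuous fun y : Fin n → ℂ => ‖y i‖ := by fun_prop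
    exact (isOpen_lt continuous_const hc).inter (isOpen_lt hc continuous_const)
  have hcont : ContinuousOn (fun y => ∑' ν, regTerm q t α b y ν)
      {y : Fin n → ℂ | ∀ i, r < ‖y i‖ ∧ ‖y i‖ < R} := by
    refine continuousOn_tsum (fun ν y hy => ?_) hu
      (fun ν y hy => hle α y ν (fun l => (hρ l).le) fun i => ⟨(hy i).1.le, (hy i).2.le⟩)
    refine ContinuousAt.continuousWithinAt (DifferentiableAt.continuousAt (𝕜 := ℂ) ?_)
    exact regTerm_comp_differentiableAt h0 h1 (t := fun _ => t) (α := fun _ => α) (b := fun _ => b)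
      (x := fun y => y) (differentiableAt_const _) ht (fun _ => differentiableAt_const _)
      (fun _ => differentiableAt_const _) hb (fun i => by fun_prop)
      (fun i => norm_pos_iff.1 (hr.trans (hy i).1)) ν
  exact hcont.continuousAt (hopen.mem_nhds hrR)

lemma regSum_update_differentiableAt (ht : t ≠ 0) (hb : ∀ l, b l ≠ 0) (hc : ConvCond q t α b n)
    {x : Fin n → ℂ} (hx : ∀ i, x i ≠ 0) (k : Fin n) {y : ℂ} (hy : y ≠ 0) :
    DifferentiableAt ℂ (fun y => regSum q t α b (Function.update x k y)) y := by
  obtain ⟨ρ, hρ, h⟩ := exists_regTerm_majorant h0 h1 ht hb hc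
  have hxy : ∀ i, Function.update x k y i ≠ 0 := fun i => by
    by_cases hi : i = k
    · subst hi; simpa
    · simpa [hi] using hx i
  obtain ⟨r, R, hr, hrR⟩ := exists_annulus hxy
  obtain ⟨u, hu, hle⟩ := h r R hr
  have hopen : IsOpen {z : ℂ | r < ‖z‖ ∧ ‖z‖ < R} :=
    (isOpen_lt continuous_const continuous_norm).inter (isOpen_lt continuous_norm continuous_const)
  have hmem : ∀ z ∈ {z : ℂ | r < ‖z‖ ∧ ‖z‖ < R}, ∀ i,
      r < ‖Function.update x k z i‖ ∧ ‖Function.update x k z i‖ < R := fun z hz i => by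
    by_cases hi : i = k
    · subst hi; simpa using hz
    · simpa [hi] using hrR i
  have hd := Complex.differentiableOn_tsum_of_summable_norm (U := {z : ℂ | r < ‖z‖ ∧ ‖z‖ < R})
    (F := fun ν z => regTerm q t α b (Function.update x k z) ν) hu
    (fun ν z hz => by
      refine DifferentiableAt.differentiableWithinAt ?_
      refine regTerm_comp_differentiableAt h0 h1 (t := fun _ => t) (α := fun _ => α)
        (b := fun _ => b) (x := fun y => Function.update x k y) (differentiableAt_const _) ht
        (fun _ => differentiableAt_const _) (fun _ => differentiableAt_const _) hb (fun i => ?_)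
        (fun i => norm_pos_iff.1 (hr.trans (hmem z hz i).1)) ν
      by_cases hi : i = k
      · subst hi; simp
      · simp [hi])
    hopen (fun ν z hz => hle α _ ν (fun l => (hρ l).le)
      fun i => ⟨(hmem z hz i).1.le, (hmem z hz i).2.le⟩)
  refine hd.differentiableAt (hopen.mem_nhds ?_)
  simpa using hrR k

/-- The regularized sum is holomorphic in the parameter `α₀`. -/
lemma regSum_alpha_differentiableAt (ht : t ≠ 0) (hb : ∀ l, b l ≠ 0) {α₀ α₁ : ℂ}
    (hc : ConvCond q t ![α₀, α₁] b n) {x : Fin n → ℂ} (hx : ∀ i, x i ≠ 0) :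
    DifferentiableAt ℂ (fun a => regSum q t ![a, α₁] b x) α₀ := by
  obtain ⟨ρ, hρ, h⟩ := exists_regTerm_majorant h0 h1 ht hb hc
  obtain ⟨r, R, hr, hrR⟩ := exists_annulus hx
  obtain ⟨u, hu, hle⟩ := h r R hr
  have hopen : IsOpen {z : ℂ | ‖z‖ < ρ 0} := isOpen_lt continuous_norm continuous_const
  have hd := Complex.differentiableOn_tsum_of_summable_norm (U := {z : ℂ | ‖z‖ < ρ 0})
    (F := fun ν z => regTerm q t ![z, α₁] b x ν) hu
    (fun ν z hz => by
      refine DifferentiableAt.differentiableWithinAt ?_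
      refine regTerm_comp_differentiableAt h0 h1 (t := fun _ => t) (α := fun z => ![z, α₁])
        (b := fun _ => b) (x := fun _ => x) (differentiableAt_const _) ht
        (fun l => ?_) (fun _ => differentiableAt_const _) hb (fun i => differentiableAt_const _)
        hx ν
      fin_cases l
      · simp
      · simp)
    hopen (fun ν z hz => hle _ _ ν (fun l => by
      fin_cases l
      · exact le_of_lt hz
      · exact (hρ 1).le)
      fun i => ⟨(hrR i).1.le, (hrR i).2.le⟩)
  exact hd.differentiableAt (hopen.mem_nhds (hρ 0))

end analytic

/-! ### Dividing by the elliptic Vandermonde product -/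

section generic

variable {q : ℝ} (h0 : 0 < q) (h1 : q < 1)

/-- The coordinates of `x` are pairwise inequivalent modulo multiplication by powers of `q`. -/
def IsGeneric (q : ℝ) {n : ℕ} (x : Fin n → ℂ) : Prop := ∀ i j, i ≠ j → theta q (x i / x j) ≠ 0

include h0 h1

lemma theta_div_swap {x y : ℂ} (hx : x ≠ 0) (hy : y ≠ 0) (h : theta q (x / y) ≠ 0) :
    theta q (y / x) ≠ 0 := by
  rwa [← inv_div, Ne, theta_inv_eq_zero_iff h0 h1 (div_ne_zero hx hy)]

omit h1 in
lemma exists_real_shift (B : Set ℂ) (hB : B.Countable) :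
    (0 : ℝ) ∈ closure {s : ℝ | ∀ w ∈ B, w ≠ 0 → ∀ d : ℤ, d ≠ 0 →
      ∀ k : ℤ, w * Complex.exp ((s * d : ℝ) : ℂ) ≠ (q : ℂ) ^ k} := by
  have hc : (⋃ w ∈ B, ⋃ d : ℤ, range fun k : ℤ => (k * Real.log q - Real.log ‖w‖) / d).Countable :=
    hB.biUnion fun w _ => countable_iUnion fun d => countable_range _
  refine closure_mono ?_ ((hc.dense_compl ℝ) 0)
  intro s hs w hw hw0 d hd k h
  refine hs ?_
  simp only [mem_iUnion, mem_range]
  refine ⟨w, hw, d, k, ?_⟩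
  have hd' : (d : ℝ) ≠ 0 := by exact_mod_cast hd
  have e := congrArg (fun z => Real.log ‖z‖) h
  simp only [norm_mul, norm_zpow, norm_q h0] at e
  rw [Complex.norm_exp, Complex.ofReal_re, Real.log_mul (norm_ne_zero_iff.2 hw0)
    (Real.exp_pos _).ne', Real.log_exp, Real.log_zpow] at e
  rw [div_eq_iff hd']
  linarith

/-- Two functions which are continuous on `(ℂ^*)^n` agree as soon as they agree at the generic
points that avoid countably many `q`-orbits. -/
lemma eq_of_eq_on_generic {n : ℕ} {f g : (Fin n → ℂ) → ℂ} {P : Set ℂ} (hP : P.Countable)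
    (hP0 : ∀ p ∈ P, p ≠ 0)
    (hf : ∀ x : Fin n → ℂ, (∀ i, x i ≠ 0) → ContinuousAt f x)
    (hg : ∀ x : Fin n → ℂ, (∀ i, x i ≠ 0) → ContinuousAt g x)
    (h : ∀ x : Fin n → ℂ, (∀ i, x i ≠ 0) → IsGeneric q x → (∀ i, ∀ p ∈ P, theta q (x i / p) ≠ 0) →
      f x = g x) {x : Fin n → ℂ} (hx : ∀ i, x i ≠ 0) : f x = g x := by
  set B : Set ℂ := (range fun p : Fin n × Fin n => x p.1 / x p.2) ∪
    ⋃ i, (fun p => x i / p) '' P with hBdef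
  have hB : B.Countable :=
    (countable_range _).union (countable_iUnion fun i => hP.image _)
  have hcl := exists_real_shift h0 B hB
  set D : Set ℝ := {s : ℝ | ∀ w ∈ B, w ≠ 0 → ∀ d : ℤ, d ≠ 0 →
      ∀ k : ℤ, w * Complex.exp ((s * d : ℝ) : ℂ) ≠ (q : ℂ) ^ k} with hD
  let c : ℝ → Fin n → ℂ := fun s i => x i * Complex.exp ((s * ((i : ℕ) + 1 : ℤ) : ℝ) : ℂ)
  have hc0 : c 0 = x := by
    ext i
    simp [c]
  have hcne : ∀ s i, c s i ≠ 0 := fun s i => mul_ne_zero (hx i) (Complex.exp_ne_zero _)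
  have hcc : Continuous c := by
    refine continuous_pi fun i => ?_
    fun_prop
  have hnb : (𝓝[D] (0 : ℝ)).NeBot := mem_closure_iff_nhdsWithin_neBot.1 hcl
  have key : ∀ s ∈ D, f (c s) = g (c s) := by
    intro s hs
    refine h _ (hcne s) (fun i j hij => ?_) (fun i p hp => ?_)
    · rw [Ne, theta_eq_zero_iff h0 h1 (div_ne_zero (hcne s i) (hcne s j))]
      rintro ⟨k, hk⟩
      refine hs (x i / x j) (Or.inl ⟨(i, j), rfl⟩) (div_ne_zero (hx i) (hx j))
        ((i : ℕ) - (j : ℕ) : ℤ) (by omega) k ?_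
      rw [← hk, div_mul_eq_mul_div, div_eq_div_iff (hx j) (hcne s j)]
      simp only [c]
      rw [mul_assoc, mul_left_comm (Complex.exp _) (x j), ← Complex.exp_add]
      rw [show ((s * ((i : ℕ) - (j : ℕ) : ℤ) : ℝ) : ℂ) + ((s * ((j : ℕ) + 1 : ℤ) : ℝ) : ℂ) =
        ((s * ((i : ℕ) + 1 : ℤ) : ℝ) : ℂ) by push_cast; ring]
      ring
    · rw [Ne, theta_eq_zero_iff h0 h1 (div_ne_zero (hcne s i) (hP0 p hp))]
      rintro ⟨k, hk⟩
      refine hs (x i / p) (Or.inr (mem_iUnion.2 ⟨i, p, hp, rfl⟩)) (div_ne_zero (hx i) (hP0 p hp))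
        ((i : ℕ) + 1 : ℤ) (by omega) k ?_
      rw [← hk]
      simp only [c]
      ring
  have t1 : Tendsto (fun s => f (c s)) (𝓝[D] 0) (𝓝 (f x)) := by
    have := (hf x hx).comp_of_eq (f := c) hcc.continuousAt (x := (0 : ℝ)) hc0
    rw [ContinuousAt, Function.comp_apply, hc0] at this
    exact this.mono_left nhdsWithin_le_nhds
  have t2 : Tendsto (fun s => g (c s)) (𝓝[D] 0) (𝓝 (g x)) := by
    have := (hg x hx).comp_of_eq (f := c) hcc.continuousAt (x := (0 : ℝ)) hc0
    rw [ContinuousAt, Function.comp_apply, hc0] at this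
    exact this.mono_left nhdsWithin_le_nhds
  refine tendsto_nhds_unique t1 (t2.congr' ?_)
  filter_upwards [self_mem_nhdsWithin] with s hs using (key s hs).symm

/-- Interpolation nodes: two per coordinate, all of them inequivalent modulo powers of `q`. -/
lemma exists_nodes {κ : ℂ} (hκ : κ ≠ 0) (n : ℕ) : ∃ u v : Fin n → ℂ, (∀ i, u i ≠ 0) ∧
    (∀ i, v i ≠ 0) ∧ IsGeneric q u ∧ IsGeneric q v ∧ (∀ i j, theta q (u i / v j) ≠ 0) ∧
    ∀ i, theta q (κ * u i * v i) ≠ 0 := by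
  obtain ⟨s, hs⟩ := closure_nonempty_iff.1 ⟨_, exists_real_shift (q := q) h0 {1} (by simp)⟩
  have hs : ∀ d : ℤ, d ≠ 0 → ∀ k : ℤ, Complex.exp ((s * d : ℝ) : ℂ) ≠ (q : ℂ) ^ k :=
    fun d hd k => by simpa using hs 1 (by simp) (by simp) d hd k
  -- the phase `ω` makes all the numbers `κ u v` real and negative
  obtain ⟨ω, hω⟩ : ∃ ω : ℂ, ω ^ 2 = -κ⁻¹ := IsAlgClosed.exists_pow_nat_eq _ (by norm_num)
  have hω0 : ω ≠ 0 := by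
    rintro rfl
    simp [hκ] at hω
  have hne : ∀ d : ℤ, ω * Complex.exp ((s * d : ℝ) : ℂ) ≠ 0 :=
    fun d => mul_ne_zero hω0 (Complex.exp_ne_zero _)
  have key : ∀ d e : ℤ, d ≠ e →
      theta q (ω * Complex.exp ((s * d : ℝ) : ℂ) / (ω * Complex.exp ((s * e : ℝ) : ℂ))) ≠ 0 := by
    intro d e hde
    rw [Ne, theta_eq_zero_iff h0 h1 (div_ne_zero (hne d) (hne e))]
    rintro ⟨k, hk⟩
    refine hs (d - e) (sub_ne_zero.2 hde) k ?_
    rw [← hk, mul_div_mul_left _ _ hω0, ← Complex.exp_sub]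
    congr 1
    push_cast
    ring
  refine ⟨fun i => ω * Complex.exp ((s * (2 * (i : ℕ) : ℤ) : ℝ) : ℂ),
    fun i => ω * Complex.exp ((s * (2 * (i : ℕ) + 1 : ℤ) : ℝ) : ℂ), fun i => hne _, fun i => hne _,
    fun i j hij => key _ _ (by omega), fun i j hij => key _ _ (by omega),
    fun i j => key _ _ (by omega), fun i => ?_⟩
  have e : κ * (ω * Complex.exp ((s * (2 * (i : ℕ) : ℤ) : ℝ) : ℂ)) *
      (ω * Complex.exp ((s * (2 * (i : ℕ) + 1 : ℤ) : ℝ) : ℂ)) =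
      ((-(Real.exp (s * (2 * (i : ℕ) : ℤ)) * Real.exp (s * (2 * (i : ℕ) + 1 : ℤ))) : ℝ) : ℂ) := by
    rw [← Complex.ofReal_exp, ← Complex.ofReal_exp, Complex.ofReal_neg, Complex.ofReal_mul]
    generalize ((Real.exp (s * (2 * (i : ℕ) : ℤ)) : ℝ) : ℂ) = A
    generalize ((Real.exp (s * (2 * (i : ℕ) + 1 : ℤ)) : ℝ) : ℂ) = B
    have : κ * ω ^ 2 = -1 := by rw [hω]; field_simp
    linear_combination A * B * this
  have hpos := mul_pos (Real.exp_pos (s * (2 * (i : ℕ) : ℤ)))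
    (Real.exp_pos (s * (2 * (i : ℕ) + 1 : ℤ)))
  rw [e, Ne, theta_eq_zero_iff h0 h1 (by
    rw [Complex.ofReal_ne_zero]
    exact (neg_neg_of_pos hpos).ne)]
  rintro ⟨k, hk⟩
  have hk' : -(Real.exp (s * (2 * (i : ℕ) : ℤ)) * Real.exp (s * (2 * (i : ℕ) + 1 : ℤ))) = q ^ k := by
    exact_mod_cast hk
  have := zpow_pos h0 k
  linarith

end generic

section quotient

variable {q : ℝ} (h0 : 0 < q) (h1 : q < 1)

/-- The quotient of the regularized sum by the elliptic Vandermonde product. -/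
def regRatio (q : ℝ) (t : ℂ) (α b : Fin 2 → ℂ) {n : ℕ} (x : Fin n → ℂ) : ℂ :=
  regSum q t α b x / thetaVandermonde q x

/-- The theta function of degree two in `y` that is `1` at `v` and `0` at `u`. -/
def slotCoeff (q : ℝ) (κ u v y : ℂ) : ℂ :=
  theta q (u / y) * theta q (κ * u * y) / (theta q (u / v) * theta q (κ * u * v))

include h0 h1

lemma isTwoTheta_slotCoeff {κ u : ℂ} (hκ : κ ≠ 0) (hu : u ≠ 0) (v : ℂ) :
    IsTwoTheta q κ (slotCoeff q κ u v) := by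
  have := (isTwoTheta_theta h0 h1 hκ hu).const_mul (theta q (u / v) * theta q (κ * u * v))⁻¹
  convert this using 2 with y
  unfold slotCoeff
  ring

variable {n : ℕ} {t : ℂ} {α b : Fin 2 → ℂ}

lemma thetaVandermonde_differentiableAt {x : Fin n → ℂ} (hx : ∀ i, x i ≠ 0) :
    DifferentiableAt ℂ (thetaVandermonde q) x := by
  unfold thetaVandermonde
  refine differentiableAt_prod _ fun i _ => differentiableAt_prod _ fun j _ => ?_
  have hi : DifferentiableAt ℂ (fun y : Fin n → ℂ => y i) x := by fun_prop
  have hj : DifferentiableAt ℂ (fun y : Fin n → ℂ => y j) x := by fun_prop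
  exact hi.mul (theta_comp_differentiableAt h0 h1 (differentiableAt_div hj hi (hx i))
    (div_ne_zero (hx j) (hx i)))

omit h0 h1 in
lemma update_ne_zero {x : Fin n → ℂ} (hx : ∀ i, x i ≠ 0) (k : Fin n) {y : ℂ} (hy : y ≠ 0) :
    ∀ i, Function.update x k y i ≠ 0 := fun i => by
  by_cases hi : i = k
  · subst hi; simpa
  · simpa [hi] using hx i

lemma regSum_eq_interpolation (ht : t ≠ 0) (hb : ∀ l, b l ≠ 0) (hc : ConvCond q t α b (n + 1))
    {κ : ℂ} (hκ : κ = b 0 * b 1 * t ^ n)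
    {x : Fin (n + 1) → ℂ} (hx : ∀ i, x i ≠ 0) (k : Fin (n + 1)) {u v : ℂ} (hu : u ≠ 0) (hv : v ≠ 0)
    (hgu : IsGeneric q (Function.update x k u)) (hgv : IsGeneric q (Function.update x k v))
    (huv : theta q (u / v) ≠ 0) (hκuv : theta q (κ * u * v) ≠ 0) {y : ℂ} (hy : y ≠ 0) :
    regSum q t α b (Function.update x k y) =
      (slotCoeff q κ v u y * regRatio q t α b (Function.update x k u) +
        slotCoeff q κ u v y * regRatio q t α b (Function.update x k v)) *
      thetaVandermonde q (Function.update x k y) := by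
  have hq := q_ne h0
  have hκ0 : κ ≠ 0 := by
    rw [hκ]
    exact mul_ne_zero (mul_ne_zero (hb 0) (hb 1)) (pow_ne_zero _ ht)
  have hvu := theta_div_swap h0 h1 hu hv huv
  have hκvu : theta q (κ * v * u) ≠ 0 := by rwa [mul_right_comm]
  have hA : ∀ z ≠ 0, IsGeneric q (Function.update x k z) →
      thetaVandermonde q (Function.update x k z) ≠ 0 := fun z hz hg =>
    thetaVandermonde_ne_zero h0 h1 (update_ne_zero hx k hz) fun i j hij => hg j i hij.ne'
  have hd : ∀ y ≠ 0, DifferentiableAt ℂ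
      (fun y => thetaVandermonde q (Function.update x k y)) y := fun y hy =>
    DifferentiableAt.comp (g := thetaVandermonde q) y
      (thetaVandermonde_differentiableAt h0 h1 (update_ne_zero hx k hy))
      (differentiableAt_pi.2 fun i => by
        by_cases hi : i = k
        · subst hi; simp
        · simp [hi])
  have key := eq_zero_of_zeros h0 h1 (n + 1 + 1)
    (φ := fun y => regSum q t α b (Function.update x k y) -
      (slotCoeff q κ v u y * regRatio q t α b (Function.update x k u) +
        slotCoeff q κ u v y * regRatio q t α b (Function.update x k v)) *
      thetaVandermonde q (Function.update x k y))
    (c := (q * κ)⁻¹ * ∏ j ∈ Finset.univ.erase k, -x j) (fun y hy => ?_) (fun y hy => ?_)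
    (Fin.cons v (Function.update x k u)) (fun i => ?_) (fun i => ?_) (fun i j hij => ?_)
    (fun m hm => ?_) y hy
  · exact sub_eq_zero.1 key
  · refine (regSum_update_differentiableAt h0 h1 ht hb hc hx k hy).sub (DifferentiableAt.mul ?_
      (hd y hy))
    exact (((isTwoTheta_slotCoeff h0 h1 hκ0 hv u).1 y hy).mul_const _).add
      (((isTwoTheta_slotCoeff h0 h1 hκ0 hu v).1 y hy).mul_const _)
  · have hxy := update_ne_zero hx k hy
    have eu : Function.update x k (q * y) = Function.update (Function.update x k y) k
        (q * Function.update x k y k) := by simp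
    have s1 := regSum_update_q_mul h0 h1 ht α hb hxy k
    have s2 := thetaVandermonde_update_q_mul h0 h1 hxy k
    rw [← eu] at s1 s2
    have e1 : ∏ j ∈ Finset.univ.erase k,
        -(Function.update x k y j / (Function.update x k y k * t)) =
        (∏ j ∈ Finset.univ.erase k, -x j) * ((y * t) ^ n)⁻¹ := by
      have : ∀ j ∈ Finset.univ.erase k, -(Function.update x k y j / (Function.update x k y k * t)) =
          -x j * (y * t)⁻¹ := by
        intro j hj
        simp [Finset.ne_of_mem_erase hj]
        ring
      rw [Finset.prod_congr rfl this, Finset.prod_mul_distrib, Finset.prod_const,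
        Finset.card_erase_of_mem (Finset.mem_univ k), inv_pow]
      simp
    have e2 : ∏ j ∈ Finset.univ.erase k, -(Function.update x k y j / Function.update x k y k) =
        (∏ j ∈ Finset.univ.erase k, -x j) * (y ^ n)⁻¹ := by
      have : ∀ j ∈ Finset.univ.erase k, -(Function.update x k y j / Function.update x k y k) =
          -x j * y⁻¹ := by
        intro j hj
        simp [Finset.ne_of_mem_erase hj]
        ring
      rw [Finset.prod_congr rfl this, Finset.prod_mul_distrib, Finset.prod_const,
        Finset.card_erase_of_mem (Finset.mem_univ k)]
      simp
    rw [e1] at s1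
    rw [e2] at s2
    simp only [s1, s2, (isTwoTheta_slotCoeff h0 h1 hκ0 hv u).2 y hy,
      (isTwoTheta_slotCoeff h0 h1 hκ0 hu v).2 y hy, Function.update_self]
    have e3 : (q * (b 0 * b 1))⁻¹ * (y ^ 2)⁻¹ * ((∏ j ∈ Finset.univ.erase k, -x j) *
        ((y * t) ^ n)⁻¹) = (q * κ)⁻¹ * (∏ j ∈ Finset.univ.erase k, -x j) * (y ^ (n + 1 + 1))⁻¹ := by
      rw [hκ]
      generalize ∏ j ∈ Finset.univ.erase k, -x j = Q
      have := hb 0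
      have := hb 1
      have := pow_ne_zero n ht
      have := pow_ne_zero n hy
      rw [mul_pow, pow_succ y (n + 1), pow_succ y n]
      field_simp
    rw [e3]
    rw [show (y ^ (n + 1 + 1))⁻¹ = (y ^ 2)⁻¹ * (y ^ n)⁻¹ by rw [← mul_inv, ← pow_add]; ring_nf]
    ring
  · refine Fin.cases ?_ (fun i => ?_) i
    · simpa using hv
    · simpa using update_ne_zero hx k hu i
  · have hz : ∀ j, j ≠ k → regSum q t α b (Function.update x k (x j)) = 0 ∧
        thetaVandermonde q (Function.update x k (x j)) = 0 := by
      intro j hj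
      have e : Function.update x k (x j) k = Function.update x k (x j) j := by simp [hj]
      exact ⟨eq_zero_of_perm_antisymm (f := regSum q t α b)
        (fun x hx σ => regSum_perm h0 h1 ht α b hx σ) (update_ne_zero hx k (hx j)) hj.symm e,
        eq_zero_of_perm_antisymm (f := thetaVandermonde q)
        (fun x hx σ => thetaVandermonde_perm h0 h1 hx σ) (update_ne_zero hx k (hx j)) hj.symm e⟩
    refine Fin.cases ?_ (fun i => ?_) i
    · simp only [Fin.cons_zero]
      unfold slotCoeff regRatio
      rw [div_self hv, theta_one h0 h1, zero_mul, zero_div, zero_mul, zero_add,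
        div_self (mul_ne_zero huv hκuv), one_mul, div_mul_cancel₀ _ (hA v hv hgv), sub_self]
    · simp only [Fin.cons_succ]
      by_cases hi : i = k
      · subst hi
        simp only [Function.update_self]
        unfold slotCoeff regRatio
        rw [div_self hu, theta_one h0 h1, zero_mul, zero_div, zero_mul, add_zero,
          div_self (mul_ne_zero hvu hκvu), one_mul, div_mul_cancel₀ _ (hA u hu hgu), sub_self]
      · rw [Function.update_of_ne hi, (hz i hi).1, (hz i hi).2]
        ring
  · induction j using Fin.cases with
    | zero => exact absurd hij (by simp)
    | succ j =>
      induction i using Fin.cases with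
      | zero =>
        simp only [Fin.cons_zero, Fin.cons_succ]
        by_cases hj : j = k
        · subst hj; simpa
        · have := hgv j k hj
          simpa [hj] using this
      | succ i =>
        simp only [Fin.cons_succ]
        exact hgu j i (by rintro rfl; simp at hij)
  · apply hκuv
    rw [theta_eq_zero_iff h0 h1 (by simp [hκ0, hu, hv])]
    refine ⟨-m - 1, ?_⟩
    rw [Fin.prod_univ_succ] at hm
    simp only [Fin.cons_zero, Fin.cons_succ] at hm
    rw [← Finset.mul_prod_erase _ _ (Finset.mem_univ k), Function.update_self,
      Finset.prod_congr rfl (f := fun j => -Function.update x k u j) (g := fun j => -x j)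
        (fun j hj => by rw [Function.update_of_ne (Finset.ne_of_mem_erase hj)])] at hm
    have hQ : ∏ j ∈ Finset.univ.erase k, -x j ≠ 0 :=
      Finset.prod_ne_zero_iff.2 fun j _ => neg_ne_zero.2 (hx j)
    generalize ∏ j ∈ Finset.univ.erase k, -x j = Q at *
    have hqk : (q : ℂ) ^ m ≠ 0 := zpow_ne_zero _ hq
    rw [zpow_sub_one₀ hq, zpow_neg]
    field_simp at hm ⊢
    linear_combination -hm

/-- The regularized sum is the product of the elliptic Vandermonde product and a symmetric
holomorphic function on `(ℂ^*)^n`, a theta function of degree two in every coordinate.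
The quotient is defined by interpolation in every coordinate, at inequivalent nodes. -/
theorem exists_regSum_eq_mul (ht : t ≠ 0) (hb : ∀ l, b l ≠ 0) (hc : ConvCond q t α b (n + 1)) :
    ∃ F : (Fin (n + 1) → ℂ) → ℂ,
      (∀ x, (∀ i, x i ≠ 0) → DifferentiableAt ℂ F x) ∧
      (∀ x, (∀ i, x i ≠ 0) → regSum q t α b x = F x * thetaVandermonde q x) ∧
      (∀ (σ : Equiv.Perm (Fin (n + 1))) (x : Fin (n + 1) → ℂ), (∀ i, x i ≠ 0) → F (x ∘ σ) = F x) ∧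
      ∀ x : Fin (n + 1) → ℂ, (∀ i, x i ≠ 0) → ∀ k,
        IsTwoTheta q (b 0 * b 1 * t ^ n) (fun y => F (Function.update x k y)) := by
  have hκ0 : b 0 * b 1 * t ^ n ≠ 0 := mul_ne_zero (mul_ne_zero (hb 0) (hb 1)) (pow_ne_zero _ ht)
  obtain ⟨κ, hκ⟩ : ∃ κ, κ = b 0 * b 1 * t ^ n := ⟨_, rfl⟩
  rw [← hκ] at hκ0 ⊢
  obtain ⟨u, v, hu, hv, hgu, hgv, huv, hκuv⟩ := exists_nodes h0 h1 hκ0 (n + 1)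
  set mixed : Finset (Fin (n + 1)) → Finset (Fin (n + 1)) → (Fin (n + 1) → ℂ) → Fin (n + 1) → ℂ :=
    fun S R x k => if k ∈ R then u k else if k ∈ S then v k else x k with hmixed
  set coeff : Finset (Fin (n + 1)) → Fin (n + 1) → ℂ → ℂ := fun R k y =>
    if k ∈ R then slotCoeff q κ (v k) (u k) y else slotCoeff q κ (u k) (v k) y with hcoeff
  have hcoeffV : ∀ R k, IsTwoTheta q κ (coeff R k) := fun R k => by
    simp only [hcoeff]
    split_ifs
    · exact isTwoTheta_slotCoeff h0 h1 hκ0 (hv k) _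
    · exact isTwoTheta_slotCoeff h0 h1 hκ0 (hu k) _
  set F : (Fin (n + 1) → ℂ) → ℂ := fun x =>
    ∑ R ∈ (Finset.univ : Finset (Fin (n + 1))).powerset,
      regRatio q t α b (mixed Finset.univ R (fun _ => 0)) * ∏ k, coeff R k (x k) with hF
  have hFd : ∀ x, (∀ i, x i ≠ 0) → DifferentiableAt ℂ F x := fun x hx => by
    refine DifferentiableAt.fun_sum fun R _ => DifferentiableAt.const_mul ?_ _
    refine differentiableAt_prod _ fun k _ => ?_
    have hk : DifferentiableAt ℂ (fun y : Fin (n + 1) → ℂ => y k) x := by fun_prop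
    exact DifferentiableAt.comp (g := coeff R k) x ((hcoeffV R k).1 _ (hx k)) hk
  set P : Set ℂ := range u ∪ range v with hP
  have hPc : P.Countable := (countable_range _).union (countable_range _)
  have hP0 : ∀ p ∈ P, p ≠ 0 := by
    rintro p (⟨i, rfl⟩ | ⟨i, rfl⟩)
    exacts [hu i, hv i]
  have hvu : ∀ i j, theta q (v i / u j) ≠ 0 := fun i j =>
    theta_div_swap h0 h1 (hu j) (hv i) (huv j i)
  have hgen : ∀ x : Fin (n + 1) → ℂ, (∀ i, x i ≠ 0) → IsGeneric q x →
      (∀ i, ∀ p ∈ P, theta q (x i / p) ≠ 0) → ∀ S R, IsGeneric q (mixed S R x) := by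
    intro x hx hgx hxP S R i j hij
    have a1 : ∀ i j, theta q (x i / u j) ≠ 0 := fun i j => hxP i _ (Or.inl ⟨j, rfl⟩)
    have a2 : ∀ i j, theta q (x i / v j) ≠ 0 := fun i j => hxP i _ (Or.inr ⟨j, rfl⟩)
    have a3 : ∀ i j, theta q (u i / x j) ≠ 0 := fun i j => theta_div_swap h0 h1 (hx j) (hu i) (a1 j i)
    have a4 : ∀ i j, theta q (v i / x j) ≠ 0 := fun i j => theta_div_swap h0 h1 (hx j) (hv i) (a2 j i)
    simp only [hmixed]
    split_ifs
    exacts [hgu i j hij, huv i j, a3 i j, hvu i j, hgv i j hij, a4 i j, a1 i j, a2 i j, hgx i j hij]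
  have hmne : ∀ x : Fin (n + 1) → ℂ, (∀ i, x i ≠ 0) → ∀ S R i, mixed S R x i ≠ 0 := by
    intro x hx S R i
    simp only [hmixed]
    split_ifs
    exacts [hu i, hv i, hx i]
  have hmu : ∀ (x : Fin (n + 1) → ℂ) S R a, Function.update (mixed S R x) a (u a) =
      mixed (insert a S) (insert a R) x := by
    intro x S R a
    ext k
    by_cases hk : k = a
    · subst hk; simp [hmixed]
    · simp [hmixed, hk]
  have hmv : ∀ (x : Fin (n + 1) → ℂ) S R a, a ∉ R → Function.update (mixed S R x) a (v a) =
      mixed (insert a S) R x := by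
    intro x S R a ha
    ext k
    by_cases hk : k = a
    · subst hk; simp [hmixed, ha]
    · simp [hmixed, hk]
  -- interpolating one coordinate after the other
  have hstep : ∀ x : Fin (n + 1) → ℂ, (∀ i, x i ≠ 0) → IsGeneric q x →
      (∀ i, ∀ p ∈ P, theta q (x i / p) ≠ 0) → ∀ S : Finset (Fin (n + 1)),
      regRatio q t α b x = ∑ R ∈ S.powerset,
        regRatio q t α b (mixed S R x) * ∏ k ∈ S, coeff R k (x k) := by
    intro x hx hgx hxP S
    induction S using Finset.induction_on with
    | empty => simp [hmixed]
    | insert a S ha ih =>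
      rw [ih, Finset.sum_powerset_insert ha, ← Finset.sum_add_distrib]
      refine Finset.sum_congr rfl fun R hR => ?_
      have haR : a ∉ R := fun h => ha (Finset.mem_powerset.1 hR h)
      have e0 : Function.update (mixed S R x) a (x a) = mixed S R x := by
        have : mixed S R x a = x a := by simp [hmixed, haR, ha]
        rw [← this, Function.update_eq_self]
      have gu : IsGeneric q (Function.update (mixed S R x) a (u a)) := by
        rw [hmu]; exact hgen x hx hgx hxP _ _
      have gv : IsGeneric q (Function.update (mixed S R x) a (v a)) := by
        rw [hmv x S R a haR]; exact hgen x hx hgx hxP _ _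
      have hi := regSum_eq_interpolation h0 h1 ht hb hc hκ (hmne x hx S R) a (hu a) (hv a) gu gv
        (huv a a) (hκuv a) (hx a)
      have hA : thetaVandermonde q (mixed S R x) ≠ 0 :=
        thetaVandermonde_ne_zero h0 h1 (hmne x hx S R)
          fun i j hij => hgen x hx hgx hxP S R j i hij.ne'
      rw [e0, hmu, hmv x S R a haR, ← div_eq_iff hA] at hi
      have hco : ∏ k ∈ S, coeff (insert a R) k (x k) = ∏ k ∈ S, coeff R k (x k) :=
        Finset.prod_congr rfl fun k hk => by
          have : k ≠ a := fun h => ha (h ▸ hk)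
          simp [hcoeff, this]
      have hca : coeff R a (x a) = slotCoeff q κ (u a) (v a) (x a) := by simp [hcoeff, haR]
      have hca2 : coeff (insert a R) a (x a) = slotCoeff q κ (v a) (u a) (x a) := by simp [hcoeff]
      rw [Finset.prod_insert ha, Finset.prod_insert ha, hco, hca, hca2,
        show regRatio q t α b (mixed S R x) = _ from hi]
      ring
  have hmul : ∀ x, (∀ i, x i ≠ 0) → regSum q t α b x = F x * thetaVandermonde q x := by
    intro x hx
    refine eq_of_eq_on_generic h0 h1 hPc hP0 (g := fun x => F x * thetaVandermonde q x)
      (fun x hx => regSum_continuousAt h0 h1 ht hb hc hx)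
      (fun x hx => (hFd x hx).continuousAt.mul
        (thetaVandermonde_differentiableAt h0 h1 hx).continuousAt) (fun x hx hgx hxP => ?_) hx
    have hA : thetaVandermonde q x ≠ 0 :=
      thetaVandermonde_ne_zero h0 h1 hx fun i j hij => hgx j i hij.ne'
    have := hstep x hx hgx hxP Finset.univ
    rw [regRatio, div_eq_iff hA] at this
    have e : ∀ R, mixed Finset.univ R x = mixed Finset.univ R fun _ => 0 := fun R => by
      ext k
      simp [hmixed]
    rw [this]
    simp only [hF, e]
  refine ⟨F, hFd, hmul, fun σ x hx => ?_, fun x hx k => ?_⟩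
  · refine eq_of_eq_on_generic h0 h1 (f := fun x => F (x ∘ σ)) (P := ∅) (by simp) (by simp)
      (fun x hx => ?_) (fun x hx => (hFd x hx).continuousAt) (fun x hx hgx _ => ?_) hx
    · refine ContinuousAt.comp (g := F) (hFd (x ∘ σ) fun i => hx _).continuousAt ?_
      exact Continuous.continuousAt (by fun_prop)
    · have hA : thetaVandermonde q x ≠ 0 :=
        thetaVandermonde_ne_zero h0 h1 hx fun i j hij => hgx j i hij.ne'
      have hs : ((Equiv.Perm.sign σ : ℤ) : ℂ) ≠ 0 := by
        exact_mod_cast (Equiv.Perm.sign σ).ne_zero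
      have e1 := hmul x hx
      have e2 := hmul (x ∘ σ) fun i => hx _
      rw [regSum_perm h0 h1 ht α b hx, thetaVandermonde_perm h0 h1 hx, e1] at e2
      have : F (x ∘ σ) * ((Equiv.Perm.sign σ : ℤ) * thetaVandermonde q x) =
          F x * ((Equiv.Perm.sign σ : ℤ) * thetaVandermonde q x) := by
        rw [← e2]; ring
      exact mul_right_cancel₀ (mul_ne_zero hs hA) this
  · have e : ∀ R y, ∏ j, coeff R j (Function.update x k y j) =
        (∏ j ∈ Finset.univ.erase k, coeff R j (x j)) * coeff R k y := by
      intro R y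
      rw [← Finset.mul_prod_erase _ _ (Finset.mem_univ k), Function.update_self, mul_comm]
      congr 1
      exact Finset.prod_congr rfl fun j hj => by
        rw [Function.update_of_ne (Finset.ne_of_mem_erase hj)]
    simp only [hF, e]
    exact IsTwoTheta.sum _ fun R _ => ((hcoeffV R k).const_mul _).const_mul _

end quotient

/-! ### The regularized sum at geometric progressions -/

section cone

variable {q : ℝ} (h0 : 0 < q) (h1 : q < 1)

/-- The geometric progression `(ξ, ξ t, …, ξ t^{n-1})`. -/
def geomPoint (n : ℕ) (t ξ : ℂ) : Fin n → ℂ := fun i => ξ * t ^ (i : ℕ)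

lemma zeta_zero_eq_geomPoint (n : ℕ) (t x₁ x₂ : ℂ) : zeta n t 0 x₁ x₂ = geomPoint n t x₂ := by
  ext i
  simp [zeta, geomPoint]

lemma geomPoint_ne_zero {n : ℕ} {t ξ : ℂ} (ht : t ≠ 0) (hξ : ξ ≠ 0) (i : Fin n) :
    geomPoint n t ξ i ≠ 0 := mul_ne_zero hξ (pow_ne_zero _ ht)

include h0 h1

lemma qPoch_q_zpow_eq_zero_iff (k : ℤ) : qPoch q ((q : ℂ) ^ k) = 0 ↔ k ≤ 0 := by
  have hq := q_ne h0
  rw [qPoch_eq_zero_iff h0 h1]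
  constructor
  · rintro ⟨m, hm⟩
    rw [← zpow_natCast, ← zpow_add₀ hq] at hm
    have : (q : ℝ) ^ ((m : ℤ) + k) = 1 := by exact_mod_cast hm
    have := (zpow_eq_one_iff_right₀ h0.le h1.ne).1 this
    omega
  · intro hk
    obtain ⟨m, rfl⟩ : ∃ m : ℕ, k = -m := ⟨(-k).toNat, by omega⟩
    refine ⟨m, ?_⟩
    rw [← zpow_natCast, ← zpow_add₀ hq]
    simp

lemma regTerm_geomPoint_monotone {n : ℕ} {t ξ : ℂ} (ht : t ≠ 0) (hξ : ξ ≠ 0) {α b : Fin 2 → ℂ}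
    {ν : Fin (n + 1) → ℤ} (h : regTerm q t α b (geomPoint (n + 1) t ξ) ν ≠ 0) : Monotone ν := by
  rw [Fin.monotone_iff_le_succ]
  intro i
  by_contra hlt
  push Not at hlt
  apply h
  unfold regTerm
  refine mul_eq_zero_of_right _ (Finset.prod_eq_zero (Finset.mem_univ i.castSucc)
    (Finset.prod_eq_zero (Finset.mem_Ioi.2 (Fin.castSucc_lt_succ)) ?_))
  have hz : qPoch q (q * t⁻¹ * (geomPoint (n + 1) t ξ i.succ / geomPoint (n + 1) t ξ i.castSucc *
      (q : ℂ) ^ (ν i.succ - ν i.castSucc))) = 0 := by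
    have e : q * t⁻¹ * (geomPoint (n + 1) t ξ i.succ / geomPoint (n + 1) t ξ i.castSucc *
      (q : ℂ) ^ (ν i.succ - ν i.castSucc)) = (q : ℂ) ^ (1 + (ν i.succ - ν i.castSucc)) := by
      rw [zpow_add₀ (q_ne h0), zpow_one]
      simp only [geomPoint, Fin.val_succ, Fin.val_castSucc, pow_succ]
      have := pow_ne_zero (i : ℕ) ht
      field_simp
    rw [e, qPoch_q_zpow_eq_zero_iff h0 h1]
    omega
  unfold pairFn
  rw [hz]
  ring

lemma regTerm_geomPoint_last_nonpos {n : ℕ} {t ξ : ℂ} {α b : Fin 2 → ℂ} (l : Fin 2)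
    (hbl : b l * (ξ * t ^ n) = 1)
    {ν : Fin (n + 1) → ℤ} (h : regTerm q t α b (geomPoint (n + 1) t ξ) ν ≠ 0) :
    ν (Fin.last n) ≤ 0 := by
  by_contra hlt
  push Not at hlt
  apply h
  unfold regTerm
  refine mul_eq_zero_of_left (Finset.prod_eq_zero (Finset.mem_univ (Fin.last n)) ?_) _
  unfold oneVar
  refine mul_eq_zero_of_right _ (Finset.prod_eq_zero (Finset.mem_univ l)
    (mul_eq_zero_of_right _ ?_))
  simp only [geomPoint, Fin.val_last, hbl, thetaQuot]
  have : qPoch q (q / (1 * (q : ℂ) ^ ν (Fin.last n))) = 0 := by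
    rw [one_mul, show (q : ℂ) / (q : ℂ) ^ ν (Fin.last n) = (q : ℂ) ^ (1 - ν (Fin.last n)) by
      rw [zpow_sub₀ (q_ne h0), zpow_one], qPoch_q_zpow_eq_zero_iff h0 h1]
    omega
  rw [this]
  ring

lemma oneVar_eq_zero_of_numerator {α b : Fin 2 → ℂ} {x : ℂ} (l : Fin 2) {m k : ℤ}
    (hm : α l * x = (q : ℂ) ^ m) (hk : m + k < 0) : oneVar q α b x k = 0 := by
  unfold oneVar
  refine mul_eq_zero_of_right _ (Finset.prod_eq_zero (Finset.mem_univ l)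
    (mul_eq_zero_of_left ?_ _))
  rw [show q * α l * (x * (q : ℂ) ^ k) = (q : ℂ) ^ (1 + m + k) by
    rw [zpow_add₀ (q_ne h0), zpow_add₀ (q_ne h0), zpow_one, ← hm]; ring,
    qPoch_q_zpow_eq_zero_iff h0 h1]
  omega

lemma regTerm_eq_zero_of_numerator {n : ℕ} {t : ℂ} {α b : Fin 2 → ℂ} {x : Fin n → ℂ}
    {ν : Fin n → ℤ} (l : Fin 2) (i : Fin n) {m : ℤ}
    (hm : α l * x i = (q : ℂ) ^ m) (hk : m + ν i < 0) : regTerm q t α b x ν = 0 := by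
  unfold regTerm
  exact mul_eq_zero_of_left (Finset.prod_eq_zero (Finset.mem_univ i)
    (oneVar_eq_zero_of_numerator h0 h1 l hm hk)) _

/-- If `α l * ξ` is a power of `q`, then the terms at a truncated progression are supported in a
finite box. -/
lemma regTerm_geomPoint_box {n : ℕ} {t ξ : ℂ} (ht : t ≠ 0) (hξ : ξ ≠ 0) {α b : Fin 2 → ℂ}
    (l l' : Fin 2) (hbl : b l * (ξ * t ^ n) = 1) {N : ℕ} (hα : α l' * ξ = (q : ℂ) ^ N)
    {ν : Fin (n + 1) → ℤ} (h : regTerm q t α b (geomPoint (n + 1) t ξ) ν ≠ 0) (i : Fin (n + 1)) :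
    -(N : ℤ) ≤ ν i ∧ ν i ≤ 0 := by
  have hmono := regTerm_geomPoint_monotone h0 h1 ht hξ h
  refine ⟨?_, (hmono (Fin.le_last i)).trans (regTerm_geomPoint_last_nonpos h0 h1 l hbl h)⟩
  refine le_trans ?_ (hmono (Fin.zero_le i))
  by_contra hlt
  refine h (regTerm_eq_zero_of_numerator h0 h1 l' 0 (m := N) ?_ ?_)
  · simpa [geomPoint] using hα
  · omega

/-- The sum at a truncated progression is finite. -/
lemma regSum_geomPoint_eq_sum {n : ℕ} {t ξ : ℂ} (ht : t ≠ 0) (hξ : ξ ≠ 0) {α b : Fin 2 → ℂ}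
    (l l' : Fin 2) (hbl : b l * (ξ * t ^ n) = 1) {N : ℕ} (hα : α l' * ξ = (q : ℂ) ^ N) :
    regSum q t α b (geomPoint (n + 1) t ξ) =
      ∑ ν ∈ Fintype.piFinset fun _ : Fin (n + 1) => Finset.Icc (-(N : ℤ)) 0,
        regTerm q t α b (geomPoint (n + 1) t ξ) ν := by
  refine tsum_eq_sum fun ν hν => ?_
  by_contra h
  refine hν (Fintype.mem_piFinset.2 fun i => Finset.mem_Icc.2 ?_)
  exact regTerm_geomPoint_box h0 h1 ht hξ l l' hbl hα h i

/-- If `α l = b l' t^k q^{-m}` with `1 ≤ m`, then all terms at the truncated progression of `b l'`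
vanish. -/
lemma regSum_geomPoint_eq_zero {n : ℕ} {t ξ : ℂ} (ht : t ≠ 0) (hξ : ξ ≠ 0) {α b : Fin 2 → ℂ}
    (l l' : Fin 2) (hbl : b l' * (ξ * t ^ n) = 1) {k : ℕ} (hk : k ≤ n) {m : ℕ} (hm : m ≠ 0)
    (hα : α l * (ξ * t ^ (n - k)) = (q : ℂ) ^ (-(m : ℤ))) :
    regSum q t α b (geomPoint (n + 1) t ξ) = 0 := by
  unfold regSum
  rw [← tsum_zero (L := .unconditional _) (α := ℂ) (β := Fin (n + 1) → ℤ)]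
  refine tsum_congr fun ν => ?_
  by_contra h
  have hmono := regTerm_geomPoint_monotone h0 h1 ht hξ h
  have hle := regTerm_geomPoint_last_nonpos h0 h1 l' hbl h
  have := hmono (Fin.le_last (⟨n - k, by omega⟩ : Fin (n + 1)))
  refine h (regTerm_eq_zero_of_numerator h0 h1 l (⟨n - k, by omega⟩ : Fin (n + 1))
    (m := -m) ?_ ?_)
  · simpa [geomPoint] using hα
  · omega

/-- On a finite box the terms are, up to a common factor, polynomials in the parameter `α₁`. -/
lemma exists_polynomial {n : ℕ} (t α₀ : ℂ) (b : Fin 2 → ℂ) (x : Fin n → ℂ) (N : ℕ) :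
    ∃ P : Polynomial ℂ, P.natDegree ≤ n * N ∧ ∀ α₁ : ℂ,
      ∑ ν ∈ Fintype.piFinset fun _ : Fin n => Finset.Icc (-(N : ℤ)) 0,
        regTerm q t ![α₀, α₁] b x ν = (∏ i, qPoch q (q * α₁ * x i)) * P.eval α₁ := by
  have hq := q_ne h0
  refine ⟨∑ ν ∈ Fintype.piFinset fun _ : Fin n => Finset.Icc (-(N : ℤ)) 0,
    Polynomial.C ((∏ i, ((q : ℂ) ^ ν i * (qPoch q (q * α₀ * (x i * (q : ℂ) ^ ν i)) *
      thetaQuot q (b 0 * x i) (ν i)) * thetaQuot q (b 1 * x i) (ν i))) *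
      ∏ i, ∏ j ∈ Finset.Ioi i, pairFn q t (x i) (x j) (ν i) (ν j)) *
    ∏ i, ∏ j ∈ Finset.range (-ν i).toNat,
      (1 - Polynomial.C ((q : ℂ) ^ j * (q * (x i * (q : ℂ) ^ ν i))) * Polynomial.X), ?_,
    fun α₁ => ?_⟩
  · refine Polynomial.natDegree_sum_le_of_forall_le _ _ fun ν hν => ?_
    refine (Polynomial.natDegree_C_mul_le _ _).trans ?_
    refine (Polynomial.natDegree_prod_le _ _).trans ?_
    refine (Finset.sum_le_card_nsmul _ _ N fun i _ => ?_).trans (by simp)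
    refine (Polynomial.natDegree_prod_le _ _).trans ?_
    refine (Finset.sum_le_card_nsmul _ _ 1 fun j _ => ?_).trans ?_
    · refine (Polynomial.natDegree_sub_le _ _).trans ?_
      simp only [Polynomial.natDegree_one, zero_le, sup_of_le_right]
      exact (Polynomial.natDegree_C_mul_le _ _).trans Polynomial.natDegree_X_le
    · have := Finset.mem_Icc.1 (Fintype.mem_piFinset.1 hν i)
      simp
      omega
  · rw [Polynomial.eval_finsetSum, Finset.mul_sum]
    refine Finset.sum_congr rfl fun ν hν => ?_
    simp only [Polynomial.eval_mul, Polynomial.eval_C, Polynomial.eval_prod, Polynomial.eval_sub,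
      Polynomial.eval_one, Polynomial.eval_X]
    unfold regTerm oneVar
    have e : ∀ i, (q : ℂ) ^ ν i * ∏ l, (qPoch q (q * ![α₀, α₁] l * (x i * (q : ℂ) ^ ν i)) *
        thetaQuot q (b l * x i) (ν i)) =
        ((q : ℂ) ^ ν i * (qPoch q (q * α₀ * (x i * (q : ℂ) ^ ν i)) *
          thetaQuot q (b 0 * x i) (ν i)) * thetaQuot q (b 1 * x i) (ν i)) *
        (qPoch q (q * α₁ * x i) * ∏ j ∈ Finset.range (-ν i).toNat,
          (1 - (q : ℂ) ^ j * (q * (x i * (q : ℂ) ^ ν i)) * α₁)) := by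
      intro i
      have hi := Finset.mem_Icc.1 (Fintype.mem_piFinset.1 hν i)
      have s := qPoch_split h0 h1 (q * α₁ * (x i * (q : ℂ) ^ ν i)) (-ν i).toNat
      have e2 : (q : ℂ) ^ (-ν i).toNat * (q * α₁ * (x i * (q : ℂ) ^ ν i)) = q * α₁ * x i := by
        rw [← zpow_natCast, Int.toNat_of_nonneg (by omega), zpow_neg]
        have := zpow_ne_zero (ν i) hq
        field_simp
      rw [e2] at s
      have e3 : ∏ j ∈ Finset.range (-ν i).toNat,
          (1 - (q : ℂ) ^ j * (q * (x i * (q : ℂ) ^ ν i)) * α₁) =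
          ∏ j ∈ Finset.range (-ν i).toNat,
          (1 - (q : ℂ) ^ j * (q * α₁ * (x i * (q : ℂ) ^ ν i))) :=
        Finset.prod_congr rfl fun j _ => by ring
      rw [Fin.prod_univ_two]
      simp only [Matrix.cons_val_zero, Matrix.cons_val_one, Matrix.cons_val_fin_one]
      rw [s, e3]
      ring
    rw [Finset.prod_congr rfl fun i _ => e i]
    simp only [Finset.prod_mul_distrib]
    ring

omit h0 h1 in
/-- A polynomial of degree at most `d` with `d` given nonzero roots is determined by its value at
one further point. -/
lemma polynomial_eval_mul_prod {ι : Type*} [Fintype ι] {P : Polynomial ℂ} {r : ι → ℂ}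
    (hr : Function.Injective r) (hr0 : ∀ i, r i ≠ 0) (hP : P.natDegree ≤ Fintype.card ι)
    (hroot : ∀ i, P.eval (r i) = 0) (y z : ℂ) :
    P.eval y * ∏ i, (1 - z / r i) = P.eval z * ∏ i, (1 - y / r i) := by
  classical
  by_cases hz : ∃ i, z = r i
  · obtain ⟨i, rfl⟩ := hz
    rw [hroot, Finset.prod_eq_zero (Finset.mem_univ i) (by rw [div_self (hr0 i), sub_self])]
    simp
  push Not at hz
  set Q : Polynomial ℂ := P * Polynomial.C (∏ i, (1 - z / r i)) - Polynomial.C (P.eval z) *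
    ∏ i, (1 - Polynomial.C (r i)⁻¹ * Polynomial.X) with hQ
  have hev : ∀ w, Q.eval w = P.eval w * ∏ i, (1 - z / r i) - P.eval z * ∏ i, (1 - w / r i) := by
    intro w
    simp only [hQ, Polynomial.eval_sub, Polynomial.eval_mul, Polynomial.eval_C,
      Polynomial.eval_prod, Polynomial.eval_one, Polynomial.eval_X]
    congr 2
    exact Finset.prod_congr rfl fun i _ => by ring
  have hdeg : Q.natDegree ≤ Fintype.card ι := by
    refine (Polynomial.natDegree_sub_le _ _).trans (max_le ?_ ?_)
    · exact (Polynomial.natDegree_mul_C_le _ _).trans hP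
    · refine (Polynomial.natDegree_C_mul_le _ _).trans ?_
      refine (Polynomial.natDegree_prod_le _ _).trans ?_
      refine (Finset.sum_le_card_nsmul _ _ 1 fun j _ => ?_).trans (by simp)
      refine (Polynomial.natDegree_sub_le _ _).trans ?_
      simp only [Polynomial.natDegree_one, zero_le, sup_of_le_right]
      exact (Polynomial.natDegree_C_mul_le _ _).trans Polynomial.natDegree_X_le
  have hQ0 : Q = 0 := by
    refine Polynomial.eq_zero_of_natDegree_lt_card_of_eval_eq_zero Q
      (f := fun o : Option ι => o.elim z r) ?_ ?_ ?_
    · intro a c hac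
      cases a <;> cases c <;> simp at hac ⊢
      · exact hz _ hac
      · exact hz _ hac.symm
      · exact hr hac
    · intro o
      cases o with
      | none => simp [hev]
      | some i =>
        have e : ∏ j, (1 - r i / r j) = 0 :=
          Finset.prod_eq_zero (Finset.mem_univ i) (by rw [div_self (hr0 i), sub_self])
        simp only [Option.elim_some, hev, hroot, e]
        ring
    · rw [Fintype.card_option]
      omega
  have := hev y
  rw [hQ0, Polynomial.eval_zero] at this
  linear_combination -this

end cone

/-! ### Evaluation at the truncated progression -/

section evaluation

variable {q : ℝ} (h0 : 0 < q) (h1 : q < 1)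

/-- The term of index `0` at the truncated progression of `b 0`, without the factors that depend
on `b 1` and `α`. -/
def coneConst (q : ℝ) (n : ℕ) (t b₀ : ℂ) : ℂ :=
  (∏ k ∈ Finset.range (n + 1), qPoch q (q * t ^ k)) *
    ∏ i, ∏ j ∈ Finset.Ioi i, pairFn q t (geomPoint (n + 1) t (b₀ * t ^ n)⁻¹ i)
      (geomPoint (n + 1) t (b₀ * t ^ n)⁻¹ j) 0 0

/-- The evaluation of the regularized sum at the truncated progression of `b 0`. -/
def ConeFormula (q : ℝ) (n : ℕ) (t : ℂ) (α b : Fin 2 → ℂ) : Prop :=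
  regSum q t α b (geomPoint (n + 1) t (b 0 * t ^ n)⁻¹) *
      ∏ k ∈ Finset.range (n + 1), qPoch q (q * (α 0 * α 1) / (b 0 * b 1 * t ^ (n + k))) =
    coneConst q n t (b 0) *
      ∏ k ∈ Finset.range (n + 1), ∏ l, ∏ l', qPoch q (q * α l / (b l' * t ^ k))

omit h0 h1 in
lemma prod_fin_reflect (n : ℕ) (f : ℕ → ℂ) :
    ∏ i : Fin (n + 1), f (n - i) = ∏ k ∈ Finset.range (n + 1), f k := by
  rw [Fin.prod_univ_eq_prod_range (fun i => f (n - i)) (n + 1),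
    ← Finset.prod_range_reflect f (n + 1)]
  rfl

include h0 h1

lemma theta_pow_ne_zero_of_norm_eq_one {t : ℂ} (ht : ‖t‖ = 1) (ht1 : ∀ k : ℕ, k ≠ 0 → t ^ k ≠ 1)
    {k : ℕ} (hk : k ≠ 0) : theta q (t ^ k) ≠ 0 := by
  have ht0 : t ≠ 0 := by
    rintro rfl
    simp at ht
  rw [Ne, theta_eq_zero_iff h0 h1 (pow_ne_zero _ ht0)]
  rintro ⟨m, hm⟩
  have e := congrArg norm hm
  rw [norm_pow, ht, one_pow, norm_zpow, norm_q h0] at e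
  have := (zpow_eq_one_iff_right₀ h0.le h1.ne).1 e.symm
  subst this
  exact ht1 k hk (by simpa using hm)

lemma thetaVandermonde_geomPoint_ne_zero {n : ℕ} {t ξ : ℂ} (ht : t ≠ 0) (hξ : ξ ≠ 0)
    (hθ : ∀ k ∈ Finset.range n, theta q (t ^ (k + 1)) ≠ 0) :
    thetaVandermonde q (geomPoint n t ξ) ≠ 0 := by
  refine thetaVandermonde_ne_zero h0 h1 (geomPoint_ne_zero ht hξ) fun i j hij => ?_
  have hij' : (i : ℕ) < j := hij
  have e : geomPoint n t ξ j / geomPoint n t ξ i = t ^ ((j : ℕ) - i - 1 + 1) := by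
    rw [div_eq_iff (geomPoint_ne_zero ht hξ i)]
    simp only [geomPoint]
    rw [mul_left_comm, ← pow_add]
    congr 2
    omega
  rw [e]
  exact hθ _ (Finset.mem_range.2 (by omega))

lemma interpCoeff_eq_zero {t B η x₁ x₂ : ℂ} {i j : ℕ} (hi : i ≠ 0)
    (hx : B * x₂ * t ^ ((i : ℤ) + j - 1) = 1) : interpCoeff q t B η x₁ x₂ i j = 0 := by
  have e : ∏ l ∈ Finset.range i, theta q (B * x₂ * t ^ ((i : ℤ) + j - 1 - l)) = 0 :=
    Finset.prod_eq_zero (Finset.mem_range.2 (Nat.pos_of_ne_zero hi)) (by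
      rw [Nat.cast_zero, sub_zero, hx, theta_one h0 h1])
  unfold interpCoeff
  rw [e]
  simp

/-- The zeros of the finite sum in the parameter `α₁`: there the terms at the truncated progression
of `b 1` all vanish, and the expansion of the value at one truncated progression has only one
term, the value at the other. -/
lemma regSum_geomPoint_root {n N : ℕ} {t : ℂ} (ht : ‖t‖ = 1) (ht1 : ∀ k : ℕ, k ≠ 0 → t ^ k ≠ 1)
    {b : Fin 2 → ℂ} (hb : ∀ l, b l ≠ 0) {k m : ℕ} (hk : k ≤ n) (hm : m < N) :
    regSum q t ![(q : ℂ) ^ N * b 0 * t ^ n, b 1 * t ^ k / (q : ℂ) ^ (m + 1)] b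
      (geomPoint (n + 1) t (b 0 * t ^ n)⁻¹) = 0 := by
  have hq := q_ne h0
  have ht0 : t ≠ 0 := by
    rintro rfl
    simp at ht
  have hb0 := hb 0
  have hb1 := hb 1
  have htn : t ^ n ≠ 0 := pow_ne_zero n ht0
  set α : Fin 2 → ℂ := ![(q : ℂ) ^ N * b 0 * t ^ n, b 1 * t ^ k / (q : ℂ) ^ (m + 1)] with hα
  have hc : ConvCond q t α b (n + 1) := by
    intro j _
    rw [ht, one_pow, mul_one, mul_one]
    refine ⟨h1, ?_⟩
    have e : ‖α 0‖ * ‖α 1‖ = q ^ N / q ^ (m + 1) * (‖b 0‖ * ‖b 1‖) := by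
      simp only [hα, Matrix.cons_val_zero, Matrix.cons_val_one, Matrix.cons_val_fin_one, norm_mul,
        norm_div, norm_pow, norm_q h0, ht, one_pow]
      ring
    have e2 : q * (q ^ N / q ^ (m + 1)) < 1 := by
      rw [← mul_div_assoc, div_lt_one (pow_pos h0 _), ← pow_succ']
      exact pow_lt_pow_right_of_lt_one₀ h0 h1 (by omega)
    have hpos : 0 < ‖b 0‖ * ‖b 1‖ := mul_pos (norm_pos_iff.2 hb0) (norm_pos_iff.2 hb1)
    rw [e, ← mul_assoc]
    exact mul_lt_of_lt_one_left hpos e2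
  obtain ⟨F, -, hF, hsym, hV⟩ := exists_regSum_eq_mul h0 h1 ht0 hb hc
  have hθ : ∀ k ∈ Finset.range (n + 1), theta q (t ^ (k + 1)) ≠ 0 := fun k _ =>
    theta_pow_ne_zero_of_norm_eq_one h0 h1 ht ht1 (by omega)
  have hθ' : ∀ {ξ : ℂ}, ξ ≠ 0 → thetaVandermonde q (geomPoint (n + 1) t ξ) ≠ 0 := fun hξ =>
    thetaVandermonde_geomPoint_ne_zero h0 h1 ht0 hξ hθ
  -- an auxiliary point `x₁` in general position
  obtain ⟨s, hs⟩ := closure_nonempty_iff.1 ⟨_, exists_real_shift (q := q) h0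
    (range fun e : ℤ × Bool => cond e.2 (b 0 * t ^ e.1) (b 1 * t ^ n * t ^ e.1))
    (countable_range _)⟩
  obtain ⟨x₁, hx₁⟩ : ∃ x₁, x₁ = Complex.exp ((s * (1 : ℤ) : ℝ) : ℂ) := ⟨_, rfl⟩
  have hx₁0 : x₁ ≠ 0 := by rw [hx₁]; exact Complex.exp_ne_zero _
  have hs1 : ∀ e : ℤ, theta q (b 0 * t ^ e * x₁) ≠ 0 := fun e => by
    have hne : b 0 * t ^ e ≠ 0 := mul_ne_zero hb0 (zpow_ne_zero _ ht0)
    rw [Ne, theta_eq_zero_iff h0 h1 (mul_ne_zero hne hx₁0), hx₁]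
    rintro ⟨k, hk⟩
    exact hs _ ⟨(e, true), rfl⟩ hne 1 one_ne_zero k hk
  have hs2 : ∀ e : ℤ, theta q (b 1 * t ^ n * t ^ e * x₁) ≠ 0 := fun e => by
    have hne : b 1 * t ^ n * t ^ e ≠ 0 := mul_ne_zero (mul_ne_zero hb1 htn) (zpow_ne_zero _ ht0)
    rw [Ne, theta_eq_zero_iff h0 h1 (mul_ne_zero hne hx₁0), hx₁]
    rintro ⟨k, hk⟩
    exact hs _ ⟨(e, false), rfl⟩ hne 1 one_ne_zero k hk
  have hexp := symmetric_expansion h0 h1 (n := n + 1) (B := b 1) (η := b 0 * t ^ n) (x₁ := x₁)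
    (x₂ := (b 1 * t ^ n)⁻¹) ht0 hb1 (mul_ne_zero hb0 htn) hx₁0 (inv_ne_zero (mul_ne_zero hb1 htn))
    hθ (fun e _ => ?_) hsym (by
      rw [show b 1 * (b 0 * t ^ n) = b 0 * b 1 * t ^ n by ring]
      exact hV)
  · have hF2 : F (geomPoint (n + 1) t (b 1 * t ^ n)⁻¹) = 0 := by
      have hξ : (b 1 * t ^ n)⁻¹ ≠ 0 := inv_ne_zero (mul_ne_zero hb1 htn)
      have e := hF _ (geomPoint_ne_zero (n := n + 1) ht0 hξ)
      rw [regSum_geomPoint_eq_zero h0 h1 ht0 hξ 1 1 (by field_simp) hk (m := m + 1) (by omega)] at e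
      · exact (mul_eq_zero.1 e.symm).resolve_right (hθ' hξ)
      · simp only [hα, Matrix.cons_val_one, Matrix.cons_val_fin_one]
        rw [zpow_neg, zpow_natCast]
        have e2 : t ^ n = t ^ k * t ^ (n - k) := by rw [← pow_add]; congr 1; omega
        have := pow_ne_zero k ht0
        have := pow_ne_zero (n - k) ht0
        rw [e2]
        field_simp
    rw [Finset.sum_eq_zero] at hexp
    · have hne : ∏ l ∈ Finset.range (n + 1),
          theta q (b 1 * (b 0 * t ^ n) * x₁ * (b 1 * t ^ n)⁻¹ * t ^ l) ≠ 0 := by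
        refine Finset.prod_ne_zero_iff.2 fun l _ => ?_
        have := hs1 l
        rw [zpow_natCast] at this
        rwa [show b 1 * (b 0 * t ^ n) * x₁ * (b 1 * t ^ n)⁻¹ * t ^ l = b 0 * t ^ l * x₁ by
          field_simp]
      rw [zeta_zero_eq_geomPoint] at hexp
      rw [hF _ (geomPoint_ne_zero ht0 (inv_ne_zero (mul_ne_zero hb0 htn))),
        (mul_eq_zero.1 hexp).resolve_left hne, zero_mul]
    · intro i hi
      rw [Finset.mem_range] at hi
      by_cases hi0 : i = 0
      · subst hi0
        rw [zeta_zero_eq_geomPoint, hF2, mul_zero]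
      · rw [interpCoeff_eq_zero h0 h1 hi0, zero_mul]
        rw [show (i : ℤ) + ((n + 1 - i : ℕ) : ℤ) - 1 = (n : ℕ) by omega, zpow_natCast]
        field_simp
  · have h := hs2 (-e)
    have h2 : b 1 * t ^ n * t ^ (-e) * x₁ ≠ 0 :=
      mul_ne_zero (mul_ne_zero (mul_ne_zero hb1 htn) (zpow_ne_zero _ ht0)) hx₁0
    rw [Ne, ← theta_inv_eq_zero_iff h0 h1 h2] at h
    rwa [show (b 1 * t ^ n)⁻¹ / x₁ * t ^ e = (b 1 * t ^ n * t ^ (-e) * x₁)⁻¹ by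
      rw [zpow_neg]
      field_simp]

/-- The product of the polynomial factors split off from `(q y / (b₁ t^k))_∞`. -/
lemma prod_qPoch_split (n N : ℕ) (t b₁ y : ℂ) :
    ∏ k ∈ Finset.range (n + 1), qPoch q (q * y / (b₁ * t ^ k)) =
      (∏ p : Fin (n + 1) × Fin N, (1 - y / (b₁ * t ^ (p.1 : ℕ) / (q : ℂ) ^ ((p.2 : ℕ) + 1)))) *
      ∏ k ∈ Finset.range (n + 1), qPoch q ((q : ℂ) ^ N * (q * y / (b₁ * t ^ k))) := by
  have e : ∀ k, qPoch q (q * y / (b₁ * t ^ k)) =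
      (∏ j : Fin N, (1 - y / (b₁ * t ^ k / (q : ℂ) ^ ((j : ℕ) + 1)))) *
        qPoch q ((q : ℂ) ^ N * (q * y / (b₁ * t ^ k))) := by
    intro k
    rw [qPoch_split h0 h1 _ N, Finset.prod_range]
    congr 1
    refine Finset.prod_congr rfl fun j _ => ?_
    rw [pow_succ, div_div_eq_mul_div]
    ring
  simp only [e, Finset.prod_mul_distrib]
  congr 1
  rw [Fintype.prod_prod_type, Finset.prod_range]

/-- The evaluation for a terminating sum, at a generic `t` on the unit circle. -/
lemma coneFormula_circle {n N : ℕ} {t : ℂ} (ht : ‖t‖ = 1) (ht1 : ∀ k : ℕ, k ≠ 0 → t ^ k ≠ 1)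
    {b : Fin 2 → ℂ} (hb : ∀ l, b l ≠ 0) (hgen : ∀ k : ℤ, ‖b 1‖ ≠ ‖b 0‖ * q ^ k) (α₁ : ℂ) :
    ConeFormula q n t ![(q : ℂ) ^ N * b 0 * t ^ n, α₁] b := by
  have hq := q_ne h0
  have ht0 : t ≠ 0 := by
    rintro rfl
    simp at ht
  have hb0 := hb 0
  have hb1 := hb 1
  have htn : t ^ n ≠ 0 := pow_ne_zero n ht0
  obtain ⟨ξ, hξ⟩ : ∃ ξ, ξ = (b 0 * t ^ n)⁻¹ := ⟨_, rfl⟩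
  have hξ0 : ξ ≠ 0 := by rw [hξ]; exact inv_ne_zero (mul_ne_zero hb0 htn)
  have hbξ : b 0 * (ξ * t ^ n) = 1 := by rw [hξ]; field_simp
  obtain ⟨P, hPdeg, hP⟩ := exists_polynomial h0 h1 t ((q : ℂ) ^ N * b 0 * t ^ n) b
    (geomPoint (n + 1) t ξ) N
  have hG : ∀ α₁, regSum q t ![(q : ℂ) ^ N * b 0 * t ^ n, α₁] b (geomPoint (n + 1) t ξ) =
      (∏ i, qPoch q (q * α₁ * geomPoint (n + 1) t ξ i)) * P.eval α₁ := fun α₁ => by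
    rw [regSum_geomPoint_eq_sum h0 h1 ht0 hξ0 0 0 hbξ (N := N), hP]
    simp only [Matrix.cons_val_zero]
    rw [hξ]
    field_simp
  -- the coordinates of the truncated progression
  have hx : ∀ i : Fin (n + 1), geomPoint (n + 1) t ξ i = (b 0 * t ^ (n - (i : ℕ)))⁻¹ := fun i => by
    have e : t ^ n = t ^ (i : ℕ) * t ^ (n - (i : ℕ)) := by rw [← pow_add]; congr 1; omega
    have := pow_ne_zero (i : ℕ) ht0
    have := pow_ne_zero (n - (i : ℕ)) ht0
    rw [hξ, e]
    simp only [geomPoint]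
    field_simp
  have hQ : ∀ y, ∏ i, qPoch q (q * y * geomPoint (n + 1) t ξ i) =
      ∏ k ∈ Finset.range (n + 1), qPoch q (q * y / (b 0 * t ^ k)) := fun y => by
    rw [← prod_fin_reflect n (fun k => qPoch q (q * y / (b 0 * t ^ k)))]
    refine Finset.prod_congr rfl fun i _ => ?_
    rw [hx, div_eq_mul_inv]
  -- the zeros of the polynomial factor
  set r : Fin (n + 1) × Fin N → ℂ := fun p => b 1 * t ^ (p.1 : ℕ) / (q : ℂ) ^ ((p.2 : ℕ) + 1) with hr
  have hr0 : ∀ p, r p ≠ 0 := fun p =>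
    div_ne_zero (mul_ne_zero hb1 (pow_ne_zero _ ht0)) (pow_ne_zero _ hq)
  have hrn : ∀ p, ‖r p‖ = ‖b 1‖ * q ^ (-((p.2 : ℕ) + 1 : ℤ)) := fun p => by
    simp only [hr, norm_div, norm_mul, norm_pow, ht, one_pow, norm_q h0]
    rw [zpow_neg]
    norm_cast
    rw [mul_one, div_eq_mul_inv]
  have hrinj : Function.Injective r := by
    intro p p' hpp
    have e := congrArg norm hpp
    rw [hrn, hrn] at e
    have e2 := mul_left_cancel₀ (norm_ne_zero_iff.2 hb1) e
    have e3 := zpow_right_injective₀ h0 h1.ne e2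
    have hp2 : (p.2 : ℕ) = p'.2 := by omega
    simp only [hr, hp2] at hpp
    rw [div_left_inj' (pow_ne_zero _ hq), mul_right_inj' hb1] at hpp
    have hp1 : (p.1 : ℕ) = p'.1 := by
      rcases lt_trichotomy (p.1 : ℕ) p'.1 with h | h | h
      · exfalso
        obtain ⟨d, hd⟩ := Nat.exists_eq_add_of_lt h
        refine ht1 (d + 1) (by omega) ?_
        rw [hd, add_assoc, pow_add] at hpp
        exact (mul_eq_left₀ (pow_ne_zero _ ht0)).1 hpp.symm
      · exact h
      · exfalso
        obtain ⟨d, hd⟩ := Nat.exists_eq_add_of_lt h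
        refine ht1 (d + 1) (by omega) ?_
        rw [hd, add_assoc, pow_add] at hpp
        exact (mul_eq_left₀ (pow_ne_zero _ ht0)).1 hpp
    exact Prod.ext (Fin.ext hp1) (Fin.ext hp2)
  have hroot : ∀ p, P.eval (r p) = 0 := fun p => by
    have e := regSum_geomPoint_root h0 h1 ht ht1 hb (n := n) (Nat.lt_succ_iff.1 p.1.2) p.2.2
    rw [← hξ, hG] at e
    refine (mul_eq_zero.1 e).resolve_left ?_
    refine Finset.prod_ne_zero_iff.2 fun i _ => ?_
    rw [Ne, qPoch_eq_zero_iff h0 h1]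
    rintro ⟨m, hm⟩
    have e2 := congrArg norm hm
    have e3 : ‖b 1 * t ^ (p.1 : ℕ) / (q : ℂ) ^ ((p.2 : ℕ) + 1)‖ = _ := hrn p
    rw [norm_mul, norm_mul, norm_mul, e3, hx, norm_inv, norm_mul, norm_pow, norm_pow, ht, one_pow,
      norm_q h0, norm_one] at e2
    refine hgen (-(m + 1 : ℤ) + ((p.2 : ℕ) + 1 : ℤ)) ?_
    have hb0' := norm_ne_zero_iff.2 hb0
    rw [zpow_add₀ h0.ne', zpow_neg, zpow_add₀ h0.ne' (m : ℤ), zpow_natCast, zpow_one]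
    rw [zpow_neg] at e2
    have := zpow_ne_zero ((p.2 : ℕ) + 1 : ℤ) h0.ne'
    have := pow_ne_zero m h0.ne'
    field_simp at e2 ⊢
    linear_combination e2
  have hcard : P.natDegree ≤ Fintype.card (Fin (n + 1) × Fin N) := by simpa using hPdeg
  have hW := polynomial_eval_mul_prod hrinj hr0 hcard hroot
  -- normalization at `α₁ = b₀ t^n`, where only the term of index `0` survives
  obtain ⟨y₀, hy₀⟩ : ∃ y₀, y₀ = b 0 * t ^ n := ⟨_, rfl⟩
  have hy₀ξ : y₀ * ξ = 1 := by
    rw [hy₀, hξ]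
    exact mul_inv_cancel₀ (mul_ne_zero hb0 htn)
  have hrefl : ∀ c : ℂ → ℂ, ∏ i : Fin (n + 1), c (t ^ (i : ℕ)) =
      ∏ k ∈ Finset.range (n + 1), c (t ^ k) := fun c =>
    Fin.prod_univ_eq_prod_range (fun k => c (t ^ k)) (n + 1)
  have hQ0 : ∏ k ∈ Finset.range (n + 1), qPoch q (q * y₀ / (b 0 * t ^ k)) ≠ 0 := by
    rw [← hQ]
    refine Finset.prod_ne_zero_iff.2 fun i _ => qPoch_ne_zero_of_norm_lt h0 h1 ?_
    rw [show q * y₀ * geomPoint (n + 1) t ξ i = q * t ^ (i : ℕ) by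
      simp only [geomPoint]
      linear_combination q * t ^ (i : ℕ) * hy₀ξ]
    rw [norm_mul, norm_pow, ht, one_pow, mul_one, norm_q h0]
    exact h1
  have hT0 : regSum q t ![(q : ℂ) ^ N * b 0 * t ^ n, y₀] b (geomPoint (n + 1) t ξ) =
      (∏ k ∈ Finset.range (n + 1), qPoch q ((q : ℂ) ^ N * (q * t ^ k))) *
      (∏ k ∈ Finset.range (n + 1), qPoch q (q * y₀ / (b 0 * t ^ k))) *
      coneConst q n t (b 0) *
      ∏ k ∈ Finset.range (n + 1), qPoch q (q * y₀ / (b 1 * t ^ k)) := by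
    unfold regSum
    rw [tsum_eq_single 0]
    · unfold regTerm coneConst
      rw [← hξ]
      have e : ∀ i : Fin (n + 1), oneVar q ![(q : ℂ) ^ N * b 0 * t ^ n, y₀] b
          (geomPoint (n + 1) t ξ i) 0 =
          qPoch q ((q : ℂ) ^ N * (q * t ^ (i : ℕ))) * qPoch q (q * y₀ * geomPoint (n + 1) t ξ i) *
          qPoch q (q * t ^ (n - (i : ℕ))) * qPoch q (q * b 0 / b 1 * t ^ (n - (i : ℕ))) := by
        intro i
        unfold oneVar
        rw [Fin.prod_univ_two, thetaQuot_zero h0 h1, thetaQuot_zero h0 h1]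
        simp only [Matrix.cons_val_zero, Matrix.cons_val_one, Matrix.cons_val_fin_one, zpow_zero,
          mul_one, one_mul]
        have e1 : q * ((q : ℂ) ^ N * b 0 * t ^ n) * geomPoint (n + 1) t ξ i =
            (q : ℂ) ^ N * (q * t ^ (i : ℕ)) := by
          simp only [geomPoint]
          rw [hy₀] at hy₀ξ
          linear_combination (q : ℂ) ^ N * (q * t ^ (i : ℕ)) * hy₀ξ
        have e2 : (q : ℂ) / (b 0 * geomPoint (n + 1) t ξ i) = q * t ^ (n - (i : ℕ)) := by
          rw [hx]
          field_simp
        have e3 : (q : ℂ) / (b 1 * geomPoint (n + 1) t ξ i) =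
            q * b 0 / b 1 * t ^ (n - (i : ℕ)) := by
          rw [hx]
          field_simp
        rw [e1, e2, e3]
        ring
      simp only [Pi.zero_apply, e, Finset.prod_mul_distrib]
      rw [hQ, prod_fin_reflect n (fun k => qPoch q (q * t ^ k)),
        prod_fin_reflect n (fun k => qPoch q (q * b 0 / b 1 * t ^ k)),
        hrefl (fun w => qPoch q ((q : ℂ) ^ N * (q * w)))]
      have e4 : ∏ k ∈ Finset.range (n + 1), qPoch q (q * y₀ / (b 1 * t ^ k)) =
          ∏ k ∈ Finset.range (n + 1), qPoch q (q * b 0 / b 1 * t ^ k) := by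
        rw [← Finset.prod_range_reflect]
        refine Finset.prod_congr rfl fun k hk => ?_
        have hk' := Finset.mem_range.1 hk
        have e5 : t ^ n = t ^ k * t ^ (n + 1 - 1 - k) := by rw [← pow_add]; congr 1; omega
        have := pow_ne_zero (n + 1 - 1 - k) ht0
        rw [hy₀, e5]
        congr 1
        field_simp
      rw [e4]
      ring
    · intro ν hν
      by_contra h
      have hb1 := regTerm_geomPoint_box h0 h1 ht0 hξ0 0 1 hbξ (N := 0) (by simpa using hy₀ξ) h
      refine hν (funext fun i => ?_)
      have := hb1 i
      simp only [Pi.zero_apply]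
      omega
  have hR := prod_qPoch_split h0 h1 n N t (b 1)
  unfold ConeFormula
  rw [← hξ, hG]
  have e1 : ∏ k ∈ Finset.range (n + 1), qPoch q (q * (![(q : ℂ) ^ N * b 0 * t ^ n, α₁] 0 *
      ![(q : ℂ) ^ N * b 0 * t ^ n, α₁] 1) / (b 0 * b 1 * t ^ (n + k))) =
      ∏ k ∈ Finset.range (n + 1), qPoch q ((q : ℂ) ^ N * (q * α₁ / (b 1 * t ^ k))) := by
    refine Finset.prod_congr rfl fun k _ => ?_
    have := pow_ne_zero k ht0
    simp only [Matrix.cons_val_zero, Matrix.cons_val_one, Matrix.cons_val_fin_one]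
    congr 1
    rw [pow_add]
    field_simp
  have e2 : ∏ k ∈ Finset.range (n + 1), ∏ l, ∏ l',
      qPoch q (q * ![(q : ℂ) ^ N * b 0 * t ^ n, α₁] l / (b l' * t ^ k)) =
      (∏ k ∈ Finset.range (n + 1), qPoch q ((q : ℂ) ^ N * (q * t ^ k))) *
      (∏ k ∈ Finset.range (n + 1), qPoch q ((q : ℂ) ^ N * (q * y₀ / (b 1 * t ^ k)))) *
      (∏ k ∈ Finset.range (n + 1), qPoch q (q * α₁ / (b 0 * t ^ k))) *
      ∏ k ∈ Finset.range (n + 1), qPoch q (q * α₁ / (b 1 * t ^ k)) := by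
    simp only [Fin.prod_univ_two, Matrix.cons_val_zero, Matrix.cons_val_one,
      Matrix.cons_val_fin_one, Finset.prod_mul_distrib]
    have e3 : ∏ k ∈ Finset.range (n + 1),
        qPoch q (q * ((q : ℂ) ^ N * b 0 * t ^ n) / (b 0 * t ^ k)) =
        ∏ k ∈ Finset.range (n + 1), qPoch q ((q : ℂ) ^ N * (q * t ^ k)) := by
      rw [← Finset.prod_range_reflect]
      refine Finset.prod_congr rfl fun k hk => ?_
      have hk' := Finset.mem_range.1 hk
      have e5 : t ^ n = t ^ k * t ^ (n + 1 - 1 - k) := by rw [← pow_add]; congr 1; omega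
      have := pow_ne_zero (n + 1 - 1 - k) ht0
      rw [e5]
      congr 1
      field_simp
    have e4 : ∏ k ∈ Finset.range (n + 1),
        qPoch q (q * ((q : ℂ) ^ N * b 0 * t ^ n) / (b 1 * t ^ k)) =
        ∏ k ∈ Finset.range (n + 1), qPoch q ((q : ℂ) ^ N * (q * y₀ / (b 1 * t ^ k))) := by
      refine Finset.prod_congr rfl fun k _ => ?_
      rw [hy₀]
      congr 1
      ring
    rw [e3, e4]
    ring
  rw [e1, e2, hQ]
  rw [hG, hQ, hR y₀] at hT0
  rw [hR α₁]
  have hWy := hW α₁ y₀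
  have hW0 : ∏ p, (1 - y₀ / r p) ≠ 0 := by
    refine Finset.prod_ne_zero_iff.2 fun p _ h => ?_
    have e := congrArg norm ((div_eq_one_iff_eq (hr0 p)).1 (sub_eq_zero.1 h).symm)
    rw [hrn, hy₀, norm_mul, norm_pow, ht, one_pow, mul_one] at e
    refine hgen ((p.2 : ℕ) + 1 : ℤ) ?_
    rw [e, mul_assoc, ← zpow_add₀ h0.ne']
    simp
  simp only [hr] at hWy hW0
  generalize (∏ p : Fin (n + 1) × Fin N,
    (1 - y₀ / (b 1 * t ^ (p.1 : ℕ) / (q : ℂ) ^ ((p.2 : ℕ) + 1)))) = W0 at *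
  generalize (∏ p : Fin (n + 1) × Fin N,
    (1 - α₁ / (b 1 * t ^ (p.1 : ℕ) / (q : ℂ) ^ ((p.2 : ℕ) + 1)))) = W1 at *
  generalize ∏ k ∈ Finset.range (n + 1), qPoch q (q * y₀ / (b 0 * t ^ k)) = Q0 at *
  generalize ∏ k ∈ Finset.range (n + 1), qPoch q (q * α₁ / (b 0 * t ^ k)) = Q1 at *
  generalize ∏ k ∈ Finset.range (n + 1), qPoch q ((q : ℂ) ^ N * (q * y₀ / (b 1 * t ^ k))) = S0 at *
  generalize ∏ k ∈ Finset.range (n + 1), qPoch q ((q : ℂ) ^ N * (q * α₁ / (b 1 * t ^ k))) = S1 at *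
  generalize ∏ k ∈ Finset.range (n + 1), qPoch q ((q : ℂ) ^ N * (q * t ^ k)) = A at *
  generalize coneConst q n t (b 0) = c at *
  generalize P.eval α₁ = p1 at *
  generalize P.eval y₀ = p0 at *
  have e3 : p0 = A * c * (W0 * S0) := mul_left_cancel₀ hQ0 (by linear_combination hT0)
  have e4 : p1 = A * c * S0 * W1 := mul_right_cancel₀ hW0 (by rw [hWy, e3]; ring)
  rw [e4]
  ring

end evaluation

/-! ### Analytic continuation of the evaluation -/

section continuation

variable {q : ℝ} (h0 : 0 < q) (h1 : q < 1)

/-- The left-hand side of the evaluation for a terminating sum, as a finite sum. -/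
def boxLHS (q : ℝ) (n N : ℕ) (t α₁ : ℂ) (b : Fin 2 → ℂ) : ℂ :=
  (∑ ν ∈ Fintype.piFinset fun _ : Fin (n + 1) => Finset.Icc (-(N : ℤ)) 0,
    regTerm q t ![(q : ℂ) ^ N * b 0 * t ^ n, α₁] b (geomPoint (n + 1) t (b 0 * t ^ n)⁻¹) ν) *
  ∏ k ∈ Finset.range (n + 1),
    qPoch q (q * ((q : ℂ) ^ N * b 0 * t ^ n * α₁) / (b 0 * b 1 * t ^ (n + k)))

/-- The right-hand side of the evaluation for a terminating sum. -/
def boxRHS (q : ℝ) (n N : ℕ) (t α₁ : ℂ) (b : Fin 2 → ℂ) : ℂ :=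
  coneConst q n t (b 0) * ∏ k ∈ Finset.range (n + 1), ∏ l, ∏ l',
    qPoch q (q * ![(q : ℂ) ^ N * b 0 * t ^ n, α₁] l / (b l' * t ^ k))

include h0 h1

lemma coneFormula_iff_box {n N : ℕ} {t α₁ : ℂ} {b : Fin 2 → ℂ} (ht : t ≠ 0) (hb : ∀ l, b l ≠ 0) :
    ConeFormula q n t ![(q : ℂ) ^ N * b 0 * t ^ n, α₁] b ↔
      boxLHS q n N t α₁ b = boxRHS q n N t α₁ b := by
  have hb0 := hb 0
  have htn := pow_ne_zero n ht
  unfold ConeFormula boxLHS boxRHS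
  rw [regSum_geomPoint_eq_sum h0 h1 ht (inv_ne_zero (mul_ne_zero hb0 htn)) 0 0 (by field_simp)
    (N := N) (by simp only [Matrix.cons_val_zero]; field_simp)]
  simp only [Matrix.cons_val_zero, Matrix.cons_val_one, Matrix.cons_val_fin_one]

section smooth

variable {E : Type*} [NormedAddCommGroup E] [NormedSpace ℂ E] {e : E} {t : E → ℂ}
  {b : E → Fin 2 → ℂ} (ht : DifferentiableAt ℂ t e) (ht0 : t e ≠ 0)
  (hb : ∀ l, DifferentiableAt ℂ (fun e => b e l) e) (hb0 : ∀ l, b e l ≠ 0)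

include ht ht0 hb hb0

omit h0 h1 in
lemma geomPoint_comp_differentiableAt (n : ℕ) (i : Fin (n + 1)) :
    DifferentiableAt ℂ (fun e => geomPoint (n + 1) (t e) (b e 0 * t e ^ n)⁻¹ i) e := by
  unfold geomPoint
  exact (((hb 0).mul (ht.pow n)).inv (mul_ne_zero (hb0 0) (pow_ne_zero _ ht0))).mul (ht.pow _)

omit h0 h1 in
lemma numerator_comp_differentiableAt (n N : ℕ) (α₁ : ℂ) (l : Fin 2) :
    DifferentiableAt ℂ (fun e => ![(q : ℂ) ^ N * b e 0 * t e ^ n, α₁] l) e := by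
  fin_cases l
  · exact ((hb 0).const_mul _).mul (ht.pow n)
  · exact differentiableAt_const _

lemma boxLHS_comp_differentiableAt (n N : ℕ) (α₁ : ℂ) :
    DifferentiableAt ℂ (fun e => boxLHS q n N (t e) α₁ (b e)) e := by
  unfold boxLHS
  refine DifferentiableAt.mul (DifferentiableAt.fun_sum fun ν _ => ?_)
    (differentiableAt_prod _ fun k _ => qPoch_comp_differentiableAt h0 h1 ?_)
  · exact regTerm_comp_differentiableAt h0 h1 ht ht0
      (numerator_comp_differentiableAt ht ht0 hb hb0 n N α₁) hb hb0
      (geomPoint_comp_differentiableAt ht ht0 hb hb0 n)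
      (fun i => geomPoint_ne_zero ht0 (inv_ne_zero (mul_ne_zero (hb0 0) (pow_ne_zero _ ht0))) i) ν
  · exact differentiableAt_div (((((hb 0).const_mul _).mul (ht.pow n)).mul_const _).const_mul _)
      (((hb 0).mul (hb 1)).mul (ht.pow _))
      (mul_ne_zero (mul_ne_zero (hb0 0) (hb0 1)) (pow_ne_zero _ ht0))

lemma boxRHS_comp_differentiableAt (n N : ℕ) (α₁ : ℂ) :
    DifferentiableAt ℂ (fun e => boxRHS q n N (t e) α₁ (b e)) e := by
  unfold boxRHS coneConst
  have hξ : (b e 0 * t e ^ n)⁻¹ ≠ 0 := inv_ne_zero (mul_ne_zero (hb0 0) (pow_ne_zero _ ht0))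
  refine DifferentiableAt.mul (DifferentiableAt.mul ?_ ?_) ?_
  · exact differentiableAt_prod _ fun k _ => qPoch_comp_differentiableAt h0 h1
      ((ht.pow k).const_mul _)
  · exact differentiableAt_prod _ fun i _ => differentiableAt_prod _ fun j _ =>
      pairFn_comp_differentiableAt h0 h1 ht ht0
        (geomPoint_comp_differentiableAt ht ht0 hb hb0 n i) (geomPoint_ne_zero ht0 hξ i)
        (geomPoint_comp_differentiableAt ht ht0 hb hb0 n j) (geomPoint_ne_zero ht0 hξ j) _ _
  · exact differentiableAt_prod _ fun k _ => differentiableAt_prod _ fun l _ =>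
      differentiableAt_prod _ fun l' _ => qPoch_comp_differentiableAt h0 h1
        (differentiableAt_div
          ((numerator_comp_differentiableAt ht ht0 hb hb0 n N α₁ l).const_mul _)
          ((hb l').mul (ht.pow k)) (mul_ne_zero (hb0 l') (pow_ne_zero _ ht0)))

end smooth

/-- The evaluation on the unit circle, without restriction on `b`. -/
lemma coneFormula_norm_eq_one {n N : ℕ} {t : ℂ} (ht : ‖t‖ = 1)
    (ht1 : ∀ k : ℕ, k ≠ 0 → t ^ k ≠ 1) {b : Fin 2 → ℂ} (hb : ∀ l, b l ≠ 0) (α₁ : ℂ) :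
    boxLHS q n N t α₁ b = boxRHS q n N t α₁ b := by
  have ht0 : t ≠ 0 := by
    rintro rfl
    simp at ht
  have hb0 := norm_ne_zero_iff.2 (hb 0)
  have hb1 := norm_ne_zero_iff.2 (hb 1)
  have hcl := exists_real_shift (q := q) h0 {((‖b 1‖ / ‖b 0‖ : ℝ) : ℂ)} (by simp)
  set D := {s : ℝ | ∀ w ∈ ({((‖b 1‖ / ‖b 0‖ : ℝ) : ℂ)} : Set ℂ), w ≠ 0 → ∀ d : ℤ, d ≠ 0 →
      ∀ k : ℤ, w * Complex.exp ((s * d : ℝ) : ℂ) ≠ (q : ℂ) ^ k} with hD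
  have hnb : (𝓝[D] (0 : ℝ)).NeBot := mem_closure_iff_nhdsWithin_neBot.1 hcl
  let c : ℝ → Fin 2 → ℂ := fun s => ![b 0, b 1 * Complex.exp (s : ℂ)]
  have hc0 : c 0 = b := by
    ext i
    fin_cases i <;> simp [c]
  have hbd : ∀ l, DifferentiableAt ℂ (fun e : Fin 2 → ℂ => e l) b := fun l => by fun_prop
  have hcc : ContinuousAt c 0 := by
    refine continuousAt_pi.2 fun i => ?_
    fin_cases i
    · exact continuousAt_const
    · exact Continuous.continuousAt (by simp [c]; fun_prop)
  have key : ∀ s ∈ D, boxLHS q n N t α₁ (c s) = boxRHS q n N t α₁ (c s) := by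
    intro s hs
    have hcs : ∀ l, c s l ≠ 0 := fun l => by
      fin_cases l
      · simpa [c] using hb 0
      · simpa [c] using hb 1
    refine (coneFormula_iff_box h0 h1 ht0 hcs).1
      (coneFormula_circle h0 h1 ht ht1 hcs (fun k hk => ?_) α₁)
    refine hs _ rfl (by rw [Complex.ofReal_ne_zero]; exact div_ne_zero hb1 hb0) 1 one_ne_zero k ?_
    simp only [c, Matrix.cons_val_zero, Matrix.cons_val_one, Matrix.cons_val_fin_one, norm_mul,
      Complex.norm_exp, Complex.ofReal_re] at hk
    rw [← Complex.ofReal_exp, ← Complex.ofReal_zpow, ← Complex.ofReal_mul, Complex.ofReal_inj]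
    simp only [Int.cast_one, mul_one]
    rw [div_mul_eq_mul_div, hk]
    field_simp
  have t1 : Tendsto (fun s => boxLHS q n N t α₁ (c s)) (𝓝[D] 0) (𝓝 (boxLHS q n N t α₁ b)) := by
    have := (boxLHS_comp_differentiableAt h0 h1 (t := fun _ => t) (b := fun b => b)
      (differentiableAt_const _) ht0 hbd hb n N α₁).continuousAt.comp_of_eq hcc hc0
    rw [ContinuousAt, Function.comp_apply, hc0] at this
    exact this.mono_left nhdsWithin_le_nhds
  have t2 : Tendsto (fun s => boxRHS q n N t α₁ (c s)) (𝓝[D] 0) (𝓝 (boxRHS q n N t α₁ b)) := by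
    have := (boxRHS_comp_differentiableAt h0 h1 (t := fun _ => t) (b := fun b => b)
      (differentiableAt_const _) ht0 hbd hb n N α₁).continuousAt.comp_of_eq hcc hc0
    rw [ContinuousAt, Function.comp_apply, hc0] at this
    exact this.mono_left nhdsWithin_le_nhds
  refine tendsto_nhds_unique t1 (t2.congr' ?_)
  filter_upwards [self_mem_nhdsWithin] with s hs using (key s hs).symm

omit h0 h1 in
lemma frequently_circle :
    ∃ᶠ t : ℂ in 𝓝[≠] 1, ‖t‖ = 1 ∧ ∀ k : ℕ, k ≠ 0 → t ^ k ≠ 1 := by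
  have hc : (range fun p : ℤ × ℕ => (2 * Real.pi * p.1 / p.2 : ℝ)).Countable := countable_range _
  have hcl := (hc.dense_compl ℝ) 0
  have hnb := mem_closure_iff_nhdsWithin_neBot.1 hcl
  set D := (range fun p : ℤ × ℕ => (2 * Real.pi * p.1 / p.2 : ℝ))ᶜ with hD
  have hgood : ∀ s ∈ D, ∀ k : ℕ, k ≠ 0 → Complex.exp (s * Complex.I) ^ k ≠ 1 := by
    intro s hs k hk h
    rw [← Complex.exp_nat_mul, Complex.exp_eq_one_iff] at h
    obtain ⟨m, hm⟩ := h
    refine hs ⟨(m, k), ?_⟩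
    have hk' : (k : ℝ) ≠ 0 := by exact_mod_cast hk
    have e : ((k * s : ℝ) : ℂ) * Complex.I = ((m * (2 * Real.pi) : ℝ) : ℂ) * Complex.I := by
      push_cast
      linear_combination hm
    have e2 := mul_right_cancel₀ Complex.I_ne_zero e
    have e3 : (k : ℝ) * s = m * (2 * Real.pi) := by exact_mod_cast e2
    simp only
    rw [div_eq_iff hk']
    linarith
  have ht : Tendsto (fun s : ℝ => Complex.exp (s * Complex.I)) (𝓝[D] 0) (𝓝[≠] 1) := by
    refine tendsto_nhdsWithin_iff.2 ⟨?_, ?_⟩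
    · have : Continuous fun s : ℝ => Complex.exp (s * Complex.I) := by fun_prop
      have := this.tendsto 0
      simp only [Complex.ofReal_zero, zero_mul, Complex.exp_zero] at this
      exact this.mono_left nhdsWithin_le_nhds
    · filter_upwards [self_mem_nhdsWithin] with s hs
      have := hgood s hs 1 one_ne_zero
      simpa using this
  refine ht.frequently (Eventually.frequently ?_)
  filter_upwards [self_mem_nhdsWithin] with s hs
  exact ⟨Complex.norm_exp_ofReal_mul_I s, hgood s hs⟩

/-- The evaluation for a terminating sum. -/
lemma boxLHS_eq_boxRHS {n N : ℕ} {t : ℂ} (ht : t ≠ 0) {b : Fin 2 → ℂ} (hb : ∀ l, b l ≠ 0)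
    (α₁ : ℂ) : boxLHS q n N t α₁ b = boxRHS q n N t α₁ b := by
  have ho : IsOpen ({0}ᶜ : Set ℂ) := isOpen_compl_singleton
  have hpre : IsPreconnected ({0}ᶜ : Set ℂ) :=
    (isConnected_compl_singleton_of_one_lt_rank (by simp [Complex.rank_real_complex])
      0).isPreconnected
  have hf : AnalyticOnNhd ℂ (fun t => boxLHS q n N t α₁ b) {0}ᶜ :=
    DifferentiableOn.analyticOnNhd (fun t ht => (boxLHS_comp_differentiableAt h0 h1
      (t := fun t => t) (b := fun _ => b) differentiableAt_id ht
      (fun _ => differentiableAt_const _) hb n N α₁).differentiableWithinAt) ho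
  have hg : AnalyticOnNhd ℂ (fun t => boxRHS q n N t α₁ b) {0}ᶜ :=
    DifferentiableOn.analyticOnNhd (fun t ht => (boxRHS_comp_differentiableAt h0 h1
      (t := fun t => t) (b := fun _ => b) differentiableAt_id ht
      (fun _ => differentiableAt_const _) hb n N α₁).differentiableWithinAt) ho
  exact hf.eqOn_of_preconnected_of_frequently_eq hg hpre (z₀ := 1) (by simp)
    (frequently_circle.mono fun t ht => coneFormula_norm_eq_one h0 h1 ht.1 ht.2 hb α₁) ht

/-- The evaluation of the regularized sum at the truncated progression. -/
theorem coneFormula {n : ℕ} {t : ℂ} (ht : t ≠ 0) {α b : Fin 2 → ℂ} (hb : ∀ l, b l ≠ 0)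
    (hc : ConvCond q t α b (n + 1)) : ConeFormula q n t α b := by
  obtain ⟨ρ, hρ, hρ2⟩ := exists_radii hb hc
  have hb0 : 0 < ‖b 0‖ * ‖b 1‖ := mul_pos (norm_pos_iff.2 (hb 0)) (norm_pos_iff.2 (hb 1))
  have hq := q_ne h0
  have htn := pow_ne_zero n ht
  have hρ0 : 0 < ρ 0 := (norm_nonneg _).trans_lt (hρ 0)
  have hconv : ∀ z ∈ Metric.ball (0 : ℂ) (ρ 0), ConvCond q t ![z, α 1] b (n + 1) := by
    intro z hz k hk
    refine ⟨(hc k hk).1, ?_⟩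
    have h := hρ2 k hk
    rw [div_lt_iff₀ hb0, mul_comm (‖t‖ ^ _)] at h
    refine lt_of_le_of_lt ?_ h
    have hz' : ‖z‖ < ρ 0 := by simpa using hz
    simp only [Matrix.cons_val_zero, Matrix.cons_val_one, Matrix.cons_val_fin_one]
    gcongr
    exact (hρ 1).le
  set ξ := (b 0 * t ^ n)⁻¹ with hξ
  have hξ0 : ξ ≠ 0 := inv_ne_zero (mul_ne_zero (hb 0) htn)
  have hf : AnalyticOnNhd ℂ (fun z => regSum q t ![z, α 1] b (geomPoint (n + 1) t ξ) *
      ∏ k ∈ Finset.range (n + 1), qPoch q (q * (z * α 1) / (b 0 * b 1 * t ^ (n + k))))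
      (Metric.ball 0 (ρ 0)) := by
    refine DifferentiableOn.analyticOnNhd (fun z hz => ?_) Metric.isOpen_ball
    refine DifferentiableAt.differentiableWithinAt (DifferentiableAt.mul
      (regSum_alpha_differentiableAt h0 h1 ht hb (hconv z hz)
        (geomPoint_ne_zero ht hξ0)) (differentiableAt_prod _ fun k _ => ?_))
    exact qPoch_comp_differentiableAt h0 h1 (by fun_prop)
  have hg : AnalyticOnNhd ℂ (fun z => coneConst q n t (b 0) * ∏ k ∈ Finset.range (n + 1), ∏ l, ∏ l',
      qPoch q (q * ![z, α 1] l / (b l' * t ^ k))) (Metric.ball 0 (ρ 0)) := by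
    refine DifferentiableOn.analyticOnNhd (fun z hz => ?_) Metric.isOpen_ball
    refine DifferentiableAt.differentiableWithinAt (DifferentiableAt.const_mul
      (differentiableAt_prod _ fun k _ => differentiableAt_prod _ fun l _ =>
      differentiableAt_prod _ fun l' _ => qPoch_comp_differentiableAt h0 h1 ?_) _)
    fin_cases l
    · simp only [Fin.zero_eta, Matrix.cons_val_zero]
      fun_prop
    · simp only [Fin.mk_one, Matrix.cons_val_one, Matrix.cons_val_fin_one]
      fun_prop
  have hlim : Tendsto (fun N : ℕ => (q : ℂ) ^ N * b 0 * t ^ n) atTop (𝓝[≠] 0) := by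
    refine tendsto_nhdsWithin_iff.2 ⟨?_, Eventually.of_forall fun N =>
      mul_ne_zero (mul_ne_zero (pow_ne_zero _ hq) (hb 0)) htn⟩
    have := tendsto_pow_atTop_nhds_zero_of_norm_lt_one (x := (q : ℂ)) (by rwa [norm_q h0])
    simpa using (this.mul_const (b 0)).mul_const (t ^ n)
  have key := hf.eqOn_of_preconnected_of_frequently_eq hg
    (convex_ball (0 : ℂ) (ρ 0)).isPreconnected (Metric.mem_ball_self hρ0)
    (hlim.frequently (Frequently.of_forall fun N => ?_))
    (show α 0 ∈ Metric.ball (0 : ℂ) (ρ 0) by simpa using hρ 0)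
  · have e : ![α 0, α 1] = α := by
      ext i
      fin_cases i <;> rfl
    beta_reduce at key
    rw [e] at key
    unfold ConeFormula
    rw [← hξ]
    exact key
  · have := (coneFormula_iff_box h0 h1 ht hb).2 (boxLHS_eq_boxRHS h0 h1 (n := n) (N := N) ht hb (α 1))
    unfold ConeFormula at this
    rw [← hξ] at this
    simp only [Matrix.cons_val_zero, Matrix.cons_val_one, Matrix.cons_val_fin_one] at this
    exact this

omit h0 h1 in
lemma prod_Ioi_sub (n : ℕ) (i : Fin (n + 1)) (f : ℕ → ℂ) :
    ∏ j ∈ Finset.Ioi i, f ((j : ℕ) - i - 1) = ∏ d ∈ Finset.range (n - i), f d := by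
  have e := Finset.prod_map (Finset.Ioi i) Fin.valEmbedding (fun j : ℕ => f (j - i - 1))
  rw [Fin.map_valEmbedding_Ioi] at e
  simp only [Fin.valEmbedding_apply] at e
  rw [← e]
  have e2 : Finset.Ioo (i : ℕ) (n + 1) = Finset.Ico ((i : ℕ) + 1) (n + 1) := by
    ext; simp
  rw [e2, Finset.prod_Ico_eq_prod_range]
  refine Finset.prod_congr ?_ fun d _ => ?_
  · rw [show n + 1 - ((i : ℕ) + 1) = n - i by omega]
  · rw [show (i : ℕ) + 1 + d - i - 1 = d by omega]

/-- The ratio of the constant of the evaluation and the elliptic Vandermonde product: the factors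
belonging to a row telescope. -/
lemma coneConst_mul_prod {n : ℕ} {t b₀ : ℂ} (ht : t ≠ 0) (hb : b₀ ≠ 0)
    (hθ : ∀ k ∈ Finset.range (n + 1), theta q (t ^ (k + 1)) ≠ 0) :
    coneConst q n t b₀ * ∏ _k ∈ Finset.range (n + 1), qPoch q (q * t⁻¹) =
      thetaVandermonde q (geomPoint (n + 1) t (b₀ * t ^ n)⁻¹) *
        ∏ k ∈ Finset.range (n + 1), (qPoch q q * qPoch q (q * (t ^ (k + 1))⁻¹)) := by
  have hξ : (b₀ * t ^ n)⁻¹ ≠ 0 := inv_ne_zero (mul_ne_zero hb (pow_ne_zero _ ht))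
  have hA : ∀ k, k ≤ n → qPoch q (q * t ^ (k + 1)) ≠ 0 ∧ qPoch q (q * (t ^ (k + 1))⁻¹) ≠ 0 := by
    intro k hk
    have h := hθ k (Finset.mem_range.2 (by omega))
    unfold theta at h
    rw [qPoch_step h0 h1] at h
    refine ⟨right_ne_zero_of_mul (left_ne_zero_of_mul h), ?_⟩
    rw [← div_eq_mul_inv]
    exact right_ne_zero_of_mul h
  have hA0 : ∀ k, k ≤ n + 1 → qPoch q (q * t ^ k) ≠ 0 := by
    intro k hk
    cases k with
    | zero => simpa using qPoch_q_ne_zero h0 h1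
    | succ k => exact (hA k (by omega)).1
  have hpair : ∀ i j : Fin (n + 1), i < j →
      pairFn q t (geomPoint (n + 1) t (b₀ * t ^ n)⁻¹ i) (geomPoint (n + 1) t (b₀ * t ^ n)⁻¹ j) 0 0 =
      (geomPoint (n + 1) t (b₀ * t ^ n)⁻¹ i * theta q (geomPoint (n + 1) t (b₀ * t ^ n)⁻¹ j /
        geomPoint (n + 1) t (b₀ * t ^ n)⁻¹ i)) *
      (qPoch q (q * t ^ ((j : ℕ) - i - 1)) / qPoch q (q * t ^ ((j : ℕ) - i - 1 + 1)) *
        (qPoch q (q * (t ^ ((j : ℕ) - i - 1 + 1 + 1))⁻¹) /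
          qPoch q (q * (t ^ ((j : ℕ) - i - 1 + 1))⁻¹))) := by
    intro i j hij
    have hij' : (i : ℕ) < j := hij
    obtain ⟨d, hd⟩ : ∃ d, (j : ℕ) - i - 1 = d := ⟨_, rfl⟩
    have hdn : d ≤ n := by omega
    have e : geomPoint (n + 1) t (b₀ * t ^ n)⁻¹ j / geomPoint (n + 1) t (b₀ * t ^ n)⁻¹ i =
        t ^ (d + 1) := by
      rw [div_eq_iff (geomPoint_ne_zero ht hξ i)]
      simp only [geomPoint]
      rw [mul_left_comm, ← pow_add]
      congr 2
      omega
    unfold pairFn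
    rw [e, hd, sub_self, thetaQuot_zero h0 h1]
    unfold theta
    rw [qPoch_step h0 h1 (t ^ (d + 1))]
    have a1 := (hA d hdn).1
    have a2 := (hA d hdn).2
    rw [← div_eq_mul_inv] at a2
    simp only [mul_zero, zpow_zero, mul_one]
    generalize geomPoint (n + 1) t (b₀ * t ^ n)⁻¹ i = X
    rw [show q * t⁻¹ * t ^ (d + 1) = q * t ^ d by rw [pow_succ]; field_simp,
      show (q : ℂ) / (t * t ^ (d + 1)) = q * (t ^ (d + 1 + 1))⁻¹ by
        rw [pow_succ t (d + 1), mul_comm t, div_eq_mul_inv],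
      show (q : ℂ) * (t ^ (d + 1))⁻¹ = q / t ^ (d + 1) by rw [div_eq_mul_inv]]
    generalize qPoch q (q * t ^ (d + 1)) = A at *
    generalize qPoch q (q / t ^ (d + 1)) = B at *
    field_simp
  have hrow : ∀ i : Fin (n + 1), ∏ j ∈ Finset.Ioi i,
      (qPoch q (q * t ^ ((j : ℕ) - i - 1)) / qPoch q (q * t ^ ((j : ℕ) - i - 1 + 1)) *
        (qPoch q (q * (t ^ ((j : ℕ) - i - 1 + 1 + 1))⁻¹) /
          qPoch q (q * (t ^ ((j : ℕ) - i - 1 + 1))⁻¹))) =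
      qPoch q q / qPoch q (q * t ^ (n - (i : ℕ))) *
        (qPoch q (q * (t ^ (n - (i : ℕ) + 1))⁻¹) / qPoch q (q * t⁻¹)) := by
    intro i
    rw [prod_Ioi_sub n i (fun d => qPoch q (q * t ^ d) / qPoch q (q * t ^ (d + 1)) *
        (qPoch q (q * (t ^ (d + 1 + 1))⁻¹) / qPoch q (q * (t ^ (d + 1))⁻¹)))]
    have hi : n - (i : ℕ) ≤ n := by omega
    generalize n - (i : ℕ) = m at *
    induction m with
    | zero =>
      have a1 := qPoch_q_ne_zero h0 h1
      have a2 := (hA 0 (by omega)).2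
      simp only [zero_add, pow_one] at a2
      simp [a1, a2]
    | succ m ih =>
      rw [Finset.prod_range_succ, ih (by omega)]
      have a1 := hA0 m (by omega)
      have a2 := hA0 (m + 1) (by omega)
      have a3 := (hA m (by omega)).2
      have a4 := (hA 0 (by omega)).2
      simp only [zero_add, pow_one] at a4
      generalize qPoch q (q * (t ^ (m + 1))⁻¹) = A at *
      generalize qPoch q (q * t⁻¹) = B at *
      field_simp
  have hprod : ∏ i, ∏ j ∈ Finset.Ioi i, pairFn q t (geomPoint (n + 1) t (b₀ * t ^ n)⁻¹ i)
      (geomPoint (n + 1) t (b₀ * t ^ n)⁻¹ j) 0 0 =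
      thetaVandermonde q (geomPoint (n + 1) t (b₀ * t ^ n)⁻¹) *
      ∏ k ∈ Finset.range (n + 1), (qPoch q q / qPoch q (q * t ^ k) *
        (qPoch q (q * (t ^ (k + 1))⁻¹) / qPoch q (q * t⁻¹))) := by
    rw [← prod_fin_reflect]
    unfold thetaVandermonde
    rw [← Finset.prod_mul_distrib]
    refine Finset.prod_congr rfl fun i _ => ?_
    rw [← hrow i, ← Finset.prod_mul_distrib]
    exact Finset.prod_congr rfl fun j hj => hpair i j (Finset.mem_Ioi.1 hj)
  unfold coneConst
  rw [hprod, mul_left_comm, mul_assoc, ← Finset.prod_mul_distrib, ← Finset.prod_mul_distrib]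
  congr 1
  refine Finset.prod_congr rfl fun k hk => ?_
  have a1 := hA0 k (by have := Finset.mem_range.1 hk; omega)
  have a4 := (hA 0 (by omega)).2
  simp only [zero_add, pow_one] at a4
  generalize qPoch q (q * t⁻¹) = B at *
  field_simp

end continuation

/-! ### The terms of the Jackson integral -/

section reduced

variable {q : ℝ} (h0 : 0 < q) (h1 : q < 1)

/-- The factor of a term of the Jackson integral that belongs to one coordinate. -/
def redOne (q : ℝ) (α b : Fin 2 → ℂ) (x : ℂ) (ν : ℤ) : ℂ :=
  (q : ℂ) ^ ν * ∏ l, (qPoch q (q * α l * (x * (q : ℂ) ^ ν)) / qPoch q (b l * (x * (q : ℂ) ^ ν)))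

/-- The factor of a term of the Jackson integral that belongs to a pair of coordinates. -/
def redPair (q : ℝ) (t x y : ℂ) (k l : ℤ) : ℂ :=
  t ^ (2 * k) * (1 - y / x * (q : ℂ) ^ (l - k)) *
    (qPoch q (q * t⁻¹ * (y / x * (q : ℂ) ^ (l - k))) / qPoch q (t * (y / x * (q : ℂ) ^ (l - k))))

/-- A term of the Jackson integral, up to a factor that does not depend on `ν`. It depends on
`t`, but not on the determination of the logarithm. -/
def redTerm (q : ℝ) (t : ℂ) (α b : Fin 2 → ℂ) {n : ℕ} (x : Fin n → ℂ) (ν : Fin n → ℤ) : ℂ :=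
  (∏ i, redOne q α b (x i) (ν i)) *
    ∏ i, ∏ j ∈ Finset.Ioi i, redPair q t (x i) (x j) (ν i) (ν j)

/-- The factor of the terms of the Jackson integral that contains the complex powers. -/
def powFactor (τ : ℂ) (lg : ℂ → ℂ) {n : ℕ} (x : Fin n → ℂ) : ℂ :=
  (∏ i, x i) * ∏ i, ∏ _j ∈ Finset.Ioi i, powL lg (x i) (2 * τ)

include h0

lemma IsQLog.apply_mul_zpow {lg : ℂ → ℂ} (hlg : IsQLog q lg) {x : ℂ} (hx : x ≠ 0) (k : ℤ) :
    lg (x * (q : ℂ) ^ k) = lg x + k * (Real.log q : ℂ) := by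
  have hq := q_ne h0
  induction k using Int.induction_on with
  | zero => simp
  | succ k ih =>
    rw [zpow_add_one₀ hq, ← mul_assoc, mul_comm _ (q : ℂ),
      (hlg _ (mul_ne_zero hx (zpow_ne_zero _ hq))).2, ih]
    push_cast
    ring
  | pred k ih =>
    have e := (hlg (x * (q : ℂ) ^ (-(k : ℤ) - 1)) (mul_ne_zero hx (zpow_ne_zero _ hq))).2
    rw [← mul_assoc, mul_comm (q : ℂ) x, mul_assoc, ← zpow_one_add₀ hq,
      show 1 + (-(k : ℤ) - 1) = -k by ring, ih] at e
    push_cast at e ⊢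
    linear_combination -e

lemma q_cpow_eq_exp (τ : ℂ) : (q : ℂ) ^ τ = Complex.exp ((Real.log q : ℂ) * τ) := by
  rw [Complex.cpow_def_of_ne_zero (q_ne h0), Complex.ofReal_log h0.le]

lemma q_cpow_ne_zero (τ : ℂ) : (q : ℂ) ^ τ ≠ 0 := by
  rw [q_cpow_eq_exp h0]
  exact Complex.exp_ne_zero _

lemma powL_mul_zpow {lg : ℂ → ℂ} (hlg : IsQLog q lg) (τ : ℂ) {x : ℂ} (hx : x ≠ 0) (k : ℤ) :
    powL lg (x * (q : ℂ) ^ k) (2 * τ) = powL lg x (2 * τ) * ((q : ℂ) ^ τ) ^ (2 * k) := by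
  unfold powL
  rw [hlg.apply_mul_zpow h0 hx, q_cpow_eq_exp h0, ← Complex.exp_int_mul, ← Complex.exp_add]
  congr 1
  push_cast
  ring

omit h0 in
lemma powL_sub_one {lg : ℂ → ℂ} (hlg : IsQLog q lg) (s : ℂ) {x : ℂ} (hx : x ≠ 0) :
    powL lg x (s - 1) * x = powL lg x s := by
  have e := (hlg x hx).1
  unfold powL
  nth_rw 2 [← e]
  rw [← Complex.exp_add]
  congr 1
  ring

lemma term_eq {n : ℕ} {lg : ℂ → ℂ} (hlg : IsQLog q lg) (τ : ℂ) (a b : Fin 2 → ℂ)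
    {x : Fin n → ℂ} (hx : ∀ i, x i ≠ 0) (ν : Fin n → ℤ) :
    term q τ a b lg x ν =
      powFactor τ lg x * redTerm q ((q : ℂ) ^ τ) (fun l => (a l)⁻¹) b x ν := by
  have hq := q_ne h0
  unfold term Phi Delta powFactor redTerm
  have e1 : ∀ i, x i * (q : ℂ) ^ ν i * ∏ l : Fin 2, qPoch q (q * (a l)⁻¹ * (x i * (q : ℂ) ^ ν i)) /
      qPoch q (b l * (x i * (q : ℂ) ^ ν i)) = x i * redOne q (fun l => (a l)⁻¹) b (x i) (ν i) := by
    intro i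
    unfold redOne
    ring
  have e2 : ∀ i j, powL lg (x i * (q : ℂ) ^ ν i) (2 * τ - 1) *
      (qPoch q (q * ((q : ℂ) ^ τ)⁻¹ * (x j * (q : ℂ) ^ ν j / (x i * (q : ℂ) ^ ν i))) /
        qPoch q ((q : ℂ) ^ τ * (x j * (q : ℂ) ^ ν j / (x i * (q : ℂ) ^ ν i)))) *
      (x i * (q : ℂ) ^ ν i - x j * (q : ℂ) ^ ν j) =
      powL lg (x i) (2 * τ) * redPair q ((q : ℂ) ^ τ) (x i) (x j) (ν i) (ν j) := by
    intro i j
    have hz : x i * (q : ℂ) ^ ν i ≠ 0 := mul_ne_zero (hx i) (zpow_ne_zero _ hq)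
    have hW : x j * (q : ℂ) ^ ν j / (x i * (q : ℂ) ^ ν i) = x j / x i * (q : ℂ) ^ (ν j - ν i) := by
      rw [zpow_sub₀ hq]
      ring
    have hd : x i * (q : ℂ) ^ ν i - x j * (q : ℂ) ^ ν j =
        x i * (q : ℂ) ^ ν i * (1 - x j / x i * (q : ℂ) ^ (ν j - ν i)) := by
      rw [← hW, mul_sub, mul_one, mul_div_cancel₀ _ hz]
    rw [hd, hW]
    unfold redPair
    have := powL_sub_one hlg (2 * τ) hz
    rw [powL_mul_zpow h0 hlg τ (hx i)] at this
    linear_combination (qPoch q (q * ((q : ℂ) ^ τ)⁻¹ * (x j / x i * (q : ℂ) ^ (ν j - ν i))) /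
      qPoch q ((q : ℂ) ^ τ * (x j / x i * (q : ℂ) ^ (ν j - ν i)))) *
      (1 - x j / x i * (q : ℂ) ^ (ν j - ν i)) * this
  have e3 : (∏ i, ∏ j ∈ Finset.Ioi i, powL lg (x i * (q : ℂ) ^ ν i) (2 * τ - 1) *
      (qPoch q (q * ((q : ℂ) ^ τ)⁻¹ * (x j * (q : ℂ) ^ ν j / (x i * (q : ℂ) ^ ν i))) /
        qPoch q ((q : ℂ) ^ τ * (x j * (q : ℂ) ^ ν j / (x i * (q : ℂ) ^ ν i))))) *
      (∏ i, ∏ j ∈ Finset.Ioi i, (x i * (q : ℂ) ^ ν i - x j * (q : ℂ) ^ ν j)) =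
      (∏ i, ∏ _j ∈ Finset.Ioi i, powL lg (x i) (2 * τ)) *
        ∏ i, ∏ j ∈ Finset.Ioi i, redPair q ((q : ℂ) ^ τ) (x i) (x j) (ν i) (ν j) := by
    rw [← Finset.prod_mul_distrib, ← Finset.prod_mul_distrib]
    refine Finset.prod_congr rfl fun i _ => ?_
    rw [← Finset.prod_mul_distrib, ← Finset.prod_mul_distrib]
    exact Finset.prod_congr rfl fun j _ => e2 i j
  rw [Finset.prod_congr rfl fun i _ => e1 i, Finset.prod_mul_distrib, mul_assoc, e3]
  ring

include h1

lemma redOne_eq {α b : Fin 2 → ℂ} {x : ℂ} (hb : ∀ l, b l ≠ 0) (hx : x ≠ 0)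
    (hθ : ∀ l, theta q (b l * x) ≠ 0) (ν : ℤ) :
    redOne q α b x ν = oneVar q α b x ν / (theta q (b 0 * x) * theta q (b 1 * x)) := by
  have hP : ∀ l, qPoch q (b l * x * (q : ℂ) ^ ν) ≠ 0 := fun l =>
    qPoch_ne_zero_of_theta h0 h1 (mul_ne_zero (hb l) hx) (hθ l) ν
  have e : ∀ l, thetaQuot q (b l * x) ν = theta q (b l * x) / qPoch q (b l * x * (q : ℂ) ^ ν) :=
    fun l => thetaQuot_eq_div h0 h1 (mul_ne_zero (hb l) hx) (hP l)
  have p0 := hP 0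
  have p1 := hP 1
  have t0 := hθ 0
  have t1 := hθ 1
  unfold redOne oneVar
  simp only [e, Fin.prod_univ_two, ← mul_assoc]
  generalize theta q (b 0 * x) = A at *
  generalize theta q (b 1 * x) = B at *
  field_simp

lemma redPair_eq {t x y : ℂ} (ht : t ≠ 0) (hx : x ≠ 0) (hy : y ≠ 0)
    (hθ : theta q (t * (y / x)) ≠ 0) (k l : ℤ) :
    redPair q t x y k l = pairFn q t x y k l / (x * theta q (t * (y / x))) := by
  have hw : t * (y / x) ≠ 0 := mul_ne_zero ht (div_ne_zero hy hx)
  have hP := qPoch_ne_zero_of_theta h0 h1 hw hθ (l - k)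
  unfold redPair pairFn
  rw [thetaQuot_eq_div h0 h1 hw hP, show t * (y / x) * (q : ℂ) ^ (l - k) =
    t * (y / x * (q : ℂ) ^ (l - k)) by ring]
  rw [show t * (y / x) * (q : ℂ) ^ (l - k) = t * (y / x * (q : ℂ) ^ (l - k)) by ring] at hP
  generalize qPoch q (t * (y / x * (q : ℂ) ^ (l - k))) = A at *
  generalize theta q (t * (y / x)) = B at *
  generalize y / x * (q : ℂ) ^ (l - k) = W at *
  field_simp

/-- The factor by which the regularized terms differ from the reduced ones. -/
def denFactor (q : ℝ) (t : ℂ) (b : Fin 2 → ℂ) {n : ℕ} (x : Fin n → ℂ) : ℂ :=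
  (∏ i, theta q (b 0 * x i) * theta q (b 1 * x i)) *
    ∏ i, ∏ j ∈ Finset.Ioi i, x i * theta q (t * (x j / x i))

lemma redTerm_eq {n : ℕ} {t : ℂ} (ht : t ≠ 0) {α b : Fin 2 → ℂ} (hb : ∀ l, b l ≠ 0)
    {x : Fin n → ℂ} (hx : ∀ i, x i ≠ 0) (hθ : ∀ i l, theta q (b l * x i) ≠ 0)
    (hθ2 : ∀ i j, i < j → theta q (t * (x j / x i)) ≠ 0) (ν : Fin n → ℤ) :
    redTerm q t α b x ν = regTerm q t α b x ν / denFactor q t b x := by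
  unfold redTerm regTerm denFactor
  rw [Finset.prod_congr rfl fun i _ => redOne_eq h0 h1 hb (hx i) (hθ i) _,
    Finset.prod_congr rfl fun i _ => Finset.prod_congr rfl fun j hj =>
      redPair_eq h0 h1 ht (hx i) (hx j) (hθ2 i j (Finset.mem_Ioi.1 hj)) _ _]
  simp only [Finset.prod_div_distrib]
  ring

omit h0 h1 in
lemma denFactor_ne_zero {n : ℕ} {t : ℂ} {b : Fin 2 → ℂ}
    {x : Fin n → ℂ} (hx : ∀ i, x i ≠ 0) (hθ : ∀ i l, theta q (b l * x i) ≠ 0)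
    (hθ2 : ∀ i j, i < j → theta q (t * (x j / x i)) ≠ 0) : denFactor q t b x ≠ 0 :=
  mul_ne_zero (Finset.prod_ne_zero_iff.2 fun i _ => mul_ne_zero (hθ i 0) (hθ i 1))
    (Finset.prod_ne_zero_iff.2 fun i _ => Finset.prod_ne_zero_iff.2 fun j hj =>
      mul_ne_zero (hx i) (hθ2 i j (Finset.mem_Ioi.1 hj)))

omit h0 h1 in
lemma h_mul_denFactor {n : ℕ} (τ : ℂ) (lg : ℂ → ℂ) {b : Fin 2 → ℂ} {x : Fin n → ℂ}
    (hθ : ∀ i l, theta q (b l * x i) ≠ 0)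
    (hθ2 : ∀ i j, i < j → theta q ((q : ℂ) ^ τ * (x j / x i)) ≠ 0) :
    h q τ b lg x * denFactor q ((q : ℂ) ^ τ) b x = powFactor τ lg x * thetaVandermonde q x := by
  unfold h denFactor powFactor thetaVandermonde
  have e1 : ∏ i, x i = (∏ i, x i / (theta q (b 0 * x i) * theta q (b 1 * x i))) *
      ∏ i, theta q (b 0 * x i) * theta q (b 1 * x i) := by
    rw [← Finset.prod_mul_distrib]
    exact Finset.prod_congr rfl fun i _ =>
      (div_mul_cancel₀ _ (mul_ne_zero (hθ i 0) (hθ i 1))).symm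
  have e2 : (∏ i, ∏ j ∈ Finset.Ioi i, powL lg (x i) (2 * τ) *
      (theta q (x j / x i) / theta q ((q : ℂ) ^ τ * (x j / x i)))) *
      (∏ i, ∏ j ∈ Finset.Ioi i, x i * theta q ((q : ℂ) ^ τ * (x j / x i))) =
      (∏ i, ∏ _j ∈ Finset.Ioi i, powL lg (x i) (2 * τ)) *
      ∏ i, ∏ j ∈ Finset.Ioi i, x i * theta q (x j / x i) := by
    rw [← Finset.prod_mul_distrib, ← Finset.prod_mul_distrib]
    refine Finset.prod_congr rfl fun i _ => ?_
    rw [← Finset.prod_mul_distrib, ← Finset.prod_mul_distrib]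
    refine Finset.prod_congr rfl fun j hj => ?_
    have := hθ2 i j (Finset.mem_Ioi.1 hj)
    generalize theta q ((q : ℂ) ^ τ * (x j / x i)) = A at *
    field_simp
  rw [e1]
  linear_combination (∏ i, x i / (theta q (b 0 * x i) * theta q (b 1 * x i))) *
    (∏ i, theta q (b 0 * x i) * theta q (b 1 * x i)) * e2

end reduced

section limit

variable {q : ℝ} (h0 : 0 < q) (h1 : q < 1)

lemma exists_moduli {t : ℂ} (ht : t ≠ 0) {P : ℝ} {n : ℕ}
    (hc : ∀ k < n, q * ‖t‖ ^ (2 * k) < 1 ∧ P < ‖t‖ ^ (2 * k)) :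
    ∃ T₁ T₂ : ℝ, 0 < T₁ ∧ T₁ < ‖t‖ ∧ ‖t‖ < T₂ ∧
      (∀ k < n, q * T₁ ^ (2 * k) < 1 ∧ P < T₁ ^ (2 * k)) ∧
      ∀ k < n, q * T₂ ^ (2 * k) < 1 ∧ P < T₂ ^ (2 * k) := by
  have hev : ∀ᶠ T : ℝ in 𝓝 ‖t‖, ∀ k ∈ Finset.range n, q * T ^ (2 * k) < 1 ∧ P < T ^ (2 * k) := by
    rw [Filter.eventually_all_finset]
    intro k hk
    have hk := hc k (Finset.mem_range.1 hk)
    have c1 : Continuous fun T : ℝ => q * T ^ (2 * k) := by fun_prop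
    have c2 : Continuous fun T : ℝ => T ^ (2 * k) := by fun_prop
    exact (c1.continuousAt.eventually (Iio_mem_nhds hk.1)).and
      (c2.continuousAt.eventually (Ioi_mem_nhds hk.2))
  have hpos : 0 < ‖t‖ := norm_pos_iff.2 ht
  have hev₁ : ∀ᶠ T : ℝ in 𝓝[<] ‖t‖, (∀ k ∈ Finset.range n, q * T ^ (2 * k) < 1 ∧
      P < T ^ (2 * k)) ∧ 0 < T :=
    nhdsWithin_le_nhds (hev.and (eventually_gt_nhds hpos))
  have hev₂ : ∀ᶠ T : ℝ in 𝓝[>] ‖t‖, ∀ k ∈ Finset.range n, q * T ^ (2 * k) < 1 ∧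
      P < T ^ (2 * k) := nhdsWithin_le_nhds hev
  obtain ⟨T₁, hT₁, hT₁2⟩ := (hev₁.and self_mem_nhdsWithin).exists
  obtain ⟨T₂, hT₂, hT₂2⟩ := (hev₂.and self_mem_nhdsWithin).exists
  exact ⟨T₁, T₂, hT₁.2, hT₁2, hT₂2, fun k hk => hT₁.1 k (Finset.mem_range.2 hk),
    fun k hk => hT₂ k (Finset.mem_range.2 hk)⟩

include h0 h1

lemma eventually_redOne_le {α b : Fin 2 → ℂ} (hb : ∀ l, b l ≠ 0) {ρ : Fin 2 → ℝ}
    (hρ : ∀ l, ‖α l‖ < ρ l) {t : ℂ} {x : ℂ → ℂ} (hx : ContinuousAt x t) (hx0 : x t ≠ 0)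
    (hθ : ∀ l, theta q (b l * x t) ≠ 0) :
    ∃ C : ℝ, 0 ≤ C ∧ ∀ᶠ s in 𝓝 t, ∀ ν, ‖redOne q α b (x s) ν‖ ≤
      C * geomMaj q (q * (ρ 0 * ρ 1) / (‖b 0‖ * ‖b 1‖)) ν := by
  have hpos : 0 < ‖x t‖ := norm_pos_iff.2 hx0
  obtain ⟨C, hC, hbd⟩ := exists_oneVar_bound h0 h1 hb
    (fun l => (norm_nonneg _).trans_lt (hρ l)) (half_pos hpos) (R := 2 * ‖x t‖)
  have hcθ : ∀ l, ContinuousAt (fun s => theta q (b l * x s)) t := fun l =>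
    ContinuousAt.comp (g := theta q)
      (theta_differentiableAt h0 h1 (mul_ne_zero (hb l) hx0)).continuousAt
      (continuousAt_const.mul hx)
  have hc : ContinuousAt (fun s => ‖theta q (b 0 * x s) * theta q (b 1 * x s)‖) t :=
    ((hcθ 0).mul (hcθ 1)).norm
  have hD : 0 < ‖theta q (b 0 * x t) * theta q (b 1 * x t)‖ :=
    norm_pos_iff.2 (mul_ne_zero (hθ 0) (hθ 1))
  set D := ‖theta q (b 0 * x t) * theta q (b 1 * x t)‖ with hDdef
  refine ⟨C / (D / 2), by positivity, ?_⟩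
  have e1 := hc.eventually (Ioi_mem_nhds (half_lt_self hD))
  have e2 := hx.norm.eventually (Ioi_mem_nhds (half_lt_self hpos))
  have e3 := hx.norm.eventually (Iio_mem_nhds (lt_two_mul_self hpos))
  have e4 := fun l => (hcθ l).eventually_ne (hθ l)
  filter_upwards [e1, e2, e3, e4 0, e4 1] with s s1 s2 s3 s4 s5 ν
  have s1 : D / 2 < ‖theta q (b 0 * x s) * theta q (b 1 * x s)‖ := s1
  have s2 : ‖x t‖ / 2 < ‖x s‖ := s2
  have s3 : ‖x s‖ < 2 * ‖x t‖ := s3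
  have hxs : x s ≠ 0 := norm_pos_iff.1 ((half_pos hpos).trans s2)
  rw [redOne_eq h0 h1 hb hxs (fun l => by fin_cases l; exacts [s4, s5]), norm_div]
  have hb1 := hbd α (x s) ν (fun l => (hρ l).le) s2.le s3.le
  rw [div_mul_eq_mul_div]
  exact div_le_div₀ ((norm_nonneg _).trans hb1) hb1 (half_pos hD) s1.le

lemma eventually_redPair_le_of_theta {t : ℂ} (ht : t ≠ 0) {x y : ℂ → ℂ} (hx : ContinuousAt x t)
    (hx0 : x t ≠ 0) (hy : ContinuousAt y t) (hy0 : y t ≠ 0)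
    (hθ : theta q (t * (y t / x t)) ≠ 0) :
    ∃ C : ℝ, 0 ≤ C ∧ ∀ᶠ s in 𝓝 t, ∀ k l, ‖redPair q s (x s) (y s) k l‖ ≤
      C * ‖s‖ ^ (2 * min k l) := by
  have hpos : 0 < ‖t‖ := norm_pos_iff.2 ht
  have hxpos : 0 < ‖x t‖ := norm_pos_iff.2 hx0
  have hypos : 0 < ‖y t‖ := norm_pos_iff.2 hy0
  set r := min ‖x t‖ ‖y t‖ / 2 with hr
  have hr0 : 0 < r := half_pos (lt_min hxpos hypos)
  have hrx : r < ‖x t‖ := (half_lt_self (lt_min hxpos hypos)).trans_le (min_le_left _ _)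
  have hry : r < ‖y t‖ := (half_lt_self (lt_min hxpos hypos)).trans_le (min_le_right _ _)
  set R := ‖x t‖ + ‖y t‖ with hR
  obtain ⟨C, hC, hbd⟩ := exists_pairFn_bound h0 h1 hr0 (half_pos hpos) (R := R) (T₂ := 2 * ‖t‖)
  have hc : ContinuousAt (fun s => theta q (s * (y s / x s))) t :=
    ContinuousAt.comp (g := theta q) (theta_differentiableAt h0 h1
      (mul_ne_zero ht (div_ne_zero hy0 hx0))).continuousAt (continuousAt_id.mul (hy.div hx hx0))
  have hD : 0 < ‖theta q (t * (y t / x t))‖ := norm_pos_iff.2 hθ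
  set D := ‖theta q (t * (y t / x t))‖ with hDdef
  refine ⟨C / (r * (D / 2)), by positivity, ?_⟩
  filter_upwards [hc.norm.eventually (Ioi_mem_nhds (half_lt_self hD)), hc.eventually_ne hθ,
    hx.norm.eventually (Ioi_mem_nhds hrx),
    hx.norm.eventually (Iio_mem_nhds (show ‖x t‖ < R by linarith)),
    hy.norm.eventually (Ioi_mem_nhds hry),
    hy.norm.eventually (Iio_mem_nhds (show ‖y t‖ < R by linarith)),
    continuous_norm.continuousAt.eventually (Ioi_mem_nhds (half_lt_self hpos)),
    continuous_norm.continuousAt.eventually (Iio_mem_nhds (lt_two_mul_self hpos))]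
    with s s1 s2 s3 s4 s5 s6 s7 s8 k l
  have s1 : D / 2 < ‖theta q (s * (y s / x s))‖ := s1
  have s3 : r < ‖x s‖ := s3
  have s5 : r < ‖y s‖ := s5
  have s7 : ‖t‖ / 2 < ‖s‖ := s7
  rw [redPair_eq h0 h1 (norm_pos_iff.1 ((half_pos hpos).trans s7))
    (norm_pos_iff.1 (hr0.trans s3)) (norm_pos_iff.1 (hr0.trans s5)) s2, norm_div, norm_mul]
  have hb1 := hbd s (x s) (y s) k l s7.le (le_of_lt s8) s3.le (le_of_lt s4) s5.le (le_of_lt s6)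
  rw [div_mul_eq_mul_div]
  exact div_le_div₀ ((norm_nonneg _).trans hb1) hb1 (by positivity)
    (mul_le_mul s3.le s1.le (by positivity) (norm_nonneg _))

/-- The bound for a pair of consecutive powers in a geometric progression of ratio `t`. -/
lemma eventually_redPair_le_of_qPoch {t : ℂ} (ht : t ≠ 0) {d : ℕ}
    (hP : qPoch q (t ^ (d + 1)) ≠ 0) :
    ∃ C : ℝ, 0 ≤ C ∧ ∀ᶠ s in 𝓝 t, ∀ x : ℂ, x ≠ 0 → ∀ k l, k ≤ l →
      ‖redPair q s x (x * s ^ d) k l‖ ≤ C * ‖s‖ ^ (2 * min k l) := by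
  have hpos : 0 < ‖t‖ := norm_pos_iff.2 ht
  have hc : ContinuousAt (fun s : ℂ => qPoch q (s ^ (d + 1))) t :=
    ((qPoch_continuous h0 h1).comp (continuous_pow _)).continuousAt
  have hD : 0 < ‖qPoch q (t ^ (d + 1))‖ := norm_pos_iff.2 hP
  set D := ‖qPoch q (t ^ (d + 1))‖ with hDdef
  have h1q : 0 < 1 - q := by linarith
  set T := 2 * ‖t‖ with hT
  refine ⟨(1 + T ^ d) * (Real.exp (q * (‖t‖ / 2)⁻¹ * T ^ d / (1 - q)) *
    (Real.exp (T ^ (d + 1) / (1 - q)) / (D / 2))), by positivity, ?_⟩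
  filter_upwards [hc.norm.eventually (Ioi_mem_nhds (half_lt_self hD)), hc.eventually_ne hP,
    continuous_norm.continuousAt.eventually (Ioi_mem_nhds (half_lt_self hpos)),
    continuous_norm.continuousAt.eventually (Iio_mem_nhds (lt_two_mul_self hpos))]
    with s s1 s2 s3 s4 x hx k l hkl
  have s1 : D / 2 < ‖qPoch q (s ^ (d + 1))‖ := s1
  have s3 : ‖t‖ / 2 < ‖s‖ := s3
  have s4 : ‖s‖ < T := s4
  have hs0 : s ≠ 0 := norm_pos_iff.1 ((half_pos hpos).trans s3)
  obtain ⟨m, hm⟩ : ∃ m : ℕ, l - k = m := ⟨(l - k).toNat, by omega⟩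
  have hTd : ‖s‖ ^ d ≤ T ^ d := pow_le_pow_left₀ (norm_nonneg _) s4.le _
  have hqm : q ^ m ≤ 1 := pow_le_one₀ h0.le h1.le
  have hqm0 : 0 < q ^ m := pow_pos h0 m
  unfold redPair
  rw [hm, mul_div_cancel_left₀ _ hx, min_eq_left hkl, zpow_natCast, norm_mul, norm_mul, norm_zpow,
    mul_assoc, mul_comm (‖s‖ ^ _)]
  refine mul_le_mul_of_nonneg_right ?_ (by positivity)
  refine mul_le_mul ?_ ?_ (norm_nonneg _) (by positivity)
  · refine (norm_sub_le _ _).trans ?_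
    rw [norm_one, norm_mul, norm_pow, norm_pow, norm_q h0]
    have : ‖s‖ ^ d * q ^ m ≤ T ^ d * 1 := mul_le_mul hTd hqm hqm0.le (by positivity)
    linarith
  · rw [div_eq_mul_inv, norm_mul]
    refine mul_le_mul ?_ ?_ (norm_nonneg _) (Real.exp_pos _).le
    · apply norm_qPoch_le' h0 h1
      rw [norm_mul, norm_mul, norm_mul, norm_inv, norm_pow, norm_pow, norm_q h0, mul_assoc,
        mul_assoc]
      have e1 : ‖s‖⁻¹ ≤ (‖t‖ / 2)⁻¹ := inv_anti₀ (half_pos hpos) s3.le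
      have e2 : ‖s‖ ^ d * q ^ m ≤ T ^ d := by
        have : ‖s‖ ^ d * q ^ m ≤ T ^ d * 1 := mul_le_mul hTd hqm hqm0.le (by positivity)
        linarith
      refine mul_le_mul_of_nonneg_left ?_ h0.le
      exact mul_le_mul e1 e2 (by positivity) (by positivity)
    · have sp := qPoch_split h0 h1 (s ^ (d + 1)) m
      have e : s * (s ^ d * (q : ℂ) ^ m) = (q : ℂ) ^ m * s ^ (d + 1) := by ring
      rw [e]
      have hne : qPoch q ((q : ℂ) ^ m * s ^ (d + 1)) ≠ 0 := by
        intro hz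
        rw [hz, mul_zero] at sp
        exact s2 sp
      have e2 : (qPoch q ((q : ℂ) ^ m * s ^ (d + 1)))⁻¹ =
          (∏ j ∈ Finset.range m, (1 - (q : ℂ) ^ j * s ^ (d + 1))) / qPoch q (s ^ (d + 1)) := by
        rw [eq_div_iff s2, sp]
        field_simp
      rw [e2, norm_div]
      refine div_le_div₀ (Real.exp_pos _).le ?_ (half_pos hD) s1.le
      refine (norm_prod_one_sub_geom_le h0 h1 _ _).trans (Real.exp_le_exp.2 ?_)
      rw [norm_pow]
      gcongr

/-- The sum of the reduced terms depends continuously on `t` along a continuous family of points,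
whose pairs of coordinates are either in general position, or belong to a geometric progression
of ratio `t` and impose an inequality on the indices of the nonvanishing terms. -/
lemma redSum_continuousAt {n : ℕ} {t : ℂ} (ht : t ≠ 0) {α b : Fin 2 → ℂ} (hb : ∀ l, b l ≠ 0)
    (hc : ConvCond q t α b n) {x : ℂ → Fin n → ℂ} (hx : ∀ i, ContinuousAt (fun s => x s i) t)
    (hx0 : ∀ i, x t i ≠ 0) (hθ : ∀ i l, theta q (b l * x t i) ≠ 0)
    (hpair : ∀ i j, i < j → theta q (t * (x t j / x t i)) ≠ 0 ∨ ∃ d : ℕ,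
      qPoch q (t ^ (d + 1)) ≠ 0 ∧ ∀ᶠ s in 𝓝 t, x s j = x s i * s ^ d ∧
        ∀ ν, redTerm q s α b (x s) ν ≠ 0 → ν i ≤ ν j) :
    Summable (redTerm q t α b (x t)) ∧
      ContinuousAt (fun s => ∑' ν, redTerm q s α b (x s) ν) t := by
  have hq := q_ne h0
  obtain ⟨ρ, hρ, hρ2⟩ := exists_radii hb hc
  set P := q * (ρ 0 * ρ 1) / (‖b 0‖ * ‖b 1‖) with hPdef
  have hP : 0 ≤ P := by
    have := (norm_nonneg _).trans_lt (hρ 0)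
    have := (norm_nonneg _).trans_lt (hρ 1)
    positivity
  obtain ⟨T₁, T₂, hT₁, hT₁t, htT₂, hc₁, hc₂⟩ :=
    exists_moduli (P := P) ht fun k hk => ⟨(hc k hk).1, hρ2 k hk⟩
  choose C₁ hC₁ hev₁ using fun i => eventually_redOne_le h0 h1 hb hρ (hx i) (hx0 i) (hθ i)
  have hpairs : ∀ i j, ∃ C : ℝ, 0 ≤ C ∧ (i < j → ∀ᶠ s in 𝓝 t, ∀ ν,
      redTerm q s α b (x s) ν ≠ 0 →
      ‖redPair q s (x s i) (x s j) (ν i) (ν j)‖ ≤ C * ‖s‖ ^ (2 * min (ν i) (ν j))) := by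
    intro i j
    by_cases hij : i < j
    · rcases hpair i j hij with h | ⟨d, hd, hs⟩
      · obtain ⟨C, hC, hev⟩ := eventually_redPair_le_of_theta h0 h1 ht (hx i) (hx0 i) (hx j)
          (hx0 j) h
        exact ⟨C, hC, fun _ => hev.mono fun s hs ν _ => hs _ _⟩
      · obtain ⟨C, hC, hev⟩ := eventually_redPair_le_of_qPoch h0 h1 ht hd
        refine ⟨C, hC, fun _ => ?_⟩
        filter_upwards [hev, hs, (hx i).eventually_ne (hx0 i)] with s s1 s2 s3 ν hν
        rw [s2.1]
        exact s1 _ s3 _ _ (s2.2 ν hν)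
    · exact ⟨0, le_rfl, fun h => absurd h hij⟩
  choose C₂ hC₂ hev₂ using hpairs
  have hB₁ : ∀ i, C₁ i ≤ ∑ i, C₁ i := fun i =>
    Finset.single_le_sum (fun i _ => hC₁ i) (Finset.mem_univ i)
  have hB₂ : ∀ i j, C₂ i j ≤ ∑ i, ∑ j, C₂ i j := fun i j =>
    (Finset.single_le_sum (fun j _ => hC₂ i j) (Finset.mem_univ j)).trans
      (Finset.single_le_sum (f := fun i => ∑ j, C₂ i j)
        (fun i _ => Finset.sum_nonneg fun j _ => hC₂ i j) (Finset.mem_univ i))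
  set B₁ := ∑ i, C₁ i with hB₁def
  set B₂ := ∑ i, ∑ j, C₂ i j with hB₂def
  have hB₁0 : 0 ≤ B₁ := Finset.sum_nonneg fun i _ => hC₁ i
  have hB₂0 : 0 ≤ B₂ := Finset.sum_nonneg fun i _ => Finset.sum_nonneg fun j _ => hC₂ i j
  set u : (Fin n → ℤ) → ℝ := fun ν =>
    (∏ _i : Fin n, B₁) * (∏ i : Fin n, ∏ _j ∈ Finset.Ioi i, B₂) * termMaj q P T₁ T₂ ν with hu
  have husum : Summable u := (termMaj_summable h0 hP hT₁ (hT₁.trans (hT₁t.trans htT₂)) hc₁ hc₂).mul_left _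
  have hbound : ∀ᶠ s in 𝓝 t, ∀ ν, ‖redTerm q s α b (x s) ν‖ ≤ u ν := by
    have E₁ : ∀ᶠ s in 𝓝 t, ∀ i ν, ‖redOne q α b (x s i) ν‖ ≤ C₁ i * geomMaj q P ν :=
      Filter.eventually_all.2 hev₁
    have E₂ : ∀ᶠ s in 𝓝 t, ∀ i j, i < j → ∀ ν, redTerm q s α b (x s) ν ≠ 0 →
        ‖redPair q s (x s i) (x s j) (ν i) (ν j)‖ ≤ C₂ i j * ‖s‖ ^ (2 * min (ν i) (ν j)) := by
      refine Filter.eventually_all.2 fun i => Filter.eventually_all.2 fun j => ?_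
      by_cases hij : i < j
      · exact (hev₂ i j hij).mono fun s hs _ => hs
      · exact Eventually.of_forall fun s h => absurd h hij
    filter_upwards [E₁, E₂, continuous_norm.continuousAt.eventually (Ioi_mem_nhds hT₁t),
      continuous_norm.continuousAt.eventually (Iio_mem_nhds htT₂)] with s s1 s2 s3 s4 ν
    have s3 : T₁ < ‖s‖ := s3
    have hspos : 0 < ‖s‖ := hT₁.trans s3
    by_cases hz : redTerm q s α b (x s) ν = 0
    · have h2 := norm_prod_le_termMaj (n := n) (e := 0) (p := 0) h0 hP hT₁ s3.le (le_of_lt s4)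
        hB₁0 hB₂0 ν (fun i => by
          simpa using mul_nonneg hB₁0 (geomMaj_nonneg h0 hP (ν i)))
        (fun i j _ => by
          simp only [Pi.zero_apply, norm_zero]
          positivity)
      rw [hz, norm_zero]
      exact (norm_nonneg _).trans h2
    · exact norm_prod_le_termMaj h0 hP hT₁ s3.le (le_of_lt s4) hB₁0 hB₂0 ν
        (fun i => (s1 i _).trans (mul_le_mul_of_nonneg_right (hB₁ i) (geomMaj_nonneg h0 hP _)))
        (fun i j hij => (s2 i j hij ν hz).trans
          (mul_le_mul_of_nonneg_right (hB₂ i j) (by positivity)))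
  refine ⟨husum.of_norm_bounded hbound.self_of_nhds, ?_⟩
  refine tendsto_tsum_of_dominated_convergence husum (fun ν => ?_) hbound
  -- the convergence of the individual terms
  by_cases hmono : ∃ i j, i < j ∧ (∃ d : ℕ, qPoch q (t ^ (d + 1)) ≠ 0 ∧
      ∀ᶠ s in 𝓝 t, x s j = x s i * s ^ d ∧ ∀ ν, redTerm q s α b (x s) ν ≠ 0 → ν i ≤ ν j) ∧ ν j < ν i
  · obtain ⟨i, j, hij, ⟨d, hd, hs⟩, hlt⟩ := hmono
    have hz : ∀ᶠ s in 𝓝 t, redTerm q s α b (x s) ν = 0 := hs.mono fun s hs => by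
      by_contra h
      exact absurd (hs.2 ν h) (by omega)
    rw [hz.self_of_nhds]
    exact tendsto_const_nhds.congr' (hz.mono fun s hs => hs.symm)
  push Not at hmono
  have hqc := qPoch_continuous h0 h1
  unfold redTerm
  refine Tendsto.mul (tendsto_finsetProd _ fun i _ => ?_)
    (tendsto_finsetProd _ fun i _ => tendsto_finsetProd _ fun j hj => ?_)
  · unfold redOne
    refine Tendsto.mul tendsto_const_nhds (tendsto_finsetProd _ fun l _ => ?_)
    have hz : ContinuousAt (fun s => x s i * (q : ℂ) ^ ν i) t := (hx i).mul continuousAt_const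
    refine ContinuousAt.div (ContinuousAt.comp (g := qPoch q) hqc.continuousAt
      (continuousAt_const.mul hz))
      (ContinuousAt.comp (g := qPoch q) hqc.continuousAt (continuousAt_const.mul hz)) ?_
    rw [← mul_assoc]
    exact qPoch_ne_zero_of_theta h0 h1 (mul_ne_zero (hb l) (hx0 i)) (hθ i l) _
  · have hij := Finset.mem_Ioi.1 hj
    unfold redPair
    have hW : ContinuousAt (fun s => x s j / x s i * (q : ℂ) ^ (ν j - ν i)) t :=
      ((hx j).div (hx i) (hx0 i)).mul continuousAt_const
    have hs : ContinuousAt (fun s : ℂ => s) t := continuousAt_id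
    refine ContinuousAt.mul ((hs.zpow₀ _ (Or.inl ht)).mul (continuousAt_const.sub hW))
      (ContinuousAt.div (ContinuousAt.comp (g := qPoch q) hqc.continuousAt
        ((continuousAt_const.mul (hs.inv₀ ht)).mul hW))
        (ContinuousAt.comp (g := qPoch q) hqc.continuousAt (hs.mul hW)) ?_)
    rcases hpair i j hij with h | ⟨d, hd, hs⟩
    · rw [← mul_assoc]
      exact qPoch_ne_zero_of_theta h0 h1 (mul_ne_zero ht (div_ne_zero (hx0 j) (hx0 i))) h _
    · have hle := hmono i j hij ⟨d, hd, hs⟩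
      obtain ⟨m, hm⟩ : ∃ m : ℕ, ν j - ν i = m := ⟨(ν j - ν i).toNat, by omega⟩
      rw [hm, hs.self_of_nhds.1, mul_div_cancel_left₀ _ (hx0 i), zpow_natCast]
      intro hz
      refine hd ?_
      rw [qPoch_split h0 h1 _ m, show (q : ℂ) ^ m * t ^ (d + 1) = t * (t ^ d * (q : ℂ) ^ m) by ring,
        hz, mul_zero]

end limit

/-! ### Products over the points `ζ_i` -/

section products

lemma prod_Icc_one (n : ℕ) (f : ℕ → ℂ) :
    ∏ k ∈ Finset.Icc 1 n, f k = ∏ k ∈ Finset.range n, f (k + 1) := by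
  rw [show Finset.Icc 1 n = Finset.Ico 1 (n + 1) by ext; simp,
    Finset.prod_Ico_eq_prod_range]
  refine Finset.prod_congr (by simp) fun k _ => by rw [add_comm]

lemma prod_range_telescope (f : ℕ → ℂ) (m : ℕ) (h : ∀ k ≤ m, f k ≠ 0) :
    ∏ k ∈ Finset.range m, f k / f (k + 1) = f 0 / f m := by
  induction m with
  | zero => simp [h 0 le_rfl]
  | succ m ih =>
    rw [Finset.prod_range_succ, ih fun k hk => h k (by omega)]
    have := h m (by omega)
    field_simp

lemma prod_range_reverse (f : ℕ → ℂ) (m : ℕ) :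
    ∏ k ∈ Finset.range m, f (m - k) = ∏ k ∈ Finset.range m, f (k + 1) := by
  rw [← Finset.prod_range_reflect]
  refine Finset.prod_congr rfl fun k hk => ?_
  rw [show m - (m - 1 - k) = k + 1 by have := Finset.mem_range.1 hk; omega]

lemma prod_range_complement (f : ℕ → ℂ) {n i : ℕ} (hi : i ≤ n + 1) :
    (∏ k ∈ Finset.range (n + 1 - i), f k) * ∏ l ∈ Finset.range i, f (n - l) =
      ∏ k ∈ Finset.range (n + 1), f k := by
  conv_rhs => rw [show n + 1 = n + 1 - i + i by omega, Finset.prod_range_add]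
  congr 1
  rw [← Finset.prod_range_reflect]
  refine Finset.prod_congr rfl fun l hl => ?_
  rw [show n - (i - 1 - l) = n + 1 - i + l by have := Finset.mem_range.1 hl; omega]

variable {n i : ℕ} (t x₁ x₂ : ℂ)

lemma prod_zeta (hi : i ≤ n) (f : ℕ → ℂ → ℂ) :
    ∏ m : Fin n, f m (zeta n t i x₁ x₂ m) =
      (∏ j ∈ Finset.range i, f j (x₁ * t ^ j)) *
        ∏ k ∈ Finset.range (n - i), f (i + k) (x₂ * t ^ k) := by
  unfold zeta
  rw [Fin.prod_univ_eq_prod_range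
    (fun m => f m (if m < i then x₁ * t ^ m else x₂ * t ^ (m - i))) n]
  conv_lhs => rw [show n = i + (n - i) by omega, Finset.prod_range_add]
  congr 1
  · exact Finset.prod_congr rfl fun j hj => by rw [if_pos (Finset.mem_range.1 hj)]
  · refine Finset.prod_congr rfl fun k _ => ?_
    rw [if_neg (by omega), show i + k - i = k by omega]

lemma prod_Ioi_zeta (p : Fin n) (f : ℂ → ℂ) :
    ∏ r ∈ Finset.Ioi p, f (zeta n t i x₁ x₂ r) =
      ∏ r ∈ Finset.Ico ((p : ℕ) + 1) n,
        f (if r < i then x₁ * t ^ r else x₂ * t ^ (r - i)) := by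
  have e := Finset.prod_map (Finset.Ioi p) Fin.valEmbedding
    (fun r : ℕ => f (if r < i then x₁ * t ^ r else x₂ * t ^ (r - i)))
  rw [Fin.map_valEmbedding_Ioi] at e
  simp only [Fin.valEmbedding_apply] at e
  unfold zeta
  rw [← e]
  refine Finset.prod_congr ?_ fun _ _ => rfl
  ext r
  simp

variable {t x₁ x₂}

/-- The product over the pairs of coordinates of `ζ_i` of the quotients `φ w / φ (t w)`: every row
telescopes in each of the two blocks. -/
lemma prod_pairs_zeta (ht : t ≠ 0) (hx₁ : x₁ ≠ 0) (hx₂ : x₂ ≠ 0) (hi : i ≤ n) (φ : ℂ → ℂ)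
    (hφ : ∀ k ∈ Finset.range n, φ (t ^ (k + 1)) ≠ 0)
    (hφx : ∀ m : ℤ, |m| < n → φ (x₂ * x₁⁻¹ * t ^ m) ≠ 0) :
    ∏ p, ∏ r ∈ Finset.Ioi p, φ (zeta n t i x₁ x₂ r / zeta n t i x₁ x₂ p) /
        φ (t * (zeta n t i x₁ x₂ r / zeta n t i x₁ x₂ p)) =
      φ t ^ n / ((∏ k ∈ Finset.range i, φ (t ^ (k + 1))) *
        ∏ k ∈ Finset.range (n - i), φ (t ^ (k + 1))) *
      ((∏ j ∈ Finset.range i, φ (x₂ * x₁⁻¹ * t ^ (-(j : ℤ)))) /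
        ∏ j ∈ Finset.range i, φ (x₂ * x₁⁻¹ * t ^ ((n : ℤ) - i - j))) := by
  -- the part of a row in its own block
  have hblock : ∀ x : ℂ, x ≠ 0 → ∀ p m : ℕ, m + 1 ≤ n →
      ∏ r ∈ Finset.range m, φ (x * t ^ (p + 1 + r) / (x * t ^ p)) /
        φ (t * (x * t ^ (p + 1 + r) / (x * t ^ p))) = φ t / φ (t ^ (m + 1)) := by
    intro x hx p m hm
    have e := prod_range_telescope (fun r => φ (t ^ (r + 1))) m
      (fun k hk => hφ k (Finset.mem_range.2 (by omega)))
    simp only [zero_add, pow_one] at e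
    rw [← e]
    refine Finset.prod_congr rfl fun r _ => ?_
    have hp := pow_ne_zero p ht
    have e2 : x * t ^ (p + 1 + r) / (x * t ^ p) = t ^ (r + 1) := by
      rw [show p + 1 + r = p + (r + 1) by ring, pow_add]
      field_simp
    rw [e2, ← pow_succ']
  -- the part of a row of the first block in the second block
  have hcross : ∀ p < i, ∏ r ∈ Finset.range (n - i), φ (x₂ * t ^ r / (x₁ * t ^ p)) /
      φ (t * (x₂ * t ^ r / (x₁ * t ^ p))) =
      φ (x₂ * x₁⁻¹ * t ^ (-(p : ℤ))) / φ (x₂ * x₁⁻¹ * t ^ ((n : ℤ) - i - p)) := by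
    intro p hp
    have e := prod_range_telescope (fun r => φ (x₂ * x₁⁻¹ * t ^ ((r : ℤ) - p))) (n - i)
      (fun k hk => hφx _ (by rw [abs_lt]; omega))
    simp only [Nat.cast_zero, zero_sub] at e
    rw [show (n : ℤ) - i = ((n - i : ℕ) : ℤ) by omega, ← e]
    refine Finset.prod_congr rfl fun r _ => ?_
    have hp := pow_ne_zero p ht
    have e2 : x₂ * t ^ r / (x₁ * t ^ p) = x₂ * x₁⁻¹ * t ^ ((r : ℤ) - p) := by
      rw [zpow_sub₀ ht, zpow_natCast, zpow_natCast]
      field_simp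
    have e3 : t * (x₂ * t ^ r / (x₁ * t ^ p)) = x₂ * x₁⁻¹ * t ^ (((r + 1 : ℕ) : ℤ) - p) := by
      rw [zpow_sub₀ ht, zpow_natCast, zpow_natCast, pow_succ]
      field_simp
    rw [e2, ← e3, e2]
  have hrow1 : ∀ p : ℕ, p < i → ∏ r ∈ Finset.Ico (p + 1) n,
      φ ((if r < i then x₁ * t ^ r else x₂ * t ^ (r - i)) / (x₁ * t ^ p)) /
        φ (t * ((if r < i then x₁ * t ^ r else x₂ * t ^ (r - i)) / (x₁ * t ^ p))) =
      φ t / φ (t ^ (i - p)) *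
        (φ (x₂ * x₁⁻¹ * t ^ (-(p : ℤ))) / φ (x₂ * x₁⁻¹ * t ^ ((n : ℤ) - i - p))) := by
    intro p hp
    rw [← Finset.prod_Ico_consecutive _ (show p + 1 ≤ i by omega) hi]
    rw [Finset.prod_Ico_eq_prod_range, Finset.prod_Ico_eq_prod_range]
    congr 1
    · rw [show i - p = i - (p + 1) + 1 by omega, ← hblock x₁ hx₁ p (i - (p + 1)) (by omega)]
      refine Finset.prod_congr rfl fun r hr => ?_
      rw [if_pos (by have := Finset.mem_range.1 hr; omega)]
    · rw [← hcross p hp]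
      refine Finset.prod_congr rfl fun r _ => ?_
      rw [if_neg (by omega), show i + r - i = r by omega]
  have hrow2 : ∀ k : ℕ, k < n - i → ∏ r ∈ Finset.Ico (i + k + 1) n,
      φ ((if r < i then x₁ * t ^ r else x₂ * t ^ (r - i)) / (x₂ * t ^ k)) /
        φ (t * ((if r < i then x₁ * t ^ r else x₂ * t ^ (r - i)) / (x₂ * t ^ k))) =
      φ t / φ (t ^ (n - i - k)) := by
    intro k hk
    rw [Finset.prod_Ico_eq_prod_range]
    rw [show n - i - k = n - (i + k + 1) + 1 by omega, ← hblock x₂ hx₂ k (n - (i + k + 1)) (by omega)]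
    refine Finset.prod_congr rfl fun r _ => ?_
    rw [if_neg (by omega), show i + k + 1 + r - i = k + 1 + r by omega]
  have e : ∀ p : Fin n, ∏ r ∈ Finset.Ioi p, φ (zeta n t i x₁ x₂ r / zeta n t i x₁ x₂ p) /
        φ (t * (zeta n t i x₁ x₂ r / zeta n t i x₁ x₂ p)) =
      ∏ r ∈ Finset.Ico ((p : ℕ) + 1) n,
        φ ((if r < i then x₁ * t ^ r else x₂ * t ^ (r - i)) / zeta n t i x₁ x₂ p) /
        φ (t * ((if r < i then x₁ * t ^ r else x₂ * t ^ (r - i)) / zeta n t i x₁ x₂ p)) :=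
    fun p => prod_Ioi_zeta t x₁ x₂ p
      (fun z => φ (z / zeta n t i x₁ x₂ p) / φ (t * (z / zeta n t i x₁ x₂ p)))
  rw [Finset.prod_congr rfl fun p _ => e p, prod_zeta t x₁ x₂ hi (fun p z =>
    ∏ r ∈ Finset.Ico (p + 1) n, φ ((if r < i then x₁ * t ^ r else x₂ * t ^ (r - i)) / z) /
      φ (t * ((if r < i then x₁ * t ^ r else x₂ * t ^ (r - i)) / z)))]
  rw [Finset.prod_congr rfl fun p hp => hrow1 p (Finset.mem_range.1 hp),
    Finset.prod_congr rfl fun k hk => hrow2 k (Finset.mem_range.1 hk)]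
  simp only [Finset.prod_mul_distrib, Finset.prod_div_distrib, Finset.prod_const,
    Finset.card_range]
  rw [prod_range_reverse (fun k => φ (t ^ k)), prod_range_reverse (fun k => φ (t ^ k))]
  rw [show φ t ^ n = φ t ^ i * φ t ^ (n - i) by rw [← pow_add]; congr 1; omega]
  ring

end products

section weights

variable {q : ℝ} (h0 : 0 < q) (h1 : q < 1)

/-- The part of the coefficient of `J(ζ_i)` without complex powers. -/
def redWeight (n : ℕ) (q : ℝ) (t : ℂ) (i : ℕ) (x₁ x₂ : ℂ) : ℂ :=
  (∏ j ∈ Finset.range i, (theta q (x₂ * x₁⁻¹ * t ^ (-(j : ℤ))))⁻¹) *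
    ∏ k ∈ Finset.range (n - i), (theta q (x₁ * x₂⁻¹ * t ^ ((i : ℤ) - k)))⁻¹

lemma powL_mul_cancel {lg : ℂ → ℂ} (hlg : IsQLog q lg) (τ : ℂ) {z : ℂ} (hz : z ≠ 0) (k : ℕ) :
    powL lg z (-1 - 2 * k * τ) * (z * powL lg z (2 * τ) ^ k) = 1 := by
  have e := (hlg z hz).1
  have e2 : powL lg z (-1 - 2 * k * τ) * powL lg z (2 * τ) ^ k = z⁻¹ := by
    rw [show z⁻¹ = Complex.exp (-lg z) by rw [Complex.exp_neg, e]]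
    unfold powL
    rw [← Complex.exp_nat_mul, ← Complex.exp_add]
    congr 1
    ring
  rw [mul_left_comm, e2, mul_inv_cancel₀ hz]

/-- The complex powers cancel in the product of a coefficient and a term. -/
lemma weight_mul_powFactor {lg : ℂ → ℂ} (hlg : IsQLog q lg) {τ t : ℂ} (ht : t = (q : ℂ) ^ τ)
    (ht0 : t ≠ 0) {n i : ℕ} (hi : i ≤ n) {x₁ x₂ : ℂ} (hx₁ : x₁ ≠ 0) (hx₂ : x₂ ≠ 0) :
    weight n q τ lg i x₁ x₂ * powFactor τ lg (zeta n t i x₁ x₂) = redWeight n q t i x₁ x₂ := by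
  have e1 : powFactor τ lg (zeta n t i x₁ x₂) = ∏ m : Fin n, (fun (m : ℕ) z =>
      z * powL lg z (2 * τ) ^ (n - 1 - m)) m (zeta n t i x₁ x₂ m) := by
    unfold powFactor
    rw [← Finset.prod_mul_distrib]
    simp
  rw [e1, prod_zeta t x₁ x₂ hi (fun (m : ℕ) z => z * powL lg z (2 * τ) ^ (n - 1 - m))]
  unfold weight redWeight
  rw [← ht, prod_Icc_one i (fun j => powL lg (x₁ * t ^ ((j : ℤ) - 1)) (-1 - 2 * ((n : ℂ) - j) * τ) /
      theta q (x₂ * x₁⁻¹ * t ^ (-(j : ℤ) + 1))), prod_Icc_one (n - i) (fun k =>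
    powL lg (x₂ * t ^ ((k : ℤ) - 1)) (-1 - 2 * ((n : ℂ) - i - k) * τ) /
      theta q (x₁ * x₂⁻¹ * t ^ ((i : ℤ) - k + 1))), mul_mul_mul_comm, ← Finset.prod_mul_distrib,
      ← Finset.prod_mul_distrib]
  congr 1
  · refine Finset.prod_congr rfl fun j hj => ?_
    have hj := Finset.mem_range.1 hj
    have hc := powL_mul_cancel hlg τ (mul_ne_zero hx₁ (pow_ne_zero j ht0)) (n - 1 - j)
    have ec : (n : ℂ) - ((j + 1 : ℕ) : ℂ) = ((n - 1 - j : ℕ) : ℂ) := by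
      rw [← Nat.cast_sub (by omega)]
      congr 1
      omega
    rw [show ((j + 1 : ℕ) : ℤ) - 1 = j by omega, zpow_natCast, ec,
      show -((j + 1 : ℕ) : ℤ) + 1 = -(j : ℤ) by omega, div_mul_eq_mul_div, hc, one_div]
  · refine Finset.prod_congr rfl fun k hk => ?_
    have hk := Finset.mem_range.1 hk
    have hc := powL_mul_cancel hlg τ (mul_ne_zero hx₂ (pow_ne_zero k ht0)) (n - 1 - (i + k))
    have ec : (n : ℂ) - i - ((k + 1 : ℕ) : ℂ) = ((n - 1 - (i + k) : ℕ) : ℂ) := by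
      rw [← Nat.cast_sub hi, ← Nat.cast_sub (by omega)]
      congr 1
      omega
    rw [show ((k + 1 : ℕ) : ℤ) - 1 = k by omega, zpow_natCast, ec,
      show (i : ℤ) - ((k + 1 : ℕ) : ℤ) + 1 = (i : ℤ) - k by omega, div_mul_eq_mul_div, hc, one_div]

/-- The coefficients `H_i`, in terms of the interpolation coefficients. -/
lemma H_mul_prod {n i : ℕ} (hi : i ≤ n + 1) {t : ℂ} (ht : t ≠ 0) {b : Fin 2 → ℂ} {x₁ x₂ : ℂ}
    (hκ : ∀ l ∈ Finset.range (n + 1), theta q (b 1 * (b 0 * t ^ n) * x₁ * x₂ * t ^ l) ≠ 0) :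
    H (n + 1) q t b i x₁ x₂ * ∏ l ∈ Finset.range (n + 1),
        theta q (b 1 * (b 0 * t ^ n) * x₁ * x₂ * t ^ l) =
      interpCoeff q t (b 1) (b 0 * t ^ n) x₁ x₂ i (n + 1 - i) := by
  have hk : ∏ l ∈ Finset.range (n + 1), theta q (b 1 * (b 0 * t ^ n) * x₁ * x₂ * t ^ l) ≠ 0 :=
    Finset.prod_ne_zero_iff.2 hκ
  unfold H interpCoeff
  simp only [prod_Icc_one]
  have e0 : i + (n + 1 - i) = n + 1 := by omega
  have e0' : (i : ℤ) + ((n + 1 - i : ℕ) : ℤ) = n + 1 := by omega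
  have e0'' : ((n + 1 - i : ℕ) : ℤ) = n + 1 - i := by omega
  rw [e0, e0', e0'']
  have e1 : ∀ l : ℕ, theta q (t ^ ((l + 1 : ℕ) : ℤ)) = theta q (t ^ (l + 1)) := fun l => by
    rw [zpow_natCast]
  have e2 : ∀ (x β : ℂ) (l : ℕ), x * β * t ^ (((n + 1 : ℕ) : ℤ) - ((l + 1 : ℕ) : ℤ)) =
      β * x * t ^ ((n : ℤ) + 1 - 1 - l) := fun x β l => by
    rw [show ((n + 1 : ℕ) : ℤ) - ((l + 1 : ℕ) : ℤ) = (n : ℤ) + 1 - 1 - l by push_cast; ring]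
    ring
  have e3 : ∀ (x : ℂ) (l : ℕ), b 0 * t ^ n * x * t ^ (-(l : ℤ)) =
      b 0 * x * t ^ ((n : ℤ) + 1 - 1 - l) := fun x l => by
    rw [show (n : ℤ) + 1 - 1 - l = n + -l by ring, zpow_add₀ ht, zpow_natCast]
    ring
  have e4 : ∀ l : ℕ, ((n + 1 : ℕ) : ℤ) - i - ((l + 1 : ℕ) : ℤ) + 1 = n + 1 - i - l := fun l => by
    push_cast; ring
  have e5 : ∀ l : ℕ, (i : ℤ) - ((l + 1 : ℕ) : ℤ) + 1 = i - l := fun l => by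
    push_cast; ring
  have e6 : ∀ l : ℕ, x₁ * x₂ * b 0 * b 1 * t ^ (((n + 1 : ℕ) : ℤ) + ((l + 1 : ℕ) : ℤ) - 2) =
      b 1 * (b 0 * t ^ n) * x₁ * x₂ * t ^ l := fun l => by
    rw [show ((n + 1 : ℕ) : ℤ) + ((l + 1 : ℕ) : ℤ) - 2 = n + l by push_cast; ring, zpow_add₀ ht,
      zpow_natCast, zpow_natCast]
    ring
  simp only [e1, e2, e3, e4, e5, e6, ← div_eq_mul_inv, Finset.prod_div_distrib,
    Finset.prod_mul_distrib]
  rw [mul_assoc _ (_ / _), div_mul_cancel₀ _ hk]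
  ring

end weights

/-! ### The summation formula in general position -/

section identity

variable {q : ℝ} (h0 : 0 < q) (h1 : q < 1) {n : ℕ} {t : ℂ} {α b : Fin 2 → ℂ}

include h0 h1

lemma qPoch_convCond_ne_zero (ht : t ≠ 0) (hb : ∀ l, b l ≠ 0) (hc : ConvCond q t α b (n + 1))
    {k : ℕ} (hk : k ≤ n) : qPoch q (q * (α 0 * α 1) / (b 0 * b 1 * t ^ (n + k))) ≠ 0 := by
  refine qPoch_ne_zero_of_norm_lt h0 h1 ?_
  have hpos : 0 < ‖b 0‖ * ‖b 1‖ := mul_pos (norm_pos_iff.2 (hb 0)) (norm_pos_iff.2 (hb 1))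
  have htpos : 0 < ‖t‖ := norm_pos_iff.2 ht
  rw [norm_div, norm_mul, norm_mul, norm_mul, norm_mul, norm_pow, norm_q h0,
    div_lt_one (by positivity)]
  rcases le_total 1 ‖t‖ with h | h
  · refine (hc 0 (by omega)).2.trans_le ?_
    rw [mul_zero, pow_zero]
    exact mul_le_mul_of_nonneg_left (one_le_pow₀ h) hpos.le
  · refine (hc n (by omega)).2.trans_le ?_
    exact mul_le_mul_of_nonneg_left (pow_le_pow_of_le_one htpos.le h (by omega)) hpos.le

/-- The product of the numerators of the evaluation. -/
def numProd (q : ℝ) (n : ℕ) (t : ℂ) (α b : Fin 2 → ℂ) : ℂ :=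
  ∏ k ∈ Finset.range (n + 1), ∏ l, ∏ l', qPoch q (q * α l / (b l' * t ^ k))

/-- The denominator of the evaluation. -/
def denProd (q : ℝ) (n : ℕ) (t : ℂ) (α b : Fin 2 → ℂ) : ℂ :=
  ∏ k ∈ Finset.range (n + 1), qPoch q (q * (α 0 * α 1) / (b 0 * b 1 * t ^ (n + k)))

lemma denProd_ne_zero (ht : t ≠ 0) (hb : ∀ l, b l ≠ 0) (hc : ConvCond q t α b (n + 1)) :
    denProd q n t α b ≠ 0 :=
  Finset.prod_ne_zero_iff.2 fun _ hk => qPoch_convCond_ne_zero h0 h1 ht hb hc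
    (Nat.lt_succ_iff.1 (Finset.mem_range.1 hk))

lemma quotient_at_cone (ht : t ≠ 0) (hb : ∀ l, b l ≠ 0) (hc : ConvCond q t α b (n + 1))
    (hθ : ∀ k ∈ Finset.range (n + 1), theta q (t ^ (k + 1)) ≠ 0) {F : (Fin (n + 1) → ℂ) → ℂ}
    (hF : ∀ x, (∀ i, x i ≠ 0) → regSum q t α b x = F x * thetaVandermonde q x) :
    F (geomPoint (n + 1) t (b 0 * t ^ n)⁻¹) *
        (denProd q n t α b * ∏ _k ∈ Finset.range (n + 1), qPoch q (q * t⁻¹)) =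
      (∏ k ∈ Finset.range (n + 1), (qPoch q q * qPoch q (q * (t ^ (k + 1))⁻¹))) *
        numProd q n t α b := by
  have hξ : (b 0 * t ^ n)⁻¹ ≠ 0 := inv_ne_zero (mul_ne_zero (hb 0) (pow_ne_zero _ ht))
  have hA := thetaVandermonde_geomPoint_ne_zero h0 h1 ht hξ hθ
  have e1 := coneFormula h0 h1 ht hb hc
  have e2 := coneConst_mul_prod h0 h1 ht (hb 0) hθ
  unfold ConeFormula at e1
  rw [hF _ (geomPoint_ne_zero ht hξ)] at e1
  refine mul_left_cancel₀ hA ?_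
  unfold denProd numProd
  linear_combination (∏ _k ∈ Finset.range (n + 1), qPoch q (q * t⁻¹)) * e1 +
    (∏ k ∈ Finset.range (n + 1), ∏ l, ∏ l', qPoch q (q * α l / (b l' * t ^ k))) * e2

lemma sum_interpCoeff (ht : t ≠ 0) (hb : ∀ l, b l ≠ 0)
    (hθ : ∀ k ∈ Finset.range (n + 1), theta q (t ^ (k + 1)) ≠ 0) {F : (Fin (n + 1) → ℂ) → ℂ}
    (hsym : ∀ (σ : Equiv.Perm (Fin (n + 1))) (x : Fin (n + 1) → ℂ), (∀ i, x i ≠ 0) →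
      F (x ∘ σ) = F x)
    (hV : ∀ x : Fin (n + 1) → ℂ, (∀ i, x i ≠ 0) → ∀ k,
        IsTwoTheta q (b 0 * b 1 * t ^ n) (fun y => F (Function.update x k y)))
    {x₁ x₂ : ℂ} (hx₁ : x₁ ≠ 0) (hx₂ : x₂ ≠ 0)
    (hx : ∀ m : ℤ, |m| < ((n + 1 : ℕ) : ℤ) → theta q (x₂ * x₁⁻¹ * t ^ m) ≠ 0) :
    ∑ i ∈ Finset.range (n + 1 + 1), interpCoeff q t (b 1) (b 0 * t ^ n) x₁ x₂ i (n + 1 - i) *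
        F (zeta (n + 1) t i x₁ x₂) =
      (∏ l ∈ Finset.range (n + 1), theta q (b 1 * (b 0 * t ^ n) * x₁ * x₂ * t ^ l)) *
        F (geomPoint (n + 1) t (b 0 * t ^ n)⁻¹) := by
  rw [← zeta_zero_eq_geomPoint (n + 1) t x₁]
  refine (symmetric_expansion h0 h1 ht (hb 1) (mul_ne_zero (hb 0) (pow_ne_zero _ ht)) hx₁ hx₂ hθ
    (fun e he => ?_) hsym ?_).symm
  · rw [div_eq_mul_inv]
    exact hx e he
  · rw [show b 1 * (b 0 * t ^ n) = b 0 * b 1 * t ^ n by ring]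
    exact hV

omit h0 h1 in
lemma zeta_ne_zero (ht : t ≠ 0) {x₁ x₂ : ℂ} (hx₁ : x₁ ≠ 0) (hx₂ : x₂ ≠ 0) (N i : ℕ) (m : Fin N) :
    zeta N t i x₁ x₂ m ≠ 0 := by
  unfold zeta
  split_ifs
  exacts [mul_ne_zero hx₁ (pow_ne_zero _ ht), mul_ne_zero hx₂ (pow_ne_zero _ ht)]

omit h0 h1 in
lemma theta_mul_zeta_ne_zero {N i : ℕ} {x₁ x₂ : ℂ}
    (hθb : ∀ k < N, ∀ j, theta q (x₁ * b j * t ^ k) ≠ 0 ∧ theta q (x₂ * b j * t ^ k) ≠ 0)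
    (m : Fin N) (l : Fin 2) : theta q (b l * zeta N t i x₁ x₂ m) ≠ 0 := by
  unfold zeta
  split_ifs
  · have := (hθb m m.2 l).1
    rwa [mul_comm x₁, mul_assoc] at this
  · have := (hθb (m - i) (by omega) l).2
    rwa [mul_comm x₂, mul_assoc] at this

omit h0 h1 in
lemma zeta_div_cross (ht : t ≠ 0) {N i : ℕ} {x₁ x₂ : ℂ} (hx₁ : x₁ ≠ 0) {p r : Fin N}
    (hp : (p : ℕ) < i) (hr : i ≤ (r : ℕ)) :
    t * (zeta N t i x₁ x₂ r / zeta N t i x₁ x₂ p) =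
      x₂ * x₁⁻¹ * t ^ ((r : ℤ) - i - p + 1) := by
  have htp := pow_ne_zero (p : ℕ) ht
  simp only [zeta, if_pos hp, if_neg (not_lt.2 hr)]
  rw [zpow_add_one₀ ht, show (r : ℤ) - i = ((r - i : ℕ) : ℤ) by omega, zpow_sub₀ ht, zpow_natCast,
    zpow_natCast]
  field_simp

omit h0 h1 in
lemma theta_zeta_cross_ne_zero (ht : t ≠ 0) {N i : ℕ} {x₁ x₂ : ℂ} (hx₁ : x₁ ≠ 0)
    (hx : ∀ m : ℤ, |m| < N → theta q (x₂ * x₁⁻¹ * t ^ m) ≠ 0) {p r : Fin N}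
    (hp : (p : ℕ) < i) (hr : i ≤ (r : ℕ)) :
    theta q (t * (zeta N t i x₁ x₂ r / zeta N t i x₁ x₂ p)) ≠ 0 := by
  rw [zeta_div_cross ht hx₁ hp hr]
  refine hx _ ?_
  rw [abs_lt]
  have := r.2
  omega

omit h0 h1 in
lemma zeta_block {N i : ℕ} (s x₁ x₂ : ℂ) {p r : Fin N} (hpr : p ≤ r)
    (h : (r : ℕ) < i ∨ i ≤ (p : ℕ)) :
    zeta N s i x₁ x₂ r = zeta N s i x₁ x₂ p * s ^ ((r : ℕ) - p) := by
  have hpr' : (p : ℕ) ≤ r := hpr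
  unfold zeta
  rcases h with h | h
  · rw [if_pos h, if_pos (by omega), mul_assoc, ← pow_add]
    congr 2
    omega
  · rw [if_neg (by omega), if_neg (by omega), mul_assoc, ← pow_add]
    congr 2
    omega

omit h0 h1 in
lemma theta_mul_zeta_div_ne_zero (ht : t ≠ 0) {N i : ℕ} {x₁ x₂ : ℂ} (hx₁ : x₁ ≠ 0) (hx₂ : x₂ ≠ 0)
    (hθ : ∀ k ∈ Finset.range N, theta q (t ^ (k + 1)) ≠ 0)
    (hx : ∀ m : ℤ, |m| < N → theta q (x₂ * x₁⁻¹ * t ^ m) ≠ 0) (p r : Fin N) (hpr : p < r) :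
    theta q (t * (zeta N t i x₁ x₂ r / zeta N t i x₁ x₂ p)) ≠ 0 := by
  by_cases h : (r : ℕ) < i ∨ i ≤ (p : ℕ)
  · rw [zeta_block t x₁ x₂ hpr.le h, mul_div_cancel_left₀ _ (zeta_ne_zero ht hx₁ hx₂ N i p),
      ← pow_succ']
    exact hθ _ (Finset.mem_range.2 (by omega))
  · push Not at h
    exact theta_zeta_cross_ne_zero ht hx₁ hx h.2 h.1

/-- The coefficients of the summation formula are proportional to the interpolation
coefficients. -/
lemma redWeight_mul_ratio (ht : t ≠ 0) {i : ℕ} (hi : i ≤ n + 1) {x₁ x₂ : ℂ} (hx₁ : x₁ ≠ 0)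
    (hx₂ : x₂ ≠ 0) (hθ : ∀ k ∈ Finset.range (n + 1), theta q (t ^ (k + 1)) ≠ 0)
    (hx : ∀ m : ℤ, |m| < ((n + 1 : ℕ) : ℤ) → theta q (x₂ * x₁⁻¹ * t ^ m) ≠ 0)
    (hθb : ∀ k < n + 1, ∀ j, theta q (x₁ * b j * t ^ k) ≠ 0 ∧ theta q (x₂ * b j * t ^ k) ≠ 0) :
    redWeight (n + 1) q t i x₁ x₂ * (thetaVandermonde q (zeta (n + 1) t i x₁ x₂) /
        denFactor q t b (zeta (n + 1) t i x₁ x₂)) =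
      interpCoeff q t (b 1) (b 0 * t ^ n) x₁ x₂ i (n + 1 - i) *
        (theta q t ^ (n + 1) / ((∏ k ∈ Finset.range (n + 1), theta q (t ^ (k + 1))) *
          ∏ k ∈ Finset.range (n + 1), ∏ j, (theta q (x₁ * b j * t ^ k) *
            theta q (x₂ * b j * t ^ k)))) := by
  have hzne := zeta_ne_zero ht hx₁ hx₂ (n + 1) i
  have hpair := theta_mul_zeta_div_ne_zero (i := i) ht hx₁ hx₂ hθ hx
  -- the quotient of the Vandermonde product
  have hVan : thetaVandermonde q (zeta (n + 1) t i x₁ x₂) =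
      (∏ p, ∏ r ∈ Finset.Ioi p, theta q (zeta (n + 1) t i x₁ x₂ r / zeta (n + 1) t i x₁ x₂ p) /
        theta q (t * (zeta (n + 1) t i x₁ x₂ r / zeta (n + 1) t i x₁ x₂ p))) *
      ∏ p, ∏ r ∈ Finset.Ioi p, zeta (n + 1) t i x₁ x₂ p *
        theta q (t * (zeta (n + 1) t i x₁ x₂ r / zeta (n + 1) t i x₁ x₂ p)) := by
    unfold thetaVandermonde
    rw [← Finset.prod_mul_distrib]
    refine Finset.prod_congr rfl fun p _ => ?_
    rw [← Finset.prod_mul_distrib]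
    refine Finset.prod_congr rfl fun r hr => ?_
    have := hpair p r (Finset.mem_Ioi.1 hr)
    generalize theta q (t * (zeta (n + 1) t i x₁ x₂ r / zeta (n + 1) t i x₁ x₂ p)) = A at *
    field_simp
  have hden : ∏ p, ∏ r ∈ Finset.Ioi p, zeta (n + 1) t i x₁ x₂ p *
        theta q (t * (zeta (n + 1) t i x₁ x₂ r / zeta (n + 1) t i x₁ x₂ p)) ≠ 0 :=
    Finset.prod_ne_zero_iff.2 fun p _ => Finset.prod_ne_zero_iff.2 fun r hr =>
      mul_ne_zero (hzne p) (hpair p r (Finset.mem_Ioi.1 hr))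
  unfold denFactor
  rw [hVan, mul_div_mul_right _ _ hden,
    prod_pairs_zeta ht hx₁ hx₂ hi (theta q) hθ hx,
    prod_zeta t x₁ x₂ hi (fun _ z => theta q (b 0 * z) * theta q (b 1 * z))]
  -- the numerators of the interpolation coefficient complete the products over the coordinates
  have hU : ∀ x : ℂ, ∀ m, m ≤ n + 1 → ∏ k ∈ Finset.range (n + 1), ∏ j, theta q (x * b j * t ^ k) =
      (∏ k ∈ Finset.range (n + 1 - m), theta q (b 0 * (x * t ^ k)) * theta q (b 1 * (x * t ^ k))) *
      ((∏ l ∈ Finset.range m, theta q (b 0 * t ^ n * x * t ^ (-(l : ℤ)))) *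
        ∏ l ∈ Finset.range m, theta q (b 1 * x * t ^ (((n + 1 : ℕ) : ℤ) - 1 - l))) := by
    intro x m hm
    rw [← prod_range_complement (fun k => ∏ j, theta q (x * b j * t ^ k)) hm,
      ← Finset.prod_mul_distrib]
    congr 1
    · refine Finset.prod_congr rfl fun k _ => ?_
      rw [Fin.prod_univ_two]
      congr 2 <;> ring
    · refine Finset.prod_congr rfl fun l hl => ?_
      have hl := Finset.mem_range.1 hl
      rw [Fin.prod_univ_two]
      rw [show ((n + 1 : ℕ) : ℤ) - 1 - l = ((n - l : ℕ) : ℤ) by omega, zpow_natCast]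
      have e : t ^ (n - l) = t ^ n * t ^ (-(l : ℤ)) := by
        rw [zpow_neg, zpow_natCast, eq_mul_inv_iff_mul_eq₀ (pow_ne_zero _ ht), ← pow_add]
        congr 1
        omega
      rw [show b 0 * t ^ n * x * t ^ (-(l : ℤ)) = x * b 0 * t ^ (n - l) by rw [e]; ring]
      congr 2
      ring
  have hD : ∏ k ∈ Finset.range (n + 1), ∏ j, (theta q (x₁ * b j * t ^ k) *
            theta q (x₂ * b j * t ^ k)) =
      (∏ k ∈ Finset.range (n + 1), ∏ j, theta q (x₁ * b j * t ^ k)) *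
      ∏ k ∈ Finset.range (n + 1), ∏ j, theta q (x₂ * b j * t ^ k) := by
    simp only [Finset.prod_mul_distrib]
  have hD1 : ∏ k ∈ Finset.range (n + 1), ∏ j, theta q (x₁ * b j * t ^ k) ≠ 0 :=
    Finset.prod_ne_zero_iff.2 fun k hk => Finset.prod_ne_zero_iff.2 fun j _ =>
      (hθb k (Finset.mem_range.1 hk) j).1
  have hD2 : ∏ k ∈ Finset.range (n + 1), ∏ j, theta q (x₂ * b j * t ^ k) ≠ 0 :=
    Finset.prod_ne_zero_iff.2 fun k hk => Finset.prod_ne_zero_iff.2 fun j _ =>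
      (hθb k (Finset.mem_range.1 hk) j).2
  have hTN : ∏ k ∈ Finset.range (n + 1), theta q (t ^ (k + 1)) ≠ 0 :=
    Finset.prod_ne_zero_iff.2 hθ
  have hV0 : ∏ j ∈ Finset.range i, theta q (x₂ * x₁⁻¹ * t ^ (-(j : ℤ))) ≠ 0 :=
    Finset.prod_ne_zero_iff.2 fun j hj => hx _ (by
      have := Finset.mem_range.1 hj
      rw [abs_lt]
      omega)
  rw [hD]
  rw [hU x₁ (n + 1 - i) (by omega), show n + 1 - (n + 1 - i) = i by omega] at hD1 ⊢
  rw [hU x₂ i hi] at hD2 ⊢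
  unfold redWeight interpCoeff
  rw [show i + (n + 1 - i) = n + 1 by omega,
    show (i : ℤ) + ((n + 1 - i : ℕ) : ℤ) = ((n + 1 : ℕ) : ℤ) by omega,
    show ((n + 1 - i : ℕ) : ℤ) = ((n + 1 : ℕ) : ℤ) - i by omega]
  simp only [div_eq_mul_inv x₂ x₁, div_eq_mul_inv x₁ x₂, Finset.prod_inv_distrib]
  have hc1 := left_ne_zero_of_mul hD1
  have hu1 := right_ne_zero_of_mul hD1
  have hc2 := left_ne_zero_of_mul hD2
  have hu2 := right_ne_zero_of_mul hD2
  generalize ∏ j ∈ Finset.range i, theta q (x₂ * x₁⁻¹ * t ^ (-(j : ℤ))) = V0 at *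
  generalize ∏ j ∈ Finset.range i, theta q (x₂ * x₁⁻¹ * t ^ (((n + 1 : ℕ) : ℤ) - i - j)) = V
  generalize ∏ k ∈ Finset.range (n + 1 - i), theta q (x₁ * x₂⁻¹ * t ^ ((i : ℤ) - k)) = W
  generalize ∏ k ∈ Finset.range (n + 1), theta q (t ^ (k + 1)) = TN at *
  generalize ∏ k ∈ Finset.range i, theta q (t ^ (k + 1)) = T1
  generalize ∏ k ∈ Finset.range (n + 1 - i), theta q (t ^ (k + 1)) = T2
  generalize (∏ l ∈ Finset.range i, theta q (b 0 * t ^ n * x₂ * t ^ (-(l : ℤ)))) *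
    ∏ l ∈ Finset.range i, theta q (b 1 * x₂ * t ^ (((n + 1 : ℕ) : ℤ) - 1 - l)) = U2 at *
  generalize (∏ l ∈ Finset.range (n + 1 - i), theta q (b 0 * t ^ n * x₁ * t ^ (-(l : ℤ)))) *
    ∏ l ∈ Finset.range (n + 1 - i), theta q (b 1 * x₁ * t ^ (((n + 1 : ℕ) : ℤ) - 1 - l)) = U1 at *
  generalize ∏ j ∈ Finset.range i, theta q (b 0 * (x₁ * t ^ j)) * theta q (b 1 * (x₁ * t ^ j)) =
    c1 at *
  generalize ∏ j ∈ Finset.range (n + 1 - i),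
    theta q (b 0 * (x₂ * t ^ j)) * theta q (b 1 * (x₂ * t ^ j)) = c2 at *
  field_simp

/-- The right-hand side of the summation formula, as a function of `t`. -/
def sumRHS (q : ℝ) (n : ℕ) (t : ℂ) (α b : Fin 2 → ℂ) (x₁ x₂ : ℂ) : ℂ :=
  (∏ _k ∈ Finset.range (n + 1), (qPoch q q * qPoch q t)) * numProd q n t α b /
    ((∏ k ∈ Finset.range (n + 1), qPoch q (t ^ (k + 1))) * denProd q n t α b) *
  ((∏ k ∈ Finset.range (n + 1), theta q (b 1 * (b 0 * t ^ n) * x₁ * x₂ * t ^ k)) /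
    ∏ k ∈ Finset.range (n + 1), ∏ j, (theta q (x₁ * b j * t ^ k) * theta q (x₂ * b j * t ^ k)))

lemma sum_redWeight_of_theta_ne_zero (ht : t ≠ 0) (hb : ∀ l, b l ≠ 0)
    (hc : ConvCond q t α b (n + 1)) {x₁ x₂ : ℂ} (hx₁ : x₁ ≠ 0)
    (hx₂ : x₂ ≠ 0) (hθ : ∀ k ∈ Finset.range (n + 1), theta q (t ^ (k + 1)) ≠ 0)
    (hx : ∀ m : ℤ, |m| < ((n + 1 : ℕ) : ℤ) → theta q (x₂ * x₁⁻¹ * t ^ m) ≠ 0)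
    (hθb : ∀ k < n + 1, ∀ j, theta q (x₁ * b j * t ^ k) ≠ 0 ∧ theta q (x₂ * b j * t ^ k) ≠ 0) :
    ∑ i ∈ Finset.range (n + 1 + 1), redWeight (n + 1) q t i x₁ x₂ *
        ∑' ν, redTerm q t α b (zeta (n + 1) t i x₁ x₂) ν = sumRHS q n t α b x₁ x₂ := by
  obtain ⟨F, -, hF, hsym, hV⟩ := exists_regSum_eq_mul h0 h1 ht hb hc
  have hterm : ∀ i ∈ Finset.range (n + 1 + 1), redWeight (n + 1) q t i x₁ x₂ *
        ∑' ν, redTerm q t α b (zeta (n + 1) t i x₁ x₂) ν =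
      theta q t ^ (n + 1) / ((∏ k ∈ Finset.range (n + 1), theta q (t ^ (k + 1))) *
          ∏ k ∈ Finset.range (n + 1), ∏ j, (theta q (x₁ * b j * t ^ k) *
            theta q (x₂ * b j * t ^ k))) *
      (interpCoeff q t (b 1) (b 0 * t ^ n) x₁ x₂ i (n + 1 - i) * F (zeta (n + 1) t i x₁ x₂)) := by
    intro i hi
    have hi := Nat.lt_succ_iff.1 (Finset.mem_range.1 hi)
    have hzne := zeta_ne_zero ht hx₁ hx₂ (n + 1) i
    have e := redWeight_mul_ratio h0 h1 ht hi hx₁ hx₂ hθ hx hθb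
    rw [tsum_congr fun ν => redTerm_eq h0 h1 ht hb hzne (theta_mul_zeta_ne_zero hθb)
      (theta_mul_zeta_div_ne_zero ht hx₁ hx₂ hθ hx) ν, tsum_div_const,
      show ∑' ν, regTerm q t α b (zeta (n + 1) t i x₁ x₂) ν =
        F (zeta (n + 1) t i x₁ x₂) * thetaVandermonde q (zeta (n + 1) t i x₁ x₂) from hF _ hzne,
      mul_div_assoc]
    linear_combination F (zeta (n + 1) t i x₁ x₂) * e
  rw [Finset.sum_congr rfl hterm, ← Finset.mul_sum,
    sum_interpCoeff h0 h1 ht hb hθ hsym hV hx₁ hx₂ hx]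
  have hcone := quotient_at_cone h0 h1 ht hb hc hθ hF
  have hden := denProd_ne_zero h0 h1 ht hb hc
  have hT : ∏ k ∈ Finset.range (n + 1), theta q (t ^ (k + 1)) =
      (∏ k ∈ Finset.range (n + 1), qPoch q (t ^ (k + 1))) *
        ∏ k ∈ Finset.range (n + 1), qPoch q (q * (t ^ (k + 1))⁻¹) := by
    rw [← Finset.prod_mul_distrib]
    rfl
  have hTt : theta q t ^ (n + 1) = (∏ _k ∈ Finset.range (n + 1), qPoch q t) *
      ∏ _k ∈ Finset.range (n + 1), qPoch q (q * t⁻¹) := by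
    rw [Finset.prod_const, Finset.prod_const, Finset.card_range, ← mul_pow]
    rfl
  have hT0 : ∏ k ∈ Finset.range (n + 1), theta q (t ^ (k + 1)) ≠ 0 :=
    Finset.prod_ne_zero_iff.2 hθ
  have hq0 : ∏ _k ∈ Finset.range (n + 1), qPoch q (q * t⁻¹) ≠ 0 := by
    have := hθ 0 (by simp)
    rw [zero_add, pow_one] at this
    exact Finset.prod_ne_zero_iff.2 fun _ _ => right_ne_zero_of_mul this
  have hD : ∏ k ∈ Finset.range (n + 1), ∏ j, (theta q (x₁ * b j * t ^ k) *
      theta q (x₂ * b j * t ^ k)) ≠ 0 :=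
    Finset.prod_ne_zero_iff.2 fun k hk => Finset.prod_ne_zero_iff.2 fun j _ =>
      mul_ne_zero (hθb k (Finset.mem_range.1 hk) j).1 (hθb k (Finset.mem_range.1 hk) j).2
  rw [hT] at hT0
  have ha := left_ne_zero_of_mul hT0
  have hb := right_ne_zero_of_mul hT0
  rw [← eq_div_iff (mul_ne_zero hden hq0)] at hcone
  unfold sumRHS
  rw [hcone, hT, hTt]
  simp only [Finset.prod_mul_distrib] at hD ⊢
  generalize ∏ k ∈ Finset.range (n + 1), qPoch q (t ^ (k + 1)) = A1 at *
  generalize ∏ k ∈ Finset.range (n + 1), qPoch q (q * (t ^ (k + 1))⁻¹) = A2 at *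
  generalize ∏ _k ∈ Finset.range (n + 1), qPoch q (q * t⁻¹) = A3 at *
  generalize denProd q n t α b = A4 at *
  generalize (∏ k ∈ Finset.range (n + 1), ∏ j, theta q (x₁ * b j * t ^ k)) *
    ∏ k ∈ Finset.range (n + 1), ∏ j, theta q (x₂ * b j * t ^ k) = A5 at *
  field_simp

end identity

/-! ### The summation formula for all admissible `t` -/

section continuation

variable {q : ℝ} (h0 : 0 < q) (h1 : q < 1) {n : ℕ} {t : ℂ} {α b : Fin 2 → ℂ}

include h0 h1

/-- On a geometric progression of ratio `s`, the nonvanishing terms have weakly increasing indices: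
a consecutive pair contributes the factor `(q ^ (1 + l - k))_∞`. -/
lemma le_of_redTerm_zeta_ne_zero {s : ℂ} (hs : s ≠ 0) {N i : ℕ} {x₁ x₂ : ℂ} (hx₁ : x₁ ≠ 0)
    (hx₂ : x₂ ≠ 0) {ν : Fin N → ℤ} (hν : redTerm q s α b (zeta N s i x₁ x₂) ν ≠ 0) {p r : Fin N}
    (hpr : p ≤ r) (h : (r : ℕ) < i ∨ i ≤ (p : ℕ)) : ν p ≤ ν r := by
  have hpairs : ∀ u v : Fin N, u < v →
      redPair q s (zeta N s i x₁ x₂ u) (zeta N s i x₁ x₂ v) (ν u) (ν v) ≠ 0 := fun u v huv =>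
    Finset.prod_ne_zero_iff.1 (Finset.prod_ne_zero_iff.1 (right_ne_zero_of_mul hν) u
      (Finset.mem_univ _)) v (Finset.mem_Ioi.2 huv)
  have hstep : ∀ u v : Fin N, (v : ℕ) = u + 1 → ((v : ℕ) < i ∨ i ≤ (u : ℕ)) → ν u ≤ ν v := by
    intro u v huv hb
    have hlt : u < v := by
      rw [Fin.lt_def]
      omega
    have hne := hpairs u v hlt
    by_contra hlt'
    refine hne ?_
    have hz : qPoch q (q * s⁻¹ * (s * (q : ℂ) ^ (ν v - ν u))) = 0 := by
      rw [show (q : ℂ) * s⁻¹ * (s * (q : ℂ) ^ (ν v - ν u)) = (q : ℂ) ^ (1 + (ν v - ν u)) by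
        rw [zpow_add₀ (q_ne h0), zpow_one]
        field_simp]
      rw [qPoch_q_zpow_eq_zero_iff h0 h1]
      omega
    have hd : (v : ℕ) - u = 1 := by omega
    unfold redPair
    rw [zeta_block s x₁ x₂ hlt.le hb, hd, pow_one,
      mul_div_cancel_left₀ _ (zeta_ne_zero hs hx₁ hx₂ N i u), hz]
    simp
  obtain ⟨d, hd⟩ : ∃ d : ℕ, (r : ℕ) = p + d := Nat.exists_eq_add_of_le hpr
  clear hpr
  induction d generalizing r with
  | zero =>
    rw [show r = p from Fin.ext (by simpa using hd)]
  | succ d ih =>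
    have hr := r.2
    refine (ih (r := ⟨p + d, by omega⟩) (h.imp (fun h => by simp only; omega) id) rfl).trans (hstep _ _ (by simp only; omega) ?_)
    rcases h with h | h
    · exact Or.inl h
    · exact Or.inr (by simp only; omega)

omit h0 h1 in
lemma zeta_continuous (N i : ℕ) (x₁ x₂ : ℂ) (m : Fin N) :
    Continuous fun s : ℂ => zeta N s i x₁ x₂ m := by
  unfold zeta
  split_ifs <;> fun_prop

lemma redSum_zeta_continuousAt {N : ℕ} (ht : t ≠ 0) (hb : ∀ l, b l ≠ 0) (hc : ConvCond q t α b N)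
    {x₁ x₂ : ℂ} (hx₁ : x₁ ≠ 0) (hx₂ : x₂ ≠ 0)
    (htk : ∀ k ∈ Finset.range N, qPoch q (t ^ (k + 1)) ≠ 0)
    (hx : ∀ m : ℤ, |m| < N → theta q (x₂ * x₁⁻¹ * t ^ m) ≠ 0)
    (hθb : ∀ k < N, ∀ j, theta q (x₁ * b j * t ^ k) ≠ 0 ∧ theta q (x₂ * b j * t ^ k) ≠ 0) (i : ℕ) :
    Summable (redTerm q t α b (zeta N t i x₁ x₂)) ∧
      ContinuousAt (fun s => ∑' ν, redTerm q s α b (zeta N s i x₁ x₂) ν) t := by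
  refine redSum_continuousAt (x := fun s => zeta N s i x₁ x₂) h0 h1 ht hb hc
    (fun m => (zeta_continuous N i x₁ x₂ m).continuousAt) (zeta_ne_zero ht hx₁ hx₂ N i)
    (theta_mul_zeta_ne_zero hθb) fun p r hpr => ?_
  have hlt : (p : ℕ) < r := hpr
  have hr := r.2
  by_cases h : (r : ℕ) < i ∨ i ≤ (p : ℕ)
  · refine Or.inr ⟨r - p, htk _ (Finset.mem_range.2 (by omega)), ?_⟩
    filter_upwards [eventually_ne_nhds ht] with s hs
    exact ⟨zeta_block s x₁ x₂ hpr.le h, fun ν hν =>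
      le_of_redTerm_zeta_ne_zero h0 h1 hs hx₁ hx₂ hν hpr.le h⟩
  · push Not at h
    exact Or.inl (theta_zeta_cross_ne_zero ht hx₁ hx h.2 h.1)

lemma redWeight_continuousAt {N i : ℕ} (hi : i ≤ N) (ht : t ≠ 0) {x₁ x₂ : ℂ} (hx₁ : x₁ ≠ 0)
    (hx₂ : x₂ ≠ 0) (hx : ∀ m : ℤ, |m| < N → theta q (x₂ * x₁⁻¹ * t ^ m) ≠ 0) :
    ContinuousAt (fun s => redWeight N q s i x₁ x₂) t := by
  have hz : ∀ (c : ℂ) (m : ℤ), c ≠ 0 → ContinuousAt (fun s : ℂ => theta q (c * s ^ m)) t :=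
    fun c m hc => ContinuousAt.comp (g := theta q)
      (theta_continuousAt h0 h1 (mul_ne_zero hc (zpow_ne_zero _ ht)))
      (continuousAt_const.mul (continuousAt_zpow₀ _ _ (Or.inl ht)))
  unfold redWeight
  refine ContinuousAt.mul (tendsto_finsetProd _ fun j hj => ?_)
    (tendsto_finsetProd _ fun k hk => ?_)
  · have hj := Finset.mem_range.1 hj
    exact (hz _ _ (mul_ne_zero hx₂ (inv_ne_zero hx₁))).inv₀ (hx _ (by rw [abs_lt]; omega))
  · have hk := Finset.mem_range.1 hk
    refine (hz _ _ (mul_ne_zero hx₁ (inv_ne_zero hx₂))).inv₀ ?_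
    have e : x₁ * x₂⁻¹ * t ^ ((i : ℤ) - k) = (x₂ * x₁⁻¹ * t ^ ((k : ℤ) - i))⁻¹ := by
      rw [mul_inv, mul_inv, inv_inv, ← zpow_neg, neg_sub, mul_comm x₁]
    rw [e, Ne, theta_inv_eq_zero_iff h0 h1
      (mul_ne_zero (mul_ne_zero hx₂ (inv_ne_zero hx₁)) (zpow_ne_zero _ ht))]
    exact hx _ (by rw [abs_lt]; omega)

lemma sumRHS_continuousAt (ht : t ≠ 0) (hb : ∀ l, b l ≠ 0) (hc : ConvCond q t α b (n + 1))
    {x₁ x₂ : ℂ} (hx₁ : x₁ ≠ 0) (hx₂ : x₂ ≠ 0)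
    (htk : ∀ k ∈ Finset.range (n + 1), qPoch q (t ^ (k + 1)) ≠ 0)
    (hθb : ∀ k < n + 1, ∀ j, theta q (x₁ * b j * t ^ k) ≠ 0 ∧ theta q (x₂ * b j * t ^ k) ≠ 0) :
    ContinuousAt (fun s => sumRHS q n s α b x₁ x₂) t := by
  have hP : ∀ {f : ℂ → ℂ}, ContinuousAt f t → ContinuousAt (fun s => qPoch q (f s)) t :=
    fun hf => ContinuousAt.comp (g := qPoch q) (qPoch_continuous h0 h1).continuousAt hf
  have hT : ∀ {f : ℂ → ℂ}, ContinuousAt f t → f t ≠ 0 →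
      ContinuousAt (fun s => theta q (f s)) t := fun hf h =>
    ContinuousAt.comp (g := theta q) (theta_continuousAt h0 h1 h) hf
  have hpow : ∀ k : ℕ, ContinuousAt (fun s : ℂ => s ^ k) t := fun k =>
    (continuous_pow k).continuousAt
  have hbt : ∀ (l : Fin 2) (k : ℕ), b l * t ^ k ≠ 0 := fun l k =>
    mul_ne_zero (hb l) (pow_ne_zero _ ht)
  have c1 : ContinuousAt (fun s => numProd q n s α b) t :=
    tendsto_finsetProd _ fun k _ => tendsto_finsetProd _ fun l _ => tendsto_finsetProd _ fun l' _ =>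
      hP (continuousAt_const.div (continuousAt_const.mul (hpow k)) (hbt l' k))
  have c2 : ContinuousAt (fun s => denProd q n s α b) t :=
    tendsto_finsetProd _ fun k _ => hP (continuousAt_const.div (continuousAt_const.mul (hpow _))
      (by rw [mul_assoc]; exact mul_ne_zero (hb 0) (hbt 1 _)))
  have c3 : ContinuousAt (fun s : ℂ => ∏ _k ∈ Finset.range (n + 1), (qPoch q q * qPoch q s)) t :=
    tendsto_finsetProd _ fun k _ => continuousAt_const.mul (hP continuousAt_id)
  have c4 : ContinuousAt (fun s : ℂ => ∏ k ∈ Finset.range (n + 1), qPoch q (s ^ (k + 1))) t :=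
    tendsto_finsetProd _ fun k _ => hP (hpow _)
  have c5 : ContinuousAt (fun s : ℂ => ∏ k ∈ Finset.range (n + 1),
      theta q (b 1 * (b 0 * s ^ n) * x₁ * x₂ * s ^ k)) t :=
    tendsto_finsetProd _ fun k _ => hT ((((continuousAt_const.mul
      (continuousAt_const.mul (hpow n))).mul continuousAt_const).mul continuousAt_const).mul (hpow k))
      (mul_ne_zero (mul_ne_zero (mul_ne_zero (mul_ne_zero (hb 1) (hbt 0 n)) hx₁) hx₂)
        (pow_ne_zero _ ht))
  have c6 : ContinuousAt (fun s : ℂ => ∏ k ∈ Finset.range (n + 1), ∏ j, (theta q (x₁ * b j * s ^ k) *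
      theta q (x₂ * b j * s ^ k))) t :=
    tendsto_finsetProd _ fun k _ => tendsto_finsetProd _ fun j _ =>
      (hT (continuousAt_const.mul (hpow k)) (mul_ne_zero (mul_ne_zero hx₁ (hb j)) (pow_ne_zero _ ht))).mul
        (hT (continuousAt_const.mul (hpow k)) (mul_ne_zero (mul_ne_zero hx₂ (hb j)) (pow_ne_zero _ ht)))
  refine ((c3.mul c1).div (c4.mul c2) (mul_ne_zero (Finset.prod_ne_zero_iff.2 htk)
    (denProd_ne_zero h0 h1 ht hb hc))).mul (c5.div c6 (Finset.prod_ne_zero_iff.2 fun k hk =>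
      Finset.prod_ne_zero_iff.2 fun j _ => mul_ne_zero (hθb k (Finset.mem_range.1 hk) j).1
        (hθb k (Finset.mem_range.1 hk) j).2))

omit h0 h1 in
lemma ConvCond.eventually (hc : ConvCond q t α b n) : ∀ᶠ s in 𝓝 t, ConvCond q s α b n := by
  have h : ∀ᶠ s : ℂ in 𝓝 t, ∀ k ∈ Finset.range n, q * ‖s‖ ^ (2 * k) < 1 ∧
      q * (‖α 0‖ * ‖α 1‖) < ‖b 0‖ * ‖b 1‖ * ‖s‖ ^ (2 * k) := by
    rw [Filter.eventually_all_finset]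
    intro k hk
    have hk := hc k (Finset.mem_range.1 hk)
    have c1 : Continuous fun s : ℂ => q * ‖s‖ ^ (2 * k) := by fun_prop
    have c2 : Continuous fun s : ℂ => ‖b 0‖ * ‖b 1‖ * ‖s‖ ^ (2 * k) := by fun_prop
    exact (c1.continuousAt.eventually (Iio_mem_nhds hk.1)).and
      (c2.continuousAt.eventually (Ioi_mem_nhds hk.2))
  exact h.mono fun s hs k hk => hs k (Finset.mem_range.2 hk)

/-- The summation formula, by continuity in `t` along the points at which no `θ(t ^ k)` vanishes. -/
lemma sum_redWeight (ht : t ≠ 0) (hb : ∀ l, b l ≠ 0)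
    (hc : ConvCond q t α b (n + 1)) {x₁ x₂ : ℂ} (hx₁ : x₁ ≠ 0)
    (hx₂ : x₂ ≠ 0) (htk : ∀ k ∈ Finset.range (n + 1), qPoch q (t ^ (k + 1)) ≠ 0)
    (hx : ∀ m : ℤ, |m| < ((n + 1 : ℕ) : ℤ) → theta q (x₂ * x₁⁻¹ * t ^ m) ≠ 0)
    (hθb : ∀ k < n + 1, ∀ j, theta q (x₁ * b j * t ^ k) ≠ 0 ∧ theta q (x₂ * b j * t ^ k) ≠ 0) :
    ∑ i ∈ Finset.range (n + 1 + 1), redWeight (n + 1) q t i x₁ x₂ *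
        ∑' ν, redTerm q t α b (zeta (n + 1) t i x₁ x₂) ν = sumRHS q n t α b x₁ x₂ := by
  have hT : ∀ {f : ℂ → ℂ}, ContinuousAt f t → f t ≠ 0 → theta q (f t) ≠ 0 →
      ∀ᶠ s in 𝓝 t, theta q (f s) ≠ 0 := fun hf h h2 =>
    (ContinuousAt.comp (g := theta q) (theta_continuousAt h0 h1 h) hf).eventually_ne h2
  have ev1 : ∀ᶠ s in 𝓝 t, ∀ m ∈ Finset.Ioo (-((n + 1 : ℕ) : ℤ)) ((n + 1 : ℕ) : ℤ),
      theta q (x₂ * x₁⁻¹ * s ^ m) ≠ 0 := by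
    rw [Filter.eventually_all_finset]
    intro m hm
    exact hT (continuousAt_const.mul (continuousAt_zpow₀ _ _ (Or.inl ht)))
      (mul_ne_zero (mul_ne_zero hx₂ (inv_ne_zero hx₁)) (zpow_ne_zero _ ht))
      (hx m (abs_lt.2 (Finset.mem_Ioo.1 hm)))
  have ev2 : ∀ᶠ s in 𝓝 t, ∀ k ∈ Finset.range (n + 1), ∀ j, theta q (x₁ * b j * s ^ k) ≠ 0 ∧
      theta q (x₂ * b j * s ^ k) ≠ 0 := by
    rw [Filter.eventually_all_finset]
    intro k hk
    refine Filter.eventually_all.2 fun j => ?_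
    have hk := hθb k (Finset.mem_range.1 hk) j
    have hp : ContinuousAt (fun s : ℂ => s ^ k) t := (continuous_pow k).continuousAt
    exact (hT (continuousAt_const.mul hp)
      (mul_ne_zero (mul_ne_zero hx₁ (hb j)) (pow_ne_zero _ ht)) hk.1).and
      (hT (continuousAt_const.mul hp)
      (mul_ne_zero (mul_ne_zero hx₂ (hb j)) (pow_ne_zero _ ht)) hk.2)
  have hev : ∀ᶠ s in 𝓝 t, (∀ k ∈ Finset.range (n + 1), theta q (s ^ (k + 1)) ≠ 0) →
      ∑ i ∈ Finset.range (n + 1 + 1), redWeight (n + 1) q s i x₁ x₂ *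
        ∑' ν, redTerm q s α b (zeta (n + 1) s i x₁ x₂) ν = sumRHS q n s α b x₁ x₂ := by
    filter_upwards [ev1, ev2, hc.eventually, eventually_ne_nhds ht] with s s1 s2 s3 s4 hθ
    exact sum_redWeight_of_theta_ne_zero h0 h1 s4 hb s3 hx₁ hx₂ hθ
      (fun m hm => s1 m (Finset.mem_Ioo.2 (abs_lt.1 hm)))
      (fun k hk => s2 k (Finset.mem_range.2 hk))
  have cL : ContinuousAt (fun s => ∑ i ∈ Finset.range (n + 1 + 1), redWeight (n + 1) q s i x₁ x₂ *
        ∑' ν, redTerm q s α b (zeta (n + 1) s i x₁ x₂) ν) t :=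
    tendsto_finsetSum _ fun i hi => (redWeight_continuousAt h0 h1
      (Nat.lt_succ_iff.1 (Finset.mem_range.1 hi)) ht hx₁ hx₂ hx).mul
      (redSum_zeta_continuousAt h0 h1 ht hb hc hx₁ hx₂ htk hx hθb i).2
  have cR := sumRHS_continuousAt h0 h1 ht hb hc hx₁ hx₂ htk hθb
  -- a sequence of admissible points `t exp σ` with `σ → 0`
  have hcl := exists_real_shift (q := q) h0 (Set.range fun k : ℕ => t ^ (k + 1))
    (Set.countable_range _)
  set D : Set ℝ := {s : ℝ | ∀ w ∈ Set.range fun k : ℕ => t ^ (k + 1), w ≠ 0 → ∀ d : ℤ, d ≠ 0 →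
      ∀ k : ℤ, w * Complex.exp ((s * d : ℝ) : ℂ) ≠ (q : ℂ) ^ k} with hD
  have hnb : (𝓝[D] (0 : ℝ)).NeBot := mem_closure_iff_nhdsWithin_neBot.1 hcl
  have hlim : Tendsto (fun σ : ℝ => t * Complex.exp (σ : ℂ)) (𝓝[D] 0) (𝓝 t) := by
    have hcont : Continuous fun σ : ℝ => t * Complex.exp (σ : ℂ) := by fun_prop
    have := hcont.tendsto 0
    simp only [Complex.ofReal_zero, Complex.exp_zero, mul_one] at this
    exact this.mono_left nhdsWithin_le_nhds
  refine tendsto_nhds_unique_of_eventuallyEq (cL.tendsto.comp hlim) (cR.tendsto.comp hlim) ?_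
  filter_upwards [hlim.eventually hev, self_mem_nhdsWithin] with σ hσ hσD
  refine hσ fun k _ => ?_
  have hne : t * Complex.exp (σ : ℂ) ≠ 0 := mul_ne_zero ht (Complex.exp_ne_zero _)
  rw [Ne, theta_eq_zero_iff h0 h1 (pow_ne_zero _ hne)]
  rintro ⟨m, hm⟩
  refine hσD (t ^ (k + 1)) ⟨k, rfl⟩ (pow_ne_zero _ ht) ((k + 1 : ℕ) : ℤ) (by omega) m ?_
  rw [← hm, mul_pow, ← Complex.exp_nat_mul]
  congr 2
  push_cast
  ring

end continuation

/-! ### The two formulas -/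

section formulas

variable {q : ℝ} (h0 : 0 < q) (h1 : q < 1) {n : ℕ} {t τ : ℂ} {a b : Fin 2 → ℂ} {lg : ℂ → ℂ}

lemma qPoch_arg_pair (u v : ℂ) (k : ℕ) :
    (q : ℂ) * u * v⁻¹ * t ^ (-(((k + 1 : ℕ) : ℤ) - 1)) = q * u / (v * t ^ k) := by
  rw [show -(((k + 1 : ℕ) : ℤ) - 1) = -(k : ℤ) by push_cast; ring, zpow_neg, zpow_natCast]
  ring

lemma qPoch_arg_quad (u v w z : ℂ) (k : ℕ) :
    (q : ℂ) * u * v * w⁻¹ * z⁻¹ * t ^ (-(((n + 1 : ℕ) : ℤ) + ((k + 1 : ℕ) : ℤ) - 2)) =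
      q * (u * v) / (w * z * t ^ (n + k)) := by
  rw [show -(((n + 1 : ℕ) : ℤ) + ((k + 1 : ℕ) : ℤ) - 2) = -((n + k : ℕ) : ℤ) by push_cast; ring,
    zpow_neg, zpow_natCast]
  ring

lemma theta_arg_quad (x₁ x₂ : ℂ) (k : ℕ) :
    x₁ * x₂ * b 0 * b 1 * t ^ (((n + 1 : ℕ) : ℤ) + ((k + 1 : ℕ) : ℤ) - 2) =
      b 1 * (b 0 * t ^ n) * x₁ * x₂ * t ^ k := by
  rw [show ((n + 1 : ℕ) : ℤ) + ((k + 1 : ℕ) : ℤ) - 2 = ((n + k : ℕ) : ℤ) by push_cast; ring,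
    zpow_natCast, pow_add]
  ring

lemma C₀_mul_prod (x₁ x₂ : ℂ) :
    C₀ (n + 1) q t a b * ∏ k ∈ Finset.Icc 1 (n + 1),
          theta q (x₁ * x₂ * b 0 * b 1 * t ^ (((n + 1 : ℕ) : ℤ) + k - 2)) /
            ∏ j : Fin 2, (theta q (x₁ * b j * t ^ ((k : ℤ) - 1)) *
              theta q (x₂ * b j * t ^ ((k : ℤ) - 1))) =
      (1 - (q : ℂ)) ^ (n + 1) * sumRHS q n t (fun l => (a l)⁻¹) b x₁ x₂ := by
  unfold C₀ sumRHS numProd denProd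
  rw [prod_Icc_one, prod_Icc_one]
  simp only [qPoch_arg_pair, qPoch_arg_quad, theta_arg_quad]
  simp only [show ∀ k : ℕ, ((k + 1 : ℕ) : ℤ) - 1 = k from fun k => by push_cast; ring,
    zpow_natCast, Finset.prod_div_distrib, Finset.prod_mul_distrib]
  ring

lemma C₁_eq (n : ℕ) (t : ℂ) (a b : Fin 2 → ℂ) :
    C₁ (n + 1) q t a b = (1 - (q : ℂ)) ^ (n + 1) *
      ((∏ k ∈ Finset.range (n + 1), (qPoch q q * qPoch q (q * (t ^ (k + 1))⁻¹))) *
        numProd q n t (fun l => (a l)⁻¹) b /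
      (denProd q n t (fun l => (a l)⁻¹) b * ∏ _k ∈ Finset.range (n + 1), qPoch q (q * t⁻¹))) := by
  unfold C₁ numProd denProd
  rw [prod_Icc_one]
  simp only [qPoch_arg_pair, qPoch_arg_quad]
  simp only [zpow_neg, zpow_natCast, Finset.prod_div_distrib,
    Finset.prod_mul_distrib]
  ring

lemma ConvCond.of_norm (h0 : 0 < q)
    (hconv : ∀ i ∈ Finset.Icc 1 (n + 1), ‖(q : ℂ) * t ^ (2 * (i : ℤ) - 2)‖ < 1 ∧
      q < ‖a 0 * a 1 * b 0 * b 1 * t ^ (2 * (i : ℤ) - 2)‖) :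
    (∀ l, b l ≠ 0) ∧ ConvCond q t (fun l => (a l)⁻¹) b (n + 1) := by
  have hpos := h0.trans (hconv 1 (by simp)).2
  rw [norm_pos_iff] at hpos
  have hall := left_ne_zero_of_mul hpos
  have hb1 := right_ne_zero_of_mul hall
  have hb0 := right_ne_zero_of_mul (left_ne_zero_of_mul hall)
  have ha1 := right_ne_zero_of_mul (left_ne_zero_of_mul (left_ne_zero_of_mul hall))
  have ha0 := left_ne_zero_of_mul (left_ne_zero_of_mul (left_ne_zero_of_mul hall))
  refine ⟨fun l => by fin_cases l; exacts [hb0, hb1], fun k hk => ?_⟩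
  have h := hconv (k + 1) (by simp; omega)
  rw [show 2 * ((k + 1 : ℕ) : ℤ) - 2 = ((2 * k : ℕ) : ℤ) by push_cast; ring, zpow_natCast] at h
  simp only [norm_mul, norm_pow, norm_q h0] at h
  refine ⟨h.1, ?_⟩
  have p0 := norm_pos_iff.2 ha0
  have p1 := norm_pos_iff.2 ha1
  rw [norm_inv, norm_inv, ← mul_inv, ← div_eq_mul_inv, div_lt_iff₀ (by positivity)]
  calc q < _ := h.2
    _ = _ := by ring

include h0 h1

lemma summable_term_zeta {N : ℕ} (hlg : IsQLog q lg) (ht : t = (q : ℂ) ^ τ) (hb : ∀ l, b l ≠ 0)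
    (hc : ConvCond q t (fun l => (a l)⁻¹) b N)
    {x₁ x₂ : ℂ} (hx₁ : x₁ ≠ 0) (hx₂ : x₂ ≠ 0)
    (htk : ∀ k ∈ Finset.range N, qPoch q (t ^ (k + 1)) ≠ 0)
    (hx : ∀ m : ℤ, |m| < N → theta q (x₂ * x₁⁻¹ * t ^ m) ≠ 0)
    (hθb : ∀ k < N, ∀ j, theta q (x₁ * b j * t ^ k) ≠ 0 ∧ theta q (x₂ * b j * t ^ k) ≠ 0) (i : ℕ) :
    Summable (term q τ a b lg (zeta N t i x₁ x₂)) := by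
  have ht0 : t ≠ 0 := ht ▸ q_cpow_ne_zero h0 τ
  have e := funext (term_eq h0 hlg τ a b (zeta_ne_zero ht0 hx₁ hx₂ N i))
  rw [e, ← ht]
  exact (redSum_zeta_continuousAt h0 h1 ht0 hb hc hx₁ hx₂ htk hx hθb i).1.mul_left _

omit h1 in
lemma J_eq {N : ℕ} (hlg : IsQLog q lg) (τ : ℂ) (a b : Fin 2 → ℂ) {x : Fin N → ℂ}
    (hx : ∀ i, x i ≠ 0) : J q τ a b lg x = (1 - (q : ℂ)) ^ N * (powFactor τ lg x *
      ∑' ν, redTerm q ((q : ℂ) ^ τ) (fun l => (a l)⁻¹) b x ν) := by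
  unfold J
  rw [tsum_congr (term_eq h0 hlg τ a b hx), tsum_mul_left]

lemma sum_J_mul_weight (hlg : IsQLog q lg) (ht : t = (q : ℂ) ^ τ) (hb : ∀ l, b l ≠ 0)
    (hc : ConvCond q t (fun l => (a l)⁻¹) b (n + 1)) {x₁ x₂ : ℂ} (hx₁ : x₁ ≠ 0)
    (hx₂ : x₂ ≠ 0) (htk : ∀ k ∈ Finset.range (n + 1), qPoch q (t ^ (k + 1)) ≠ 0)
    (hx : ∀ m : ℤ, |m| < ((n + 1 : ℕ) : ℤ) → theta q (x₂ * x₁⁻¹ * t ^ m) ≠ 0)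
    (hθb : ∀ k < n + 1, ∀ j, theta q (x₁ * b j * t ^ k) ≠ 0 ∧ theta q (x₂ * b j * t ^ k) ≠ 0) :
    ∑ i ∈ Finset.range (n + 1 + 1),
        J q τ a b lg (zeta (n + 1) t i x₁ x₂) * weight (n + 1) q τ lg i x₁ x₂ =
      (1 - (q : ℂ)) ^ (n + 1) * sumRHS q n t (fun l => (a l)⁻¹) b x₁ x₂ := by
  have ht0 : t ≠ 0 := ht ▸ q_cpow_ne_zero h0 τ
  rw [← sum_redWeight h0 h1 ht0 hb hc hx₁ hx₂ htk hx hθb, Finset.mul_sum]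
  refine Finset.sum_congr rfl fun i hi => ?_
  rw [J_eq h0 hlg τ a b (zeta_ne_zero ht0 hx₁ hx₂ (n + 1) i), ← ht,
    ← weight_mul_powFactor hlg ht ht0 (Nat.lt_succ_iff.1 (Finset.mem_range.1 hi)) hx₁ hx₂]
  ring

omit h0 h1 in
lemma powFactor_ne_zero (τ : ℂ) (lg : ℂ → ℂ) {N : ℕ} {x : Fin N → ℂ} (hx : ∀ i, x i ≠ 0) :
    powFactor τ lg x ≠ 0 :=
  mul_ne_zero (Finset.prod_ne_zero_iff.2 fun i _ => hx i)
    (Finset.prod_ne_zero_iff.2 fun _ _ => Finset.prod_ne_zero_iff.2 fun _ _ =>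
      Complex.exp_ne_zero _)

/-- The quotient of the regularized sum by the elliptic Vandermonde product is, up to a constant,
the regularization of `J`. -/
lemma isRegularization_of_regSum_eq_mul {N : ℕ} (hlg : IsQLog q lg) (ht : t = (q : ℂ) ^ τ)
    (hb : ∀ l, b l ≠ 0) (hc : ConvCond q t (fun l => (a l)⁻¹) b N) {F : (Fin N → ℂ) → ℂ}
    (hd : ∀ x, (∀ i, x i ≠ 0) → DifferentiableAt ℂ F x)
    (hF : ∀ x, (∀ i, x i ≠ 0) →
      regSum q t (fun l => (a l)⁻¹) b x = F x * thetaVandermonde q x) :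
    IsRegularization q τ a b lg fun x => (1 - (q : ℂ)) ^ N * F x := by
  have ht0 : t ≠ 0 := ht ▸ q_cpow_ne_zero h0 τ
  refine ⟨fun x hx => ((hd x hx).const_mul _).differentiableWithinAt, fun x hx hθ hp => ?_⟩
  have hp2 : ∀ i j, i < j → theta q (t * (x j / x i)) ≠ 0 := fun i j hij => by
    rw [ht]
    exact (hp i j hij).2
  have hred := redTerm_eq h0 h1 ht0 (α := fun l => (a l)⁻¹) hb hx hθ hp2
  have hden := denFactor_ne_zero hx hθ hp2
  have hpow := powFactor_ne_zero τ lg hx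
  have hV : thetaVandermonde q x ≠ 0 :=
    Finset.prod_ne_zero_iff.2 fun i _ => Finset.prod_ne_zero_iff.2 fun j hj =>
      mul_ne_zero (hx i) (hp i j (Finset.mem_Ioi.1 hj)).1
  have hh := h_mul_denFactor τ lg (b := b) hθ fun i j hij => (hp i j hij).2
  constructor
  · rw [funext (term_eq h0 hlg τ a b hx), ← ht, funext hred]
    exact ((regTerm_summable h0 h1 ht0 hb hc hx).div_const _).mul_left _
  · have hsum : ∑' ν, regTerm q t (fun l => (a l)⁻¹) b x ν = F x * thetaVandermonde q x := hF x hx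
    rw [J_eq h0 hlg τ a b hx, ← ht, tsum_congr hred, tsum_div_const, hsum]
    rw [← ht] at hh
    have hh0 : h q τ b lg x ≠ 0 := fun hz => by
      rw [hz, zero_mul] at hh
      exact mul_ne_zero hpow hV hh.symm
    rw [eq_div_iff hh0, mul_assoc]
    congr 1
    rw [← mul_div_assoc, eq_div_iff hden]
    linear_combination F x * hh

lemma sum_regularization_mul_H (ht : t ≠ 0) (hb : ∀ l, b l ≠ 0)
    (hc : ConvCond q t (fun l => (a l)⁻¹) b (n + 1))
    (hθ : ∀ k ∈ Finset.range (n + 1), theta q (t ^ (k + 1)) ≠ 0) {F : (Fin (n + 1) → ℂ) → ℂ}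
    (hF : ∀ x, (∀ i, x i ≠ 0) →
      regSum q t (fun l => (a l)⁻¹) b x = F x * thetaVandermonde q x)
    (hsym : ∀ (σ : Equiv.Perm (Fin (n + 1))) (x : Fin (n + 1) → ℂ), (∀ i, x i ≠ 0) →
      F (x ∘ σ) = F x)
    (hV : ∀ x : Fin (n + 1) → ℂ, (∀ i, x i ≠ 0) → ∀ k,
        IsTwoTheta q (b 0 * b 1 * t ^ n) (fun y => F (Function.update x k y)))
    {x₁ x₂ : ℂ} (hx₁ : x₁ ≠ 0) (hx₂ : x₂ ≠ 0)
    (hx : ∀ m : ℤ, |m| < ((n + 1 : ℕ) : ℤ) → theta q (x₂ * x₁⁻¹ * t ^ m) ≠ 0)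
    (hκ : ∀ l ∈ Finset.range (n + 1), theta q (b 1 * (b 0 * t ^ n) * x₁ * x₂ * t ^ l) ≠ 0) :
    ∑ i ∈ Finset.range (n + 1 + 1), (1 - (q : ℂ)) ^ (n + 1) * F (zeta (n + 1) t i x₁ x₂) *
      H (n + 1) q t b i x₁ x₂ = C₁ (n + 1) q t a b := by
  have hκ0 : ∏ l ∈ Finset.range (n + 1), theta q (b 1 * (b 0 * t ^ n) * x₁ * x₂ * t ^ l) ≠ 0 :=
    Finset.prod_ne_zero_iff.2 hκ
  have hq0 : ∏ _k ∈ Finset.range (n + 1), qPoch q (q * t⁻¹) ≠ 0 := by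
    have := hθ 0 (by simp)
    rw [zero_add, pow_one] at this
    exact Finset.prod_ne_zero_iff.2 fun _ _ => right_ne_zero_of_mul this
  rw [C₁_eq, ← quotient_at_cone h0 h1 ht hb hc hθ hF,
    mul_div_cancel_right₀ _ (mul_ne_zero (denProd_ne_zero h0 h1 ht hb hc) hq0)]
  refine mul_right_cancel₀ hκ0 ?_
  rw [mul_assoc ((1 - (q : ℂ)) ^ (n + 1)), mul_comm (F _), ← sum_interpCoeff h0 h1 ht hb hθ hsym hV hx₁ hx₂ hx,
    Finset.sum_mul, Finset.mul_sum]
  refine Finset.sum_congr rfl fun i hi => ?_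
  rw [← H_mul_prod (Nat.lt_succ_iff.1 (Finset.mem_range.1 hi)) ht hκ]
  ring

end formulas

end

end SelbergJackson

theorem theorem1 (n : ℕ) (q : ℝ) (hq₀ : 0 < q) (hq₁ : q < 1)
    (τ t : ℂ) (ht : t = (q : ℂ) ^ τ) (a b : Fin 2 → ℂ)
    (lg : ℂ → ℂ) (hlg : IsQLog q lg)
    -- the convergence condition
    (hconv : ∀ i ∈ Finset.Icc 1 n, ‖(q : ℂ) * t ^ (2 * (i : ℤ) - 2)‖ < 1 ∧
      q < ‖a 0 * a 1 * b 0 * b 1 * t ^ (2 * (i : ℤ) - 2)‖)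
    -- the denominators `(t^k)_∞` do not vanish
    (htk : ∀ k ∈ Finset.Icc 1 n, qPoch q (t ^ (k : ℤ)) ≠ 0) :
    -- the formula for `J`
    (∀ x₁ x₂ : ℂ, x₁ ≠ 0 → x₂ ≠ 0 →
      (∀ k ∈ Finset.Icc 1 n, ∀ j : Fin 2,
        theta q (x₁ * b j * t ^ ((k : ℤ) - 1)) ≠ 0 ∧
        theta q (x₂ * b j * t ^ ((k : ℤ) - 1)) ≠ 0) →
      (∀ m : ℤ, |m| < n → theta q (x₂ * x₁⁻¹ * t ^ m) ≠ 0) →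
      (∀ i ∈ Finset.range (n + 1), Summable (term q τ a b lg (zeta n t i x₁ x₂))) ∧
      ∑ i ∈ Finset.range (n + 1),
          J q τ a b lg (zeta n t i x₁ x₂) * weight n q τ lg i x₁ x₂ =
        C₀ n q t a b * ∏ k ∈ Finset.Icc 1 n,
          theta q (x₁ * x₂ * b 0 * b 1 * t ^ ((n : ℤ) + k - 2)) /
            ∏ j : Fin 2, (theta q (x₁ * b j * t ^ ((k : ℤ) - 1)) *
              theta q (x₂ * b j * t ^ ((k : ℤ) - 1)))) ∧
    -- the formula for the regularization of `J`
    ((∀ k ∈ Finset.Icc 1 n, theta q (t ^ (k : ℤ)) ≠ 0) →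
      ∃ F : (Fin n → ℂ) → ℂ, IsRegularization q τ a b lg F ∧
        ∀ x₁ x₂ : ℂ, x₁ ≠ 0 → x₂ ≠ 0 →
          (∀ m : ℤ, |m| < n → theta q (x₂ * x₁⁻¹ * t ^ m) ≠ 0) →
          (∀ l ∈ Finset.Icc 1 n,
            theta q (x₁ * x₂ * b 0 * b 1 * t ^ ((n : ℤ) + l - 2)) ≠ 0) →
          ∑ i ∈ Finset.range (n + 1), F (zeta n t i x₁ x₂) * H n q t b i x₁ x₂ =
            C₁ n q t a b) := by
  rcases n with _ | n
  · have hJ : ∀ x : Fin 0 → ℂ, J q τ a b lg x = 1 := fun x => by simp [J, term, Phi, Delta]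
    have hs : ∀ x : Fin 0 → ℂ, Summable (term q τ a b lg x) := fun x => (hasSum_fintype _).summable
    refine ⟨fun x₁ x₂ _ _ _ _ => ⟨fun i _ => hs _, by simp [hJ, weight, C₀]⟩, fun _ =>
      ⟨fun _ => 1, ⟨differentiableOn_const _, fun x _ _ _ => ⟨hs x, by simp [hJ, h]⟩⟩, ?_⟩⟩
    intro x₁ x₂ _ _ _ _
    simp [H, C₁]
  have ht0 : t ≠ 0 := ht ▸ q_cpow_ne_zero hq₀ τ
  obtain ⟨hb, hc⟩ := ConvCond.of_norm hq₀ hconv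
  refine ⟨fun x₁ x₂ hx₁ hx₂ hθb hx => ?_, fun hθ => ?_⟩
  · have htk' : ∀ k ∈ Finset.range (n + 1), qPoch q (t ^ (k + 1)) ≠ 0 := fun k hk => by
      have := htk (k + 1) (by simpa [Nat.succ_le_iff] using hk)
      rwa [zpow_natCast] at this
    have hθb' : ∀ k < n + 1, ∀ j, theta q (x₁ * b j * t ^ k) ≠ 0 ∧
        theta q (x₂ * b j * t ^ k) ≠ 0 := fun k hk j => by
      have := hθb (k + 1) (by simpa [Nat.succ_le_iff] using hk) j
      rwa [show ((k + 1 : ℕ) : ℤ) - 1 = k by push_cast; ring, zpow_natCast] at this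
    exact ⟨fun i _ => summable_term_zeta hq₀ hq₁ hlg ht hb hc hx₁ hx₂ htk' hx hθb' i,
      (sum_J_mul_weight hq₀ hq₁ hlg ht hb hc hx₁ hx₂ htk' hx hθb').trans
        (C₀_mul_prod x₁ x₂).symm⟩
  · have hθ' : ∀ k ∈ Finset.range (n + 1), theta q (t ^ (k + 1)) ≠ 0 := fun k hk => by
      have := hθ (k + 1) (by simpa [Nat.succ_le_iff] using hk)
      rwa [zpow_natCast] at this
    obtain ⟨F, hd, hF, hsym, hV⟩ := exists_regSum_eq_mul hq₀ hq₁ ht0 hb hc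
    refine ⟨_, isRegularization_of_regSum_eq_mul hq₀ hq₁ hlg ht hb hc hd hF,
      fun x₁ x₂ hx₁ hx₂ hx hκ => ?_⟩
    refine sum_regularization_mul_H hq₀ hq₁ ht0 hb hc hθ' hF hsym hV hx₁ hx₂ hx fun l hl => ?_
    rw [← theta_arg_quad]
    exact hκ (l + 1) (by simpa [Nat.succ_le_iff] using hl)
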